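/- **Setting.** There are $n\ge 1$ jobs with processing times $p_1,\dots,p_n>0$ and $m\ge 1$ identical machines; $OPT$ is the minimum makespan. A *weighted random sample* is job $j$ (its name and $p_j$) with probability $p_j/\sum_i p_i$, independently of the other samples. Algorithms run on a real RAM with unit-cost instructions (integer and real registers and arrays; comparisons; addition, truncated subtraction and halving of integers; the four arithmetic operations on reals; no rounding of reals). Drawing a sample costs one step. An algorithm is *non-adaptive* if it computes the number $K$ of samples from the known parameters alone and then draws all samples in one round. It may call a black-box approximation scheme for makespan minimization: given $N$ jobs, $m$ machines and $\alpha\in(0,1)$, the scheme returns a schedule of makespan at most $(1+\alpha)$ times the optimum. $A(N,\alpha)$, which may also depend on $m$, is any bound on the running time of the scheme for at most $N$ jobs; a call with $N$ jobs costs the running time of the scheme plus $N+1$ steps. A *sketch schedule* consists of an integer $t$, reals $\delta$ and $p'_{\max}$, and numbers $\tilde n_{i,k}$ for $1\le i\le m$, $1\le k\le t$, meaning that $\tilde n_{i,k}$ jobs of the rounded processing time $\tilde p_k=p'_{\max}(1-\delta)^{k-1}$ are put on machine $i$. Its size is the number of stored numbers, $mt+t+2$. Write $I_k=(\tilde p_{k+1},\tilde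 p_k]$, $n_k=|\{j: p_j\in I_k\}|$, $\tilde n_k=\sum_i\tilde n_{i,k}$. A schedule of the jobs is *generated* from the sketch schedule if for every $k\le t$ with $\tilde n_k>0$: if $n_k\le\tilde n_k$, then every machine $i$ gets at most $\tilde n_{i,k}$ jobs from $I_k$; if $n_k>\tilde n_k$, then there is a machine $i_0$ with $\tilde n_{i_0,k}=\max_i\tilde n_{i,k}$ such that every machine $i\ne i_0$ gets exactly $\tilde n_{i,k}$ jobs from $I_k$, and $i_0$ gets the others. All remaining jobs may be put on any machine. **Theorem.** There are a non-adaptive weighted sampling algorithm (one program, with no other source of randomness, that uses the approximation scheme only as a black box) and constants $C,c$ such that the following holds for every black-box scheme with running time bound $A$, all $n,m\ge1$, all $\varepsilon,\gamma\in(0,1)$ and all processing times $p_1,\dots,p_n>0$, where the algorithm is given $n,m,\varepsilon,\gamma$. 1. For every outcome of the sampling, the algorithm halts after at most $$C\,\Bigl(\ln\bigl(\tfrac{nm}{\varepsilon\gamma}+2\bigr)\Bigr)^{c}\Bigl(\tfrac{m^5}{\varepsilon^4}\sqrt n+A\bigl(\lceil \tfrac m\varepsilon\rceil,\varepsilon\bigr)\Bigr)$$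 steps, that is, in time $\tilde O\bigl(\tfrac{m^5}{\varepsilon^4}\sqrt n+A(\lceil m/\varepsilon\rceil,\varepsilon)\bigr)$. It outputs a real number $X$ and a sketch schedule, whose size is at most $C\,\tfrac{m^2}{\varepsilon^2}\ln(mn^2)$ whenever $mn\ge2$. 2. With probability at least $1-\gamma$ all of the following hold: $OPT\le X\le(1+\varepsilon)\,OPT$; the sketch schedule satisfies $0<\delta<1$ and $p_j\le p'_{\max}$ for all $j$; and there are schedules of the jobs that are generated from the sketch schedule, and all of them have makespan at most $(1+3\varepsilon)\,OPT$. -/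

import Mathlib

noncomputable section

namespace Makespan

/-! ## Makespan minimization on identical machines -/

/-- The total processing time that the assignment `σ` puts on machine `i`. -/
def load {n m : ℕ} (p : Fin n → ℝ) (σ : Fin n → Fin m) (i : Fin m) : ℝ :=
  ∑ j with σ j = i, p j

/-- The makespan of a schedule: every machine processes its jobs one after the other from time 0. -/
def makespan {n m : ℕ} (p : Fin n → ℝ) (σ : Fin n → Fin m) : ℝ :=
  ⨆ i, load p σ i

/-- The minimum makespan of the jobs `p` on `m` machines. -/
def opt {n : ℕ} (m : ℕ) (p : Fin n → ℝ) : ℝ :=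
  ⨅ σ : Fin n → Fin m, makespan p σ

/-! ## Black-box approximation schemes -/

/-- A procedure which, given the number `m` of machines, `N` jobs with their processing times and
an accuracy `α`, returns a machine for each job (the machines being `0, …, m - 1`), together with
the number of steps that it uses on this input. -/
structure BlackBox where
  schedule : (m N : ℕ) → (Fin N → ℝ) → (α : ℝ) → Fin N → ℕ
  time : (m N : ℕ) → (Fin N → ℝ) → (α : ℝ) → ℕ

/-- The black box always returns a schedule of makespan at most `(1 + α) * OPT`. -/
def BlackBox.IsApproximationScheme (B : BlackBox) : Prop :=
  ∀ (m N : ℕ) (p : Fin N → ℝ) (α : ℝ), 1 ≤ m → (∀ j, 0 < p j) → 0 < α → α < 1 →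
    ∃ σ : Fin N → Fin m, (∀ j, (σ j : ℕ) = B.schedule m N p α j) ∧
      makespan p σ ≤ (1 + α) * opt m p

/-- `A m N α` bounds the time that the black box needs for at most `N` jobs on `m` machines with
accuracy `α`. -/
def BlackBox.RunsInTime (B : BlackBox) (A : ℕ → ℕ → ℝ → ℕ) : Prop :=
  ∀ (m N N' : ℕ) (p : Fin N' → ℝ) (α : ℝ), 1 ≤ m → N' ≤ N → (∀ j, 0 < p j) → 0 < α → α < 1 →
    B.time m N' p α ≤ A m N α

/-! ## A real RAM with unit-cost operations

Integer and real registers, and integer and real arrays with integer addresses. There is no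
rounding of real numbers to integers, and no constant other than the natural numbers written in
the program. -/

/-- A memory configuration. -/
structure State where
  nat : ℕ → ℕ
  real : ℕ → ℝ
  natArr : ℕ → ℕ → ℕ
  realArr : ℕ → ℕ → ℝ

/-- The elementary instructions. Arguments are names (numbers) of registers and of arrays; the
first one is the target. -/
inductive Instr
  | natConst (x c : ℕ)
  | natAdd (x y z : ℕ)
  | natSub (x y z : ℕ)
  | natHalf (x y : ℕ)
  | natLoad (x a i : ℕ)
  | natStore (a i x : ℕ)
  | realCast (r x : ℕ)
  | realAdd (r s t : ℕ)
  | realSub (r s t : ℕ)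
  | realMul (r s t : ℕ)
  | realDiv (r s t : ℕ)
  | realLoad (r a i : ℕ)
  | realStore (a i r : ℕ)

def State.setNat (s : State) (x v : ℕ) : State :=
  { s with nat := Function.update s.nat x v }

def State.setReal (s : State) (r : ℕ) (v : ℝ) : State :=
  { s with real := Function.update s.real r v }

def State.setNatArr (s : State) (a : ℕ) (v : ℕ → ℕ) : State :=
  { s with natArr := Function.update s.natArr a v }

def State.setRealArr (s : State) (a : ℕ) (v : ℕ → ℝ) : State :=
  { s with realArr := Function.update s.realArr a v }

/-- The effect of an elementary instruction. -/
def Instr.apply : Instr → State → State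
  | natConst x c, s => s.setNat x c
  | natAdd x y z, s => s.setNat x (s.nat y + s.nat z)
  | natSub x y z, s => s.setNat x (s.nat y - s.nat z)
  | natHalf x y, s => s.setNat x (s.nat y / 2)
  | natLoad x a i, s => s.setNat x (s.natArr a (s.nat i))
  | natStore a i x, s => s.setNatArr a (Function.update (s.natArr a) (s.nat i) (s.nat x))
  | realCast r x, s => s.setReal r (s.nat x : ℝ)
  | realAdd r u v, s => s.setReal r (s.real u + s.real v)
  | realSub r u v, s => s.setReal r (s.real u - s.real v)
  | realMul r u v, s => s.setReal r (s.real u * s.real v)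
  | realDiv r u v, s => s.setReal r (s.real u / s.real v)
  | realLoad r a i, s => s.setReal r (s.realArr a (s.nat i))
  | realStore a i r, s => s.setRealArr a (Function.update (s.realArr a) (s.nat i) (s.real r))

/-- The tests: comparison of two registers. -/
inductive Test
  | natLt (x y : ℕ)
  | realLt (r s : ℕ)

def Test.Holds : Test → State → Prop
  | natLt x y, s => s.nat x < s.nat y
  | realLt u v, s => s.real u < s.real v

/-- Programs: finite texts built from instructions, sequencing, branching, loops, and calls of the
black box. -/
inductive Prog
  | instr (i : Instr)
  | seq (P Q : Prog)
  | ite (c : Test) (P Q : Prog)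
  | loop (c : Test) (P : Prog)
  | call (mReg nReg αReg inArr outArr : ℕ)

/-- The first `N` cells of a real array. -/
def State.jobs (s : State) (a N : ℕ) : Fin N → ℝ := fun j => s.realArr a j

/-- Write the numbers `v 0, …, v (N - 1)` into the first `N` cells of an integer array. -/
def State.writeNats (s : State) (a : ℕ) {N : ℕ} (v : Fin N → ℕ) : State :=
  s.setNatArr a fun i => if h : i < N then v ⟨i, h⟩ else s.natArr a i

/-- Write the numbers `v 0, …, v (N - 1)` into the first `N` cells of a real array. -/
def State.writeReals (s : State) (a : ℕ) {N : ℕ} (v : Fin N → ℝ) : State :=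
  s.setRealArr a fun i => if h : i < N then v ⟨i, h⟩ else s.realArr a i

/-- `Exec B P s s' c`: started in `s`, the program `P` halts in `s'` after `c` steps. An
instruction or a test is one step; a call of the black box on `N` jobs costs the time of the black
box, and `N + 1` steps for handing over the data. -/
inductive Exec (B : BlackBox) : Prog → State → State → ℕ → Prop
  | instr (i : Instr) (s : State) : Exec B (.instr i) s (i.apply s) 1
  | seq {P Q : Prog} {s s' s'' : State} {a b : ℕ} :
      Exec B P s s' a → Exec B Q s' s'' b → Exec B (.seq P Q) s s'' (a + b)
  | ite_true {c : Test} {P Q : Prog} {s s' : State} {a : ℕ} :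
      c.Holds s → Exec B P s s' a → Exec B (.ite c P Q) s s' (a + 1)
  | ite_false {c : Test} {P Q : Prog} {s s' : State} {a : ℕ} :
      ¬ c.Holds s → Exec B Q s s' a → Exec B (.ite c P Q) s s' (a + 1)
  | loop_true {c : Test} {P : Prog} {s s' s'' : State} {a b : ℕ} :
      c.Holds s → Exec B P s s' a → Exec B (.loop c P) s' s'' b →
      Exec B (.loop c P) s s'' (a + b + 1)
  | loop_false {c : Test} {P : Prog} {s : State} :
      ¬ c.Holds s → Exec B (.loop c P) s s 1
  | call (x y r inArr outArr : ℕ) (s : State) :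
      Exec B (.call x y r inArr outArr) s
        (s.writeNats outArr
          (B.schedule (s.nat x) (s.nat y) (s.jobs inArr (s.nat y)) (s.real r)))
        (B.time (s.nat x) (s.nat y) (s.jobs inArr (s.nat y)) (s.real r) + s.nat y + 1)

/-! ## Non-adaptive weighted sampling -/

/-- The probability of the event `E` for `K` independent weighted random samples (with
replacement): each sample is job `j` with probability `p j / ∑ i, p i`. -/
def sampleProb {n : ℕ} (p : Fin n → ℝ) (K : ℕ) (E : Set (Fin K → Fin n)) : ℝ :=
  ∑ ω, E.indicator (fun ω => ∏ i, p (ω i) / ∑ j, p j) ω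

/-- A non-adaptive sampling algorithm: the first program sees only the parameters and fixes the
number of samples; then all samples are drawn in one round, and the second program processes
them. There is no other source of randomness. -/
structure SamplingAlgorithm where
  plan : Prog
  main : Prog

/-- The parameters `n`, `m`, `ε`, `γ` are in the first registers; the rest of the memory is 0. -/
def initState (n m : ℕ) (ε γ : ℝ) : State where
  nat x := if x = 0 then n else if x = 1 then m else 0
  real r := if r = 0 then ε else if r = 1 then γ else 0
  natArr _ _ := 0
  realArr _ _ := 0

/-- Each sample consists of the name and the processing time of the sampled job. -/
def State.loadSamples (s : State) {n K : ℕ} (p : Fin n → ℝ) (ω : Fin K → Fin n) : State :=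
  (s.writeNats 0 (fun i => (ω i : ℕ))).writeReals 0 (fun i => p (ω i))

/-- With parameters `n`, `m`, `ε`, `γ`, the algorithm draws `K` samples from the jobs `p`; if the
outcome of the sampling is `ω`, then it halts in the configuration `out` after `time` steps, where
drawing a sample is one step. -/
def SamplingAlgorithm.Runs (alg : SamplingAlgorithm) (B : BlackBox) {n : ℕ} (m : ℕ) (ε γ : ℝ)
    (p : Fin n → ℝ) {K : ℕ} (ω : Fin K → Fin n) (out : State) (time : ℕ) : Prop :=
  ∃ (s : State) (a b : ℕ), Exec B alg.plan (initState n m ε γ) s a ∧ s.nat 2 = K ∧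
    Exec B alg.main (s.loadSamples p ω) out b ∧ time = a + K + b

/-! ## Sketch schedules -/

/-- A sketch schedule for `m` machines: `t` job classes, the `k`-th one (`k = 0, …, t - 1`) with
the rounded processing time `top * (1 - delta) ^ k`, and the number `count i k` of jobs of the
`k`-th class on machine `i`. -/
structure SketchSchedule (m : ℕ) where
  t : ℕ
  delta : ℝ
  top : ℝ
  count : Fin m → Fin t → ℕ

namespace SketchSchedule

variable {m : ℕ} (S : SketchSchedule m)

/-- The number of stored numbers: `m * t` counts, `t` rounded processing times, and the two
parameters of the rounding. -/
def size : ℕ := m * S.t + S.t + 2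

/-- The rounded processing time of the `k`-th class. -/
def procTime (k : ℕ) : ℝ := S.top * (1 - S.delta) ^ k

/-- The estimated number of jobs in the `k`-th class. -/
def total (k : Fin S.t) : ℕ := ∑ i, S.count i k

open scoped Classical in
/-- The jobs of the instance `p` whose processing time rounds up to that of the `k`-th class. -/
def jobClass {n : ℕ} (p : Fin n → ℝ) (k : ℕ) : Finset (Fin n) :=
  {j | p j ∈ Set.Ioc (S.procTime (k + 1)) (S.procTime k)}

/-- The rounding is a geometric one that covers all processing times of the instance `p`. -/
def Covers {n : ℕ} (p : Fin n → ℝ) : Prop :=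
  0 < S.delta ∧ S.delta < 1 ∧ ∀ j, p j ≤ S.top

/-- The schedule `σ` of the jobs `p` is generated from the sketch schedule. In every class that
occurs in the sketch, the jobs are placed into the slots that the sketch schedule has for this
class; if there are more jobs than slots, then all slots are used and the excess jobs are put on a
machine with the largest number of slots for this class. Jobs of all other classes may be put on
any machine. -/
def Generates {n : ℕ} (p : Fin n → ℝ) (σ : Fin n → Fin m) : Prop :=
  ∀ k : Fin S.t, 0 < S.total k →
    ((S.jobClass p k).card ≤ S.total k →
      ∀ i, {j ∈ S.jobClass p k | σ j = i}.card ≤ S.count i k) ∧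
    (S.total k < (S.jobClass p k).card →
      ∃ i₀, (∀ i, S.count i k ≤ S.count i₀ k) ∧
        ∀ i, i ≠ i₀ → {j ∈ S.jobClass p k | σ j = i}.card = S.count i k)

end SketchSchedule

/-- The output value of a computation. -/
def State.value (s : State) : ℝ := s.real 0

/-- The sketch schedule that a computation outputs; the counts are stored row by row in an
integer array. -/
def State.sketch (s : State) (m : ℕ) : SketchSchedule m where
  t := s.nat 0
  delta := s.real 1
  top := s.real 2
  count i k := s.natArr 0 (i * s.nat 0 + k)

end Makespan

end

open Makespan

/-!
Write `W` for the total processing time and `OPT` for the minimum makespan, so that a sample is the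
job `j` with probability `p j / W`.

*The total processing time.* A pair of samples hits the same job `j` with probability `(p j / W) ^
2`, so the sum of `1 / p j` over all colliding pairs has mean `1 / W` times the number of pairs.
Different pairs are uncorrelated, and with about `m / ε * √n` samples or more Chebyshev's inequality
gives relative error `O(ε / m)` with constant probability (`eventProb_collisions_le`). The median
over `R` groups of samples is wrong with probability at most `2⁻ᴿ` (`eventProb_half_le`). A slightly
enlarged inverse of the median is an upper bound `V` of `W` with `V ≤ (1 + ε / (16 * m)) * W`
(`Good.totalEst_bounds`).

*The value.* A job is big if its processing time exceeds `θ = ε * V / m`, and medium if it is not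
big but exceeds a second threshold, which is `θ` times a factor between multiples of `ε ^ 2` and
`ε`. All big and medium jobs are sampled (`Good.sampled`). At most `m / ε` jobs are big, and the
black box schedules them. The value `X` is the larger one of its makespan and of `V / m + (1 - 1 /
m) * θ`; list scheduling of the other jobs stays below `X`, so `OPT ≤ X`, and `X ≤ (1 + ε) * OPT`
because `V` is so close to `W` that the term `- θ / m` compensates for the error
(`Result.opt_le_value`, `Result.value_le`). This is why the relative error of `V` has to be as small
as `O(ε / m)`.

*The sketch schedule.* The thresholds are boundaries between classes. The medium jobs are put on
machines of minimum load, which keeps all loads at most `X`, and the slots for big and medium jobs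
are those that these jobs occupy. For a class of small jobs, only the number of samples is known. By
a Chernoff bound for the lower tail, a slightly enlarged multiple of this number, plus an additive
error, is an upper bound of the total processing time of the class. The class depends on the samples
through `V`, and therefore the bound is needed for all intervals of processing times at once; there
are at most `n ^ 2` of them. All these estimates together fit into the capacity that remains if each
machine may have load `X + θ / 8` (`Result.sum_classEst_le`): the big and medium jobs are known
exactly and are also hit about as often as expected, which leaves few samples for the small jobs.
The slots of each class of small jobs are distributed in proportion to the free capacities of the
machines. There are enough slots for all classes, and hence a machine in a generated schedule has
load at most `(X + θ / 8) / (1 - δ)`, plus `O(θ)` with small constants for rounding the numbers of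
slots up and for the jobs outside of all classes; this is at most `(1 + 3 * ε) * OPT`
(`Result.makespan_le`).

*The program.* `Tr` is a triple for total correctness with a bound for the number of steps. Its
rules provide that locations which are not targets in a program keep their contents (`Frame`). The
lemmas `planProg_spec` and `mainProg_spec` describe the two programs of the algorithm for arbitrary
outcomes of the sampling, `sampleProb_good` says that the samples are representative with
probability at least `1 - γ`, and `Setting.time_le` and `Setting.size_le` bound the time and the
size of the output. As there are no roots, logarithms or roundings among the instructions, all
parameters are powers of two that are found by repeated doubling, and numbers of slots are rounded
up by computing binary digits.
-/

namespace Makespan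

/-! ### Program logic for the real RAM -/

@[simp] theorem State.setNat_nat (s : State) (x v y : ℕ) :
    (s.setNat x v).nat y = if y = x then v else s.nat y := by
  simp [State.setNat, Function.update_apply]
@[simp] theorem State.setNat_real (s : State) (x v : ℕ) : (s.setNat x v).real = s.real := rfl
@[simp] theorem State.setNat_natArr (s : State) (x v : ℕ) : (s.setNat x v).natArr = s.natArr := rfl
@[simp] theorem State.setNat_realArr (s : State) (x v : ℕ) :
    (s.setNat x v).realArr = s.realArr := rfl
@[simp] theorem State.setReal_real (s : State) (x : ℕ) (v : ℝ) (y : ℕ) :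
    (s.setReal x v).real y = if y = x then v else s.real y := by
  simp [State.setReal, Function.update_apply]
@[simp] theorem State.setReal_nat (s : State) (x : ℕ) (v : ℝ) : (s.setReal x v).nat = s.nat := rfl
@[simp] theorem State.setReal_natArr (s : State) (x : ℕ) (v : ℝ) :
    (s.setReal x v).natArr = s.natArr := rfl
@[simp] theorem State.setReal_realArr (s : State) (x : ℕ) (v : ℝ) :
    (s.setReal x v).realArr = s.realArr := rfl
@[simp] theorem State.setNatArr_natArr (s : State) (a : ℕ) (v : ℕ → ℕ) (b : ℕ) :
    (s.setNatArr a v).natArr b = if b = a then v else s.natArr b := by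
  simp [State.setNatArr, Function.update_apply]
@[simp] theorem State.setNatArr_nat (s : State) (a : ℕ) (v : ℕ → ℕ) :
    (s.setNatArr a v).nat = s.nat := rfl
@[simp] theorem State.setNatArr_real (s : State) (a : ℕ) (v : ℕ → ℕ) :
    (s.setNatArr a v).real = s.real := rfl
@[simp] theorem State.setNatArr_realArr (s : State) (a : ℕ) (v : ℕ → ℕ) :
    (s.setNatArr a v).realArr = s.realArr := rfl
@[simp] theorem State.setRealArr_realArr (s : State) (a : ℕ) (v : ℕ → ℝ) (b : ℕ) :
    (s.setRealArr a v).realArr b = if b = a then v else s.realArr b := by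
  simp [State.setRealArr, Function.update_apply]
@[simp] theorem State.setRealArr_nat (s : State) (a : ℕ) (v : ℕ → ℝ) :
    (s.setRealArr a v).nat = s.nat := rfl
@[simp] theorem State.setRealArr_real (s : State) (a : ℕ) (v : ℕ → ℝ) :
    (s.setRealArr a v).real = s.real := rfl
@[simp] theorem State.setRealArr_natArr (s : State) (a : ℕ) (v : ℕ → ℝ) :
    (s.setRealArr a v).natArr = s.natArr := rfl

/-- The effect of a list of elementary instructions. -/
noncomputable def Instr.run : List Instr → State → State
  | [], s => s
  | i :: l, s => Instr.run l (i.apply s)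

@[simp] theorem Instr.run_nil (s : State) : Instr.run [] s = s := rfl
@[simp] theorem Instr.run_cons (i : Instr) (l : List Instr) (s : State) :
    Instr.run (i :: l) s = Instr.run l (i.apply s) := rfl

attribute [simp] Instr.apply Test.Holds

/-- An instruction without relevant effect: the integer register `10` is not used otherwise. -/
def Prog.nop : Prog := .instr (.natConst 10 0)

/-- Straight-line code. -/
def Prog.block : List Instr → Prog
  | [] => .nop
  | [i] => .instr i
  | i :: j :: l => .seq (.instr i) (Prog.block (j :: l))

/-- `for x = 0, …, y - 1 do P`; register `3` has to contain `1`. -/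
def Prog.forNat (x y : ℕ) (P : Prog) : Prog :=
  .seq (.instr (.natConst x 0)) (.loop (.natLt x y) (.seq P (.instr (.natAdd x x 3))))

infixr:60 " ;; " => Prog.seq

/-- Whether the instruction writes the integer register `x`. -/
def Instr.wNat : Instr → ℕ → Bool
  | natConst y _, x => x == y
  | natAdd y _ _, x => x == y
  | natSub y _ _, x => x == y
  | natHalf y _, x => x == y
  | natLoad y _ _, x => x == y
  | _, _ => false

/-- Whether the instruction writes the real register `x`. -/
def Instr.wReal : Instr → ℕ → Bool
  | realCast y _, x => x == y
  | realAdd y _ _, x => x == y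
  | realSub y _ _, x => x == y
  | realMul y _ _, x => x == y
  | realDiv y _ _, x => x == y
  | realLoad y _ _, x => x == y
  | _, _ => false

/-- Whether the instruction writes the integer array `x`. -/
def Instr.wNatArr : Instr → ℕ → Bool
  | natStore a _ _, x => x == a
  | _, _ => false

/-- Whether the instruction writes the real array `x`. -/
def Instr.wRealArr : Instr → ℕ → Bool
  | realStore a _ _, x => x == a
  | _, _ => false

/-- Whether the integer register `x` occurs as a target in the program. -/
def Prog.wNat : Prog → ℕ → Bool
  | instr i, x => i.wNat x
  | seq P Q, x => P.wNat x || Q.wNat x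
  | ite _ P Q, x => P.wNat x || Q.wNat x
  | loop _ P, x => P.wNat x
  | call .., _ => false

/-- Whether the real register `x` occurs as a target in the program. -/
def Prog.wReal : Prog → ℕ → Bool
  | instr i, x => i.wReal x
  | seq P Q, x => P.wReal x || Q.wReal x
  | ite _ P Q, x => P.wReal x || Q.wReal x
  | loop _ P, x => P.wReal x
  | call .., _ => false

/-- Whether the integer array `x` occurs as a target in the program. -/
def Prog.wNatArr : Prog → ℕ → Bool
  | instr i, x => i.wNatArr x
  | seq P Q, x => P.wNatArr x || Q.wNatArr x
  | ite _ P Q, x => P.wNatArr x || Q.wNatArr x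
  | loop _ P, x => P.wNatArr x
  | call _ _ _ _ o, x => x == o

/-- Whether the real array `x` occurs as a target in the program. -/
def Prog.wRealArr : Prog → ℕ → Bool
  | instr i, x => i.wRealArr x
  | seq P Q, x => P.wRealArr x || Q.wRealArr x
  | ite _ P Q, x => P.wRealArr x || Q.wRealArr x
  | loop _ P, x => P.wRealArr x
  | call .., _ => false

/-- The two states agree on everything that does not occur as a target in the program. -/
structure Frame (P : Prog) (s s' : State) : Prop where
  nat : ∀ x, P.wNat x = false → s'.nat x = s.nat x
  real : ∀ x, P.wReal x = false → s'.real x = s.real x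
  natArr : ∀ x, P.wNatArr x = false → s'.natArr x = s.natArr x
  realArr : ∀ x, P.wRealArr x = false → s'.realArr x = s.realArr x

theorem Frame.refl (P : Prog) (s : State) : Frame P s s :=
  ⟨fun _ _ => rfl, fun _ _ => rfl, fun _ _ => rfl, fun _ _ => rfl⟩

theorem Frame.trans {P : Prog} {s s' s'' : State} (h : Frame P s s') (h' : Frame P s' s'') :
    Frame P s s'' :=
  ⟨fun x hx => (h'.nat x hx).trans (h.nat x hx), fun x hx => (h'.real x hx).trans (h.real x hx),
   fun x hx => (h'.natArr x hx).trans (h.natArr x hx),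
   fun x hx => (h'.realArr x hx).trans (h.realArr x hx)⟩

theorem Frame.mono {P P' : Prog} {s s' : State} (h : Frame P s s')
    (h1 : ∀ x, P'.wNat x = false → P.wNat x = false)
    (h2 : ∀ x, P'.wReal x = false → P.wReal x = false)
    (h3 : ∀ x, P'.wNatArr x = false → P.wNatArr x = false)
    (h4 : ∀ x, P'.wRealArr x = false → P.wRealArr x = false) : Frame P' s s' :=
  ⟨fun x hx => h.nat x (h1 x hx), fun x hx => h.real x (h2 x hx),
   fun x hx => h.natArr x (h3 x hx), fun x hx => h.realArr x (h4 x hx)⟩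

theorem Frame.instr (i : Instr) (s : State) : Frame (.instr i) s (i.apply s) := by
  constructor <;> intro x hx <;> cases i <;>
    simp_all [Prog.wNat, Prog.wReal, Prog.wNatArr, Prog.wRealArr, Instr.wNat, Instr.wReal,
      Instr.wNatArr, Instr.wRealArr]

theorem Frame.left {P P' : Prog} {s s' : State} (h : Frame P s s') : Frame (P ;; P') s s' := by
  refine h.mono ?_ ?_ ?_ ?_ <;>
    simp +contextual [Prog.wNat, Prog.wReal, Prog.wNatArr, Prog.wRealArr]

theorem Frame.right {P P' : Prog} {s s' : State} (h : Frame P' s s') : Frame (P ;; P') s s' := by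
  refine h.mono ?_ ?_ ?_ ?_ <;>
    simp +contextual [Prog.wNat, Prog.wReal, Prog.wNatArr, Prog.wRealArr]

theorem Frame.body {x y : ℕ} {P : Prog} {s s' : State} (h : Frame P s s') :
    Frame (.forNat x y P) s s' := by
  refine h.mono ?_ ?_ ?_ ?_ <;>
    simp +contextual [Prog.forNat, Prog.wNat, Prog.wReal, Prog.wNatArr, Prog.wRealArr]

theorem Frame.block {l : List Instr} (hl : l ≠ []) (s : State) :
    Frame (.block l) s (Instr.run l s) := by
  induction l generalizing s with
  | nil => exact absurd rfl hl
  | cons i l ih =>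
    cases l with
    | nil => exact Frame.instr i s
    | cons j l => exact (Frame.instr i s).left.trans (ih (by simp) (i.apply s)).right

theorem Exec.frame {B : BlackBox} {P : Prog} {s s' : State} {c : ℕ} (h : Exec B P s s' c) :
    Frame P s s' := by
  induction h with
  | instr i s => exact Frame.instr i s
  | seq _ _ h1 h2 =>
    exact h1.left.trans h2.right
  | ite_true _ _ h =>
    refine h.mono ?_ ?_ ?_ ?_ <;>
      simp +contextual [Prog.wNat, Prog.wReal, Prog.wNatArr, Prog.wRealArr]
  | ite_false _ _ h =>
    refine h.mono ?_ ?_ ?_ ?_ <;>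
      simp +contextual [Prog.wNat, Prog.wReal, Prog.wNatArr, Prog.wRealArr]
  | loop_true _ _ _ h1 h2 =>
    refine Frame.trans (h1.mono ?_ ?_ ?_ ?_) h2 <;>
      simp +contextual [Prog.wNat, Prog.wReal, Prog.wNatArr, Prog.wRealArr]
  | loop_false _ => exact Frame.refl _ _
  | call x y r i o s =>
    constructor <;> intro z hz <;>
      simp_all [State.writeNats, Prog.wNatArr]

theorem Exec.call_eq {B : BlackBox} {x y r i o M N : ℕ} {α : ℝ} {v : Fin N → ℝ} {s : State}
    (hM : s.nat x = M) (hN : s.nat y = N) (hα : s.real r = α) (hv : s.jobs i N = v) :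
    Exec B (.call x y r i o) s (s.writeNats o (B.schedule M N v α)) (B.time M N v α + N + 1) := by
  subst hM hN hα hv
  exact Exec.call x y r i o s

/-- Total correctness with a time bound: started in `s`, the program `P` halts after at most `T`
steps in a state that satisfies `Q`. -/
def Tr (B : BlackBox) (P : Prog) (s : State) (T : ℕ) (Q : State → Prop) : Prop :=
  ∃ s' c, Exec B P s s' c ∧ c ≤ T ∧ Q s'

variable {B : BlackBox} {P P' : Prog} {s : State} {T T' T₁ T₂ : ℕ} {Q Q' : State → Prop}

theorem Tr.mono (h : Tr B P s T Q) (hT : T ≤ T')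
    (hQ : ∀ s', Frame P s s' → Q s' → Q' s') : Tr B P s T' Q' := by
  obtain ⟨s', c, he, hc, hq⟩ := h
  exact ⟨s', c, he, hc.trans hT, hQ s' he.frame hq⟩

theorem Tr.seq (h : Tr B P s T₁ Q')
    (h' : ∀ s', Frame P s s' → Q' s' → Tr B P' s' T₂ Q) (hT : T₁ + T₂ ≤ T) :
    Tr B (P ;; P') s T Q := by
  obtain ⟨s', c, he, hc, hq⟩ := h
  obtain ⟨s'', c', he', hc', hq'⟩ := h' s' he.frame hq
  exact ⟨s'', c + c', .seq he he', by omega, hq'⟩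

theorem Tr.instr {i : Instr} (h : Q (i.apply s)) : Tr B (.instr i) s 1 Q :=
  ⟨_, 1, .instr i s, le_rfl, h⟩

theorem Tr.nop (h : Q (s.setNat 10 0)) (hT : 1 ≤ T := by omega) : Tr B .nop s T Q :=
  (Tr.instr (i := .natConst 10 0) (Q := Q) h).mono hT fun _ _ h => h

theorem Tr.block {l : List Instr} (hl : l ≠ []) (hq : Q (Instr.run l s)) (hT : l.length ≤ T) :
    Tr B (.block l) s T Q := by
  refine Tr.mono (T := l.length) (Q := Q) ?_ hT fun _ _ h => h
  clear hT
  induction l generalizing s with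
  | nil => exact absurd rfl hl
  | cons i l ih =>
    cases l with
    | nil => exact Tr.instr hq
    | cons j l =>
      refine Tr.seq (Q' := fun s' => s' = i.apply s) (Tr.instr rfl) (fun s' _ h => ?_)
        (add_comm _ _).le
      subst h
      exact ih (by simp) hq

/-- The rule for sequences, with the second program running on the rest of the budget. -/
theorem Tr.andThen (h : Tr B P s T₁ Q')
    (h' : ∀ s', Frame P s s' → Q' s' → Tr B P' s' (T - T₁) Q) (hT : T₁ ≤ T) :
    Tr B (P ;; P') s T Q :=
  Tr.seq h h' (by omega)

theorem Tr.blockSeq {l : List Instr} (k : ℕ) (hk : l.length = k + 1)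
    (h : Tr B P (Instr.run l s) (T - (k + 1)) Q) (hT : k + 1 ≤ T) : Tr B (.block l ;; P) s T Q :=
  Tr.andThen (Q' := fun s' => s' = Instr.run l s)
    (Tr.block (by rintro rfl; simp at hk) rfl hk.le) (fun s' _ hs => by rw [hs]; exact h) hT

theorem Tr.ite {c : Test} (h : c.Holds s → Tr B P s T Q) (h' : ¬ c.Holds s → Tr B P' s T Q)
    (hT : T + 1 ≤ T') : Tr B (.ite c P P') s T' Q := by
  by_cases hc : c.Holds s
  · obtain ⟨s', k, he, hk, hq⟩ := h hc
    exact ⟨s', k + 1, .ite_true hc he, by omega, hq⟩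
  · obtain ⟨s', k, he, hk, hq⟩ := h' hc
    exact ⟨s', k + 1, .ite_false hc he, by omega, hq⟩

/-- A loop that makes `N` rounds, with the invariant `I k` after `k` rounds. -/
theorem Tr.loop {c : Test} (I : ℕ → State → Prop) (N : ℕ) (h0 : I 0 s)
    (hstep : ∀ k < N, ∀ s', Frame P s s' → I k s' → c.Holds s' ∧ Tr B P s' T (I (k + 1)))
    (hend : ∀ s', Frame P s s' → I N s' → ¬ c.Holds s')
    (hQ : ∀ s', Frame P s s' → I N s' → Q s')
    (hT : N * (T + 1) + 1 ≤ T') : Tr B (.loop c P) s T' Q := by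
  have main : ∀ d k, k + d = N → ∀ s', Frame P s s' → I k s' →
      ∃ s'' b, Exec B (.loop c P) s' s'' b ∧ b ≤ d * (T + 1) + 1 ∧ Frame P s s'' ∧ I N s'' := by
    intro d
    induction d with
    | zero =>
      intro k hk s' hf hi
      obtain rfl : k = N := by omega
      exact ⟨s', 1, .loop_false (hend s' hf hi), by simp, hf, hi⟩
    | succ d ih =>
      intro k hk s' hf hi
      obtain ⟨hc, s₁, a, he, ha, hi₁⟩ := hstep k (by omega) s' hf hi
      obtain ⟨s₂, b, he₂, hb, hf₂, hi₂⟩ := ih (k + 1) (by omega) s₁ (hf.trans he.frame) hi₁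
      exact ⟨s₂, a + b + 1, .loop_true hc he he₂, by rw [Nat.succ_mul]; omega, hf₂, hi₂⟩
  obtain ⟨s', b, he, hb, hf, hi⟩ := main N 0 (by omega) s (Frame.refl _ _) h0
  exact ⟨s', b, he, hb.trans hT, hQ s' hf hi⟩

/-- The rule for counting loops: the invariant may refer to the number of rounds, and it is stated
after the counter has been increased. -/
theorem Tr.forNat {x y : ℕ} (I : ℕ → State → Prop) (N : ℕ)
    (hx : (x != 3 && x != y && !P.wNat x && !P.wNat y && !P.wNat 3) = true)
    (h3 : s.nat 3 = 1) (hN : s.nat y = N) (h0 : I 0 (s.setNat x 0))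
    (hstep : ∀ k < N, ∀ s', Frame (.forNat x y P) s s' → s'.nat x = k → I k s' →
      Tr B P s' T (fun s'' => I (k + 1) (s''.setNat x (k + 1))))
    (hQ : ∀ s', Frame (.forNat x y P) s s' → I N s' → Q s')
    (hT : N * (T + 2) + 2 ≤ T') : Tr B (.forNat x y P) s T' Q := by
  simp only [Bool.and_eq_true, bne_iff_ne, Bool.not_eq_true'] at hx
  obtain ⟨⟨⟨⟨hx3, hxy⟩, hPx⟩, hPy⟩, hP3⟩ := hx
  refine Tr.seq (Q' := fun s' => s' = s.setNat x 0) (T₂ := N * (T + 1 + 1) + 1) (Tr.instr rfl)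
    (fun s₀ hf₀ hs₀ => ?_) (by rw [add_comm]; exact hT)
  subst hs₀
  have hfr : ∀ s', Frame (P ;; .instr (.natAdd x x 3)) (s.setNat x 0) s' →
      Frame (.forNat x y P) s s' := fun s' h => by
    refine Frame.trans (hf₀.mono ?_ ?_ ?_ ?_) (h.mono ?_ ?_ ?_ ?_) <;>
      simp +contextual [Prog.forNat, Prog.wNat, Prog.wReal, Prog.wNatArr, Prog.wRealArr]
  have hy : ∀ s', Frame (P ;; .instr (.natAdd x x 3)) (s.setNat x 0) s' → s'.nat y = N :=
    fun s' h => by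
      rw [h.nat y (by simp [Prog.wNat, Instr.wNat, hPy, Ne.symm hxy])]
      simp [Ne.symm hxy, hN]
  have h3' : ∀ s', Frame (P ;; .instr (.natAdd x x 3)) (s.setNat x 0) s' → s'.nat 3 = 1 :=
    fun s' h => by
      rw [h.nat 3 (by simp [Prog.wNat, Instr.wNat, hP3, Ne.symm hx3])]
      simp [Ne.symm hx3, h3]
  refine Tr.loop (fun k s' => s'.nat x = k ∧ I k s') N ?_ ?_ ?_ ?_ le_rfl
  · exact ⟨by simp, h0⟩
  · rintro k hk s' hf ⟨hk', hI⟩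
    refine ⟨by simpa [hk', hy s' hf] using hk, ?_⟩
    refine Tr.seq (hstep k hk s' (hfr s' hf) hk' hI) (T₂ := 1) (fun s'' hf'' hI'' => ?_) le_rfl
    refine Tr.instr ?_
    have e1 : s''.nat x = k := by rw [hf''.nat x hPx, hk']
    have e2 : s''.nat 3 = 1 := by rw [hf''.nat 3 hP3, h3' s' hf]
    simp only [Instr.apply, e1, e2]
    exact ⟨by simp, hI''⟩
  · rintro s' hf ⟨hk', hI⟩
    simp [hk', hy s' hf]
  · rintro s' hf ⟨hk', hI⟩
    exact hQ s' (hfr s' hf) hI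

end Makespan

namespace Makespan

/-! ### The parameters of the algorithm and the program that computes them -/

/-- `c` is the least exponent for which `2 ^ c` is at least the square root of `y`. -/
def IsLog (y : ℝ) (c : ℕ) : Prop := y ≤ 4 ^ c ∧ ∀ k < c, (4 : ℝ) ^ k < y

theorem exists_isLog (y : ℝ) : ∃ c, IsLog y c := by
  classical
  have h : ∃ c : ℕ, y ≤ 4 ^ c := by
    obtain ⟨c, hc⟩ := pow_unbounded_of_one_lt y (by norm_num : (1 : ℝ) < 4)
    exact ⟨c, hc.le⟩
  exact ⟨Nat.find h, Nat.find_spec h, fun k hk => not_le.1 (Nat.find_min h hk)⟩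

theorem IsLog.le {x : ℝ} {c : ℕ} (h : IsLog (x * x) c) : x ≤ 2 ^ c := by
  have h1 := h.1
  have : (4 : ℝ) ^ c = 2 ^ c * 2 ^ c := by rw [← mul_pow]; norm_num
  rw [this] at h1
  exact abs_le_of_sq_le_sq' (by nlinarith) (by positivity) |>.2

theorem IsLog.ge {x : ℝ} {c : ℕ} (h : IsLog (x * x) c) (hx : 1 ≤ x) : 2 ^ c ≤ 2 * x := by
  rcases c with _ | c
  · simp; linarith
  · have h1 := h.2 c (by omega)
    have : (4 : ℝ) ^ c = 2 ^ c * 2 ^ c := by rw [← mul_pow]; norm_num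
    rw [this] at h1
    have : (2 : ℝ) ^ c ≤ x := abs_le_of_sq_le_sq' (by nlinarith) (by positivity) |>.2
    rw [pow_succ]; linarith

/-- The integer parameters of the algorithm: exponents of powers of two. -/
structure Params where
  /-- `2 ^ a` is about `1 / ε`. -/
  a : ℕ
  /-- `2 ^ l` is about `n * m / ε`. -/
  l : ℕ
  /-- The number of groups of samples; `2 ^ R` is about `n ^ 2 * m / (ε * γ)`. -/
  R : ℕ
  /-- Each group has `2 ^ b` samples. -/
  b : ℕ
  /-- Numbers of jobs are computed as binary numbers with `f + 1` digits. -/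
  f : ℕ

namespace Params

variable (q : Params)

/-- The number of samples in a group. -/
def B : ℕ := 2 ^ q.b
/-- The number of samples. -/
def K : ℕ := q.R * q.B
/-- The inverse of the rounding parameter `δ`. -/
def D : ℕ := 16 * 2 ^ q.a
/-- The number of classes, up to a factor `q.D`. -/
def T : ℕ := 2 * q.l + q.a + 8
/-- The number of classes of big jobs, which are scheduled by the black box. -/
def s₁ : ℕ := q.l * q.D
/-- The number of classes of big or medium jobs, whose jobs are all sampled. -/
def s₂ : ℕ := (q.l + q.a + 8) * q.D
/-- The number of classes. -/
def t : ℕ := q.T * q.D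
/-- The rounding parameter. -/
noncomputable def δ : ℝ := 1 / q.D

/-- The parameters are the ones that the algorithm computes for `n` jobs, `m` machines, accuracy
`ε` and error probability `γ`. -/
structure Valid (n m : ℕ) (ε γ : ℝ) : Prop where
  a : IsLog (1 / ε * (1 / ε)) q.a
  l : IsLog (64 * n * m * 2 ^ q.a * (64 * n * m * 2 ^ q.a)) q.l
  R : IsLog (64 * n * n * m * 2 ^ q.a / γ * (64 * n * n * m * 2 ^ q.a / γ)) q.R
  b : IsLog (1048576 * 2 ^ q.a * 2 ^ q.a * 2 ^ q.a * m * q.T *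
    (1048576 * 2 ^ q.a * 2 ^ q.a * 2 ^ q.a * m * q.T) * n) q.b
  f : IsLog (262144 * 2 ^ q.l * 2 ^ q.l * 2 ^ q.l * 2 ^ q.a * 2 ^ q.a *
    (262144 * 2 ^ q.l * 2 ^ q.l * 2 ^ q.l * 2 ^ q.a * 2 ^ q.a)) q.f

theorem exists_valid (n m : ℕ) (ε γ : ℝ) : ∃ q : Params, q.Valid n m ε γ := by
  obtain ⟨a, ha⟩ := exists_isLog (1 / ε * (1 / ε))
  obtain ⟨l, hl⟩ := exists_isLog (64 * n * m * 2 ^ a * (64 * n * m * 2 ^ a))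
  obtain ⟨R, hR⟩ := exists_isLog
    (64 * n * n * m * 2 ^ a / γ * (64 * n * n * m * 2 ^ a / γ))
  obtain ⟨b, hb⟩ := exists_isLog (1048576 * 2 ^ a * 2 ^ a * 2 ^ a * m *
    ((2 * l + a + 8 : ℕ) : ℝ) *
    (1048576 * 2 ^ a * 2 ^ a * 2 ^ a * m * ((2 * l + a + 8 : ℕ) : ℝ)) * n)
  obtain ⟨f, hf⟩ := exists_isLog (262144 * 2 ^ l * 2 ^ l * 2 ^ l * 2 ^ a * 2 ^ a *
    (262144 * 2 ^ l * 2 ^ l * 2 ^ l * 2 ^ a * 2 ^ a))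
  exact ⟨⟨a, l, R, b, f⟩, ha, hl, hR, hb, hf⟩

end Params

variable {B : BlackBox} {P P' : Prog} {s : State} {T T' T₁ T₂ : ℕ} {Q Q' : State → Prop}

/-- Compute the least `c` with `y ≤ 4 ^ c`, where `y` is in the real register `10`: `2 ^ c` goes to
the integer register `11` and to the real register `11`, and `c` to the integer register `12`. For
`y = x * x` this yields a power of two close to `x`, also if `x` itself involves a square root. -/
def logProg : Prog :=
  .block [.natConst 11 1, .natConst 12 0, .realCast 11 11, .realMul 12 11 11] ;;
  .loop (.realLt 12 10)
    (.block [.natAdd 11 11 11, .natAdd 12 12 3, .realCast 11 11, .realMul 12 11 11])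

theorem logProg_spec {y : ℝ} {c : ℕ} (h : IsLog y c) (h3 : s.nat 3 = 1) (hy : s.real 10 = y) :
    Tr B logProg s (5 * c + 5)
      (fun s' => s'.nat 11 = 2 ^ c ∧ s'.nat 12 = c ∧ s'.real 11 = 2 ^ c) := by
  refine Tr.blockSeq 3 rfl ?_ (by omega)
  refine Tr.loop (T := 4) (fun k s' => s'.nat 11 = 2 ^ k ∧ s'.nat 12 = k ∧ s'.real 11 = 2 ^ k ∧
    s'.real 12 = 4 ^ k) c ?_ ?_ ?_ ?_ (by omega)
  · simp
  · rintro k hk s' hf ⟨h1, h2, h4, h5⟩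
    have e1 : s'.real 10 = y := by rw [hf.real 10 rfl]; simp [hy]
    have e2 : s'.nat 3 = 1 := by rw [hf.nat 3 rfl]; simp [h3]
    refine ⟨by simpa [e1, h5] using h.2 k hk, Tr.block (by simp) ?_ (by simp)⟩
    have e3 : (2 : ℝ) ^ k + 2 ^ k = 2 ^ (k + 1) := by ring
    refine ⟨?_, ?_, ?_, ?_⟩
    · simp [h1]; ring
    · simp [h2, e2]
    · simp [h1, e3]
    · simp only [Instr.run_cons, Instr.run_nil, Instr.apply]
      simp [h1, e3]
      rw [← mul_pow]; norm_num
  · rintro s' hf ⟨h1, h2, h4, h5⟩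
    have e1 : s'.real 10 = y := by rw [hf.real 10 rfl]; simp [hy]
    simpa [e1, h5] using h.1
  · rintro s' hf ⟨h1, h2, h4, h5⟩
    exact ⟨h1, h2, h4⟩

/-- The product of the integer registers `20` and `21` goes to the integer register `22`. -/
def mulProg : Prog := .block [.natConst 22 0] ;; .forNat 23 20 (.block [.natAdd 22 22 21])

theorem mulProg_spec {u v : ℕ} (h3 : s.nat 3 = 1) (hu : s.nat 20 = u) (hv : s.nat 21 = v) :
    Tr B mulProg s (3 * u + 3) (fun s' => s'.nat 22 = u * v) := by
  refine Tr.blockSeq 0 rfl ?_ (by omega)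
  refine Tr.forNat (T := 1) (fun k s' => s'.nat 22 = k * v) u rfl (by simpa) (by simpa) ?_ ?_ ?_
    (by omega)
  · simp
  · intro k hk s' hf hk' hI
    have e1 : s'.nat 21 = v := by rw [hf.nat 21 rfl]; simp [hv]
    refine Tr.block (by simp) ?_ (by simp)
    simp [hI, e1]; ring
  · intro s' hf hI; exact hI

/-- The power of the real register `20`, with the exponent in the integer register `20`, goes to
the real register `21`. -/
def powProg : Prog :=
  .block [.realCast 21 3] ;; .forNat 23 20 (.block [.realMul 21 21 20])

theorem powProg_spec {u : ℕ} {v : ℝ} (h3 : s.nat 3 = 1) (hu : s.nat 20 = u)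
    (hv : s.real 20 = v) : Tr B powProg s (3 * u + 3) (fun s' => s'.real 21 = v ^ u) := by
  refine Tr.blockSeq 0 rfl ?_ (by omega)
  refine Tr.forNat (T := 1) (fun k s' => s'.real 21 = v ^ k) u rfl (by simpa) (by simpa) ?_ ?_ ?_
    (by omega)
  · simp [h3]
  · intro k hk s' hf hk' hI
    have e1 : s'.real 20 = v := by rw [hf.real 20 rfl]; simp [hv]
    refine Tr.block (by simp) ?_ (by simp)
    simp [hI, e1]; ring
  · intro s' hf hI; exact hI

/-- The program that computes the exponents. -/
def exponentProg : Prog :=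
  .block [.natConst 3 1, .natConst 9 0, .realCast 9 9, .realCast 7 1, .realCast 13 3,
    .realDiv 10 13 0, .realMul 10 10 10] ;;
  logProg ;;
  .block [.natAdd 13 12 9, .natAdd 14 11 9, .realAdd 6 11 9, .natConst 15 64, .realCast 14 15,
    .realCast 15 0, .realMul 10 14 15, .realMul 10 10 7, .realMul 10 10 6, .realMul 10 10 10] ;;
  logProg ;;
  .block [.natAdd 15 12 9, .realAdd 16 11 9, .realMul 10 14 15, .realMul 10 10 15,
    .realMul 10 10 7, .realMul 10 10 6, .realDiv 10 10 1, .realMul 10 10 10] ;;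
  logProg ;;
  .block [.natAdd 4 12 9, .natAdd 16 15 13, .natConst 17 8, .natAdd 16 16 17, .natAdd 18 16 15,
    .realCast 17 18, .natConst 19 1048576, .realCast 18 19, .realMul 18 18 6, .realMul 18 18 6,
    .realMul 18 18 6, .realMul 18 18 7, .realMul 18 18 17, .realMul 18 18 18,
    .realMul 10 18 15] ;;
  logProg ;;
  .block [.natAdd 5 11 9, .natConst 19 262144, .realCast 18 19, .realMul 18 18 16,
    .realMul 18 18 16, .realMul 18 18 16, .realMul 18 18 6, .realMul 18 18 6,
    .realMul 10 18 18] ;;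
  logProg ;;
  .block [.natAdd 8 11 9, .natAdd 19 14 14, .natAdd 19 19 19, .natAdd 19 19 19, .natAdd 19 19 19]

/-- The program that computes the products and powers. -/
def productProg : Prog :=
  .block [.natAdd 21 19 9, .natAdd 20 16 9] ;;
  mulProg ;;
  .block [.natAdd 6 22 9, .natAdd 20 18 9] ;;
  mulProg ;;
  .block [.natAdd 7 22 9, .natAdd 20 15 9] ;;
  mulProg ;;
  .block [.natAdd 24 22 9, .natAdd 20 4 9, .natAdd 21 5 9] ;;
  mulProg ;;
  .block [.natAdd 2 22 9, .realCast 18 19, .realDiv 3 13 18, .realSub 8 13 3, .realAdd 20 8 9,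
    .natAdd 20 24 9] ;;
  powProg ;;
  .block [.realAdd 4 21 9, .natAdd 20 6 9] ;;
  powProg ;;
  .block [.realAdd 5 21 9]

/-- The program that computes the parameters. -/
def planProg : Prog := exponentProg ;; productProg

/-- The registers that hold the parameters, and are not changed by the main program before its
last step. -/
structure Params.Stored (q : Params) (n m : ℕ) (ε : ℝ) (s : State) : Prop where
  nat0 : s.nat 0 = n
  nat1 : s.nat 1 = m
  nat2 : s.nat 2 = q.K
  nat3 : s.nat 3 = 1
  nat4 : s.nat 4 = q.R
  nat5 : s.nat 5 = q.B
  nat6 : s.nat 6 = q.s₂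
  nat7 : s.nat 7 = q.t
  nat8 : s.nat 8 = 2 ^ q.f
  nat9 : s.nat 9 = 0
  real0 : s.real 0 = ε
  real3 : s.real 3 = q.δ
  real4 : s.real 4 = (1 - q.δ) ^ q.s₁
  real5 : s.real 5 = (1 - q.δ) ^ q.s₂
  real6 : s.real 6 = 2 ^ q.a
  real7 : s.real 7 = m
  real8 : s.real 8 = 1 - q.δ
  real9 : s.real 9 = 0

attribute [local simp] Prog.wNat Prog.wReal Prog.wNatArr Prog.wRealArr Instr.wNat Instr.wReal
  Instr.wNatArr Instr.wRealArr

theorem logProg_wNat (x : ℕ) : logProg.wNat x = (x == 11 || x == 12) := by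
  simp [logProg, Prog.block]
theorem logProg_wReal (x : ℕ) : logProg.wReal x = (x == 11 || x == 12) := by
  simp [logProg, Prog.block]
theorem mulProg_wNat (x : ℕ) : mulProg.wNat x = (x == 22 || x == 23) := by
  simp [mulProg, Prog.block, Prog.forNat]; grind
theorem mulProg_wReal (x : ℕ) : mulProg.wReal x = false := by
  simp [mulProg, Prog.block, Prog.forNat]
theorem powProg_wNat (x : ℕ) : powProg.wNat x = (x == 23) := by
  simp [powProg, Prog.block, Prog.forNat]
theorem powProg_wReal (x : ℕ) : powProg.wReal x = (x == 21) := by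
  simp [powProg, Prog.block, Prog.forNat]

/-- The registers after the computation of the exponents. -/
structure Params.Exponents (q : Params) (n m : ℕ) (ε : ℝ) (s : State) : Prop where
  nat0 : s.nat 0 = n
  nat1 : s.nat 1 = m
  nat3 : s.nat 3 = 1
  nat4 : s.nat 4 = q.R
  nat5 : s.nat 5 = q.B
  nat8 : s.nat 8 = 2 ^ q.f
  nat9 : s.nat 9 = 0
  nat15 : s.nat 15 = q.l
  nat16 : s.nat 16 = q.l + q.a + 8
  nat18 : s.nat 18 = q.T
  nat19 : s.nat 19 = q.D
  real0 : s.real 0 = ε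
  real6 : s.real 6 = 2 ^ q.a
  real7 : s.real 7 = m
  real9 : s.real 9 = 0
  real13 : s.real 13 = 1

theorem exponentProg_spec {q : Params} {n m : ℕ} {ε γ : ℝ} (hq : q.Valid n m ε γ) :
    Tr B exponentProg (initState n m ε γ)
      (5 * (q.a + q.l + q.R + q.b + q.f) + 100) (q.Exponents n m ε) := by
  generalize hs : initState n m ε γ = s
  have hn0 : s.nat 0 = n := by subst hs; rfl
  have hn1 : s.nat 1 = m := by subst hs; rfl
  have hr0 : s.real 0 = ε := by subst hs; rfl
  have hr1 : s.real 1 = γ := by subst hs; rfl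
  clear hs
  have lN := logProg_wNat
  have lR := logProg_wReal
  refine Tr.blockSeq 6 rfl ?_ (by omega)
  refine Tr.andThen (logProg_spec hq.a ?_ ?_) (fun s1 f1 ⟨a1, b1, c1⟩ => ?_) (by omega)
  · simp [hr0, hn1]
  · simp [hr0, hn1]
  refine Tr.blockSeq 9 rfl ?_ (by omega)
  refine Tr.andThen (logProg_spec hq.l ?_ ?_) (fun s2 f2 ⟨a2, b2, c2⟩ => ?_) (by omega)
  · simp [hr0, hn0, hn1, lN, lR, f1.nat, f1.real, a1, b1, c1]
  · simp [hr0, hn0, hn1, lN, lR, f1.nat, f1.real, a1, b1, c1]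
  refine Tr.blockSeq 7 rfl ?_ (by omega)
  refine Tr.andThen (logProg_spec hq.R ?_ ?_) (fun s3 f3 ⟨a3, b3, c3⟩ => ?_) (by omega)
  · simp [hr0, hr1, hn0, hn1, lN, lR, f1.nat, f1.real, a1, b1, c1, f2.nat, f2.real, b2, c2]
  · simp [hr0, hr1, hn0, hn1, lN, lR, f1.nat, f1.real, a1, b1, c1, f2.nat, f2.real, b2, c2]
  refine Tr.blockSeq 14 rfl ?_ (by omega)
  refine Tr.andThen (logProg_spec hq.b ?_ ?_) (fun s4 f4 ⟨a4, b4, c4⟩ => ?_) (by omega)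
  · simp [hr0, hr1, hn0, hn1, lN, lR, f1.nat, f1.real, a1, b1, c1, f2.nat, f2.real, b2, c2, f3.nat,
      f3.real, b3]
  · simp [hr0, hr1, hn0, hn1, lN, lR, f1.nat, f1.real, a1, b1, c1, f2.nat, f2.real, b2, c2, f3.nat,
      f3.real, b3, Params.T]
    left; ring
  refine Tr.blockSeq 8 rfl ?_ (by omega)
  refine Tr.andThen (logProg_spec hq.f ?_ ?_) (fun s5 f5 ⟨a5, b5, c5⟩ => ?_) (by omega)
  · simp [hr0, hr1, hn0, hn1, lN, lR, f1.nat, f1.real, a1, b1, c1, f2.nat, f2.real, b2, c2, f3.nat,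
      f3.real, b3, f4.nat, f4.real, a4]
  · simp [hr0, hr1, hn0, hn1, lN, lR, f1.nat, f1.real, a1, b1, c1, f2.nat, f2.real, b2, c2, f3.nat,
      f3.real, b3, f4.nat, f4.real, a4]
  refine Tr.block (by simp) ?_ (by simp; omega)
  constructor <;> simp [hr0, hr1, hn0, hn1, lN, lR, f1.nat, f1.real, a1, b1, c1, f2.nat, f2.real,
    b2, c2, f3.nat, f3.real, b3, f4.nat, f4.real, a4, f5.nat, f5.real, a5, Params.T, Params.B,
    Params.D] <;> ring

theorem productProg_spec {q : Params} {n m : ℕ} {ε : ℝ} {s : State}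
    (h : q.Exponents n m ε s) :
    Tr B productProg s
      (3 * ((q.l + q.a + 8) + q.T + q.l + q.R + q.s₁ + q.s₂) + 100) (q.Stored n m ε) := by
  have mN := mulProg_wNat
  have mR := mulProg_wReal
  have pN := powProg_wNat
  have pR := powProg_wReal
  obtain ⟨n0, n1, n3, n4, n5, n8, n9, n15, n16, n18, n19, r0, r6, r7, r9, r13⟩ := h
  refine Tr.blockSeq 1 rfl ?_ (by omega)
  refine Tr.andThen (mulProg_spec (u := q.l + q.a + 8) (v := q.D) ?_ ?_ ?_) (fun s6 f6 a6 => ?_)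
    (by omega)
  · simp [n3, n9, n16, n19]
  · simp [n9, n16, n19]
  · simp [n9, n16, n19]
  refine Tr.blockSeq 1 rfl ?_ (by omega)
  refine Tr.andThen (mulProg_spec (u := q.T) (v := q.D) ?_ ?_ ?_) (fun s7 f7 a7 => ?_) (by omega)
  · simp [mN, n3, n9, n16, n18, n19, f6.nat, a6]
  · simp [mN, n9, n16, n18, n19, f6.nat, a6]
  · simp [mN, n9, n16, n18, n19, f6.nat, a6]
  refine Tr.blockSeq 1 rfl ?_ (by omega)
  refine Tr.andThen (mulProg_spec (u := q.l) (v := q.D) ?_ ?_ ?_) (fun s8 f8 a8 => ?_) (by omega)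
  · simp [mN, n3, n9, n15, n16, n18, n19, f6.nat, a6, f7.nat, a7]
  · simp [mN, n9, n15, n16, n18, n19, f6.nat, a6, f7.nat, a7]
  · simp [mN, n9, n15, n16, n18, n19, f6.nat, a6, f7.nat, a7]
  refine Tr.blockSeq 2 rfl ?_ (by omega)
  refine Tr.andThen (mulProg_spec (u := q.R) (v := q.B) ?_ ?_ ?_) (fun s9 f9 a9 => ?_) (by omega)
  · simp [mN, n3, n4, n5, n9, n15, n16, n18, n19, f6.nat, a6, f7.nat, a7, f8.nat, a8]
  · simp [mN, n4, n5, n9, n15, n16, n18, n19, f6.nat, a6, f7.nat, a7, f8.nat, a8]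
  · simp [mN, n4, n5, n9, n15, n16, n18, n19, f6.nat, a6, f7.nat, a7, f8.nat, a8]
  refine Tr.blockSeq 5 rfl ?_ (by omega)
  refine Tr.andThen (powProg_spec (u := q.s₁) (v := 1 - q.δ) ?_ ?_ ?_) (fun s10 f10 a10 => ?_)
    (by omega)
  · simp [mN, mR, n3, n4, n5, n9, n15, n16, n18, n19, r9, r13, f6.nat, f6.real, a6, f7.nat, f7.real,
      a7, f8.nat, f8.real, a8, f9.nat, f9.real, a9]
  · simp [mN, mR, n4, n5, n9, n15, n16, n18, n19, r9, r13, f6.nat, f6.real, a6, f7.nat, f7.real, a7,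
      f8.nat, f8.real, a8, f9.nat, f9.real, a9, Params.s₁]
  · simp [mN, mR, n4, n5, n9, n15, n16, n18, n19, r9, r13, f6.nat, f6.real, a6, f7.nat, f7.real, a7,
      f8.nat, f8.real, a8, f9.nat, f9.real, a9, Params.δ]
  refine Tr.blockSeq 1 rfl ?_ (by omega)
  refine Tr.andThen (powProg_spec (u := q.s₂) (v := 1 - q.δ) ?_ ?_ ?_) (fun s11 f11 a11 => ?_)
    (by omega)
  · simp [mN, mR, pN, pR, n3, n4, n5, n9, n15, n16, n18, n19, r9, r13, f6.nat, f6.real, a6, f7.nat,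
      f7.real, a7, f8.nat, f8.real, a8, f9.nat, f9.real, a9, f10.nat, f10.real, a10]
  · simp [mN, mR, pN, pR, n4, n5, n9, n15, n16, n18, n19, r9, r13, f6.nat, f6.real, a6, f7.nat,
      f7.real, a7, f8.nat, f8.real, a8, f9.nat, f9.real, a9, f10.nat, f10.real, a10, Params.s₁,
      Params.s₂]
  · simp [mN, mR, pN, pR, n4, n5, n9, n15, n16, n18, n19, r9, r13, f6.nat, f6.real, a6, f7.nat,
      f7.real, a7, f8.nat, f8.real, a8, f9.nat, f9.real, a9, f10.nat, f10.real, a10, Params.δ]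
  refine Tr.block (by simp) ?_ (by simp; omega)
  constructor <;> simp [mN, mR, pN, pR, n0, n1, n3, n4, n5, n8, n9, n15, n16, n18, n19, r0, r6, r7,
    r9, r13, f6.nat, f6.real, a6, f7.nat, f7.real, a7, f8.nat, f8.real, a8, f9.nat, f9.real, a9,
    f10.nat, f10.real, a10, f11.nat, f11.real, a11, Params.s₁, Params.s₂, Params.t, Params.K,
    Params.δ]

theorem planProg_spec {q : Params} {n m : ℕ} {ε γ : ℝ} (hq : q.Valid n m ε γ) :
    Tr B planProg (initState n m ε γ)
      (5 * (q.a + q.l + q.R + q.b + q.f) +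
        3 * ((q.l + q.a + 8) + q.T + q.l + q.R + q.s₁ + q.s₂) + 200)
      (fun s' => q.Stored n m ε s' ∧ s'.natArr = (fun _ _ => 0) ∧
        s'.realArr = fun _ _ => 0) := by
  refine Tr.mono (Q := fun s' => q.Stored n m ε s') (T := _) ?_ le_rfl (fun s' hf h => ⟨h, ?_, ?_⟩)
  · exact Tr.seq (exponentProg_spec hq) (fun s _ hs => productProg_spec hs) (by omega)
  · funext x; rw [hf.natArr x rfl]; rfl
  · funext x; rw [hf.realArr x rfl]; rfl

end Makespan

namespace Makespan

/-! ### Estimating the total processing time -/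

open Finset

/-- During the main program, the parameters are stored, and sample `i` is the job `w i`. -/
structure Env (q : Params) {n : ℕ} (m : ℕ) (ε : ℝ) (p : Fin n → ℝ) (w : ℕ → Fin n)
    (s : State) : Prop extends q.Stored n m ε s where
  names : ∀ i < q.K, s.natArr 0 i = w i
  vals : ∀ i < q.K, s.realArr 0 i = p (w i)

/-- The program writes none of the locations that `Env` refers to. -/
def Prog.keepsEnv (P : Prog) : Bool :=
  !P.wNat 0 && !P.wNat 1 && !P.wNat 2 && !P.wNat 3 && !P.wNat 4 && !P.wNat 5 && !P.wNat 6 &&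
  !P.wNat 7 && !P.wNat 8 && !P.wNat 9 && !P.wReal 0 && !P.wReal 3 && !P.wReal 4 && !P.wReal 5 &&
  !P.wReal 6 && !P.wReal 7 && !P.wReal 8 && !P.wReal 9 && !P.wNatArr 0 && !P.wRealArr 0

variable {q : Params} {n m : ℕ} {ε : ℝ} {p : Fin n → ℝ} {w : ℕ → Fin n} {B : BlackBox}
  {s s' : State}

theorem Env.of_frame {P : Prog} (h : Env q m ε p w s) (f : Frame P s s')
    (hP : P.keepsEnv = true) : Env q m ε p w s' := by
  simp only [Prog.keepsEnv, Bool.and_eq_true, Bool.not_eq_true'] at hP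
  obtain ⟨⟨⟨⟨⟨⟨⟨⟨⟨⟨⟨⟨⟨⟨⟨⟨⟨⟨⟨n0, n1⟩, n2⟩, n3⟩, n4⟩, n5⟩, n6⟩, n7⟩, n8⟩, n9⟩, r0⟩, r3⟩, r4⟩, r5⟩,
    r6⟩, r7⟩, r8⟩, r9⟩, a0⟩, b0⟩ := hP
  obtain ⟨⟨h0, h1, h2, h3, h4, h5, h6, h7, h8, h9, g0, g3, g4, g5, g6, g7, g8, g9⟩, hn, hv⟩ := h
  refine ⟨⟨?_, ?_, ?_, ?_, ?_, ?_, ?_, ?_, ?_, ?_, ?_, ?_, ?_, ?_, ?_, ?_, ?_, ?_⟩, ?_, ?_⟩ <;>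
    first
    | rw [f.nat _ (by assumption)]; assumption
    | rw [f.real _ (by assumption)]; assumption
    | rw [f.natArr _ (by assumption)]; assumption
    | rw [f.realArr _ (by assumption)]; assumption

/-- The sum of `1 / p j` over the pairs among the first `k` samples that hit the same job `j`. -/
noncomputable def collisions (p : Fin n → ℝ) (w : ℕ → Fin n) (k : ℕ) : ℝ :=
  ∑ b ∈ range k, (#{b' ∈ range b | w b' = w b} : ℝ) / p (w b)

/-- The collision sum of one group of samples; the number of earlier samples of a job is kept in
the integer array `1`, in a separate range of addresses for each group. -/
def groupProg : Prog :=
  .forNat 23 5 (.block [.natLoad 24 0 20, .natAdd 24 24 21, .natLoad 25 1 24, .realCast 21 25,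
    .realLoad 22 0 20, .realDiv 21 21 22, .realAdd 20 20 21, .natAdd 25 25 3, .natStore 1 24 25,
    .natAdd 20 20 3])

theorem groupProg_spec (h : Env q m ε p w s) {g : ℕ} (hg : g < q.R)
    (h20 : s.nat 20 = g * q.B) (h21 : s.nat 21 = g * n) (hr : s.real 20 = 0)
    (hz : ∀ x, g * n ≤ x → s.natArr 1 x = 0) :
    Tr B groupProg s (q.B * 12 + 2) (fun s' => s'.nat 20 = (g + 1) * q.B ∧
      s'.real 20 = collisions p (fun b => w (g * q.B + b)) q.B ∧
      ∀ x, (g + 1) * n ≤ x → s'.natArr 1 x = 0) := by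
  refine Tr.forNat (T := 10) (fun k s' => s'.nat 20 = g * q.B + k ∧
    s'.real 20 = collisions p (fun b => w (g * q.B + b)) k ∧
    (∀ j : Fin n, s'.natArr 1 (j + g * n) = #{b ∈ range k | w (g * q.B + b) = j}) ∧
    ∀ x, (g + 1) * n ≤ x → s'.natArr 1 x = 0) q.B rfl h.nat3 h.nat5 ?_ ?_ ?_ (by omega)
  · refine ⟨by simp [h20], by simp [hr, collisions], fun j => ?_, fun x hx => ?_⟩
    · simpa using hz _ (by omega)
    · simpa using hz _ (by rw [Nat.succ_mul] at hx; omega)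
  · rintro k hk s' hf hk' ⟨h1, h2, h3, h4⟩
    have h' := h.of_frame hf rfl
    have h21' : s'.nat 21 = g * n := by rw [hf.nat 21 rfl, h21]
    have hi : g * q.B + k < q.K := by
      have := Nat.mul_le_mul_right q.B (Nat.succ_le_of_lt hg)
      rw [Nat.succ_mul] at this
      unfold Params.K; omega
    have e1 := h'.names _ hi
    have e2 := h'.vals _ hi
    have e3 := h3 (w (g * q.B + k))
    refine Tr.block (by simp) ?_ (by simp)
    refine ⟨?_, ?_, ?_, ?_⟩
    · simp [h1, h'.nat3]; omega
    · simp [h1, h2, h21', e1, e2, e3, collisions, sum_range_succ]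
    · intro j
      simp only [Instr.run_cons, Instr.run_nil, Instr.apply]
      simp [h1, h21', e1, e3, h'.nat3, Function.update_apply, range_add_one, filter_insert]
      by_cases hj : j = w (g * q.B + k)
      · subst hj; simp
      · have : (j : ℕ) ≠ w (g * q.B + k) := fun h => hj (Fin.ext h)
        simp [this, Ne.symm hj, h3]
    · intro x hx
      have hlt : (w (g * q.B + k) : ℕ) + g * n < (g + 1) * n := by
        have := (w (g * q.B + k)).2
        rw [Nat.succ_mul]; omega
      simp [h1, h21', e1, Function.update_apply]
      rw [if_neg (by omega)]
      exact h4 x hx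
  · rintro s' hf ⟨h1, h2, h3, h4⟩
    exact ⟨by rw [h1]; ring, h2, h4⟩

/-- The collision sums of the groups of samples go to the real array `1`. -/
def estimateProg : Prog :=
  .block [.natConst 20 0, .natConst 21 0] ;;
  .forNat 22 4 (.block [.realCast 20 9] ;; groupProg ;;
    .block [.realStore 1 22 20, .natAdd 21 21 0])

theorem estimateProg_spec (h : Env q m ε p w s) (hz : ∀ x, s.natArr 1 x = 0) :
    Tr B estimateProg s (q.R * (q.B * 12 + 7) + 4) (fun s' => ∀ g < q.R,
      s'.realArr 1 g = collisions p (fun b => w (g * q.B + b)) q.B) := by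
  refine Tr.blockSeq 1 rfl ?_ (by omega)
  set s₀ := Instr.run [.natConst 20 0, .natConst 21 0] s with hs₀
  have h₀ : Env q m ε p w s₀ := h.of_frame (P := .block [.natConst 20 0, .natConst 21 0])
    (Frame.block (by simp) s) rfl
  refine Tr.forNat (T := q.B * 12 + 5) (fun k s' => s'.nat 20 = k * q.B ∧ s'.nat 21 = k * n ∧
    (∀ g < k, s'.realArr 1 g = collisions p (fun b => w (g * q.B + b)) q.B) ∧
    ∀ x, k * n ≤ x → s'.natArr 1 x = 0) q.R rfl h₀.nat3 h₀.nat4 ?_ ?_ ?_ (by simp)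
  · simp [hs₀, hz]
  · rintro k hk s' hf hk' ⟨h1, h2, h3, h4⟩
    have h' := h₀.of_frame hf rfl
    refine Tr.blockSeq 0 rfl ?_ (by omega)
    have h'' : Env q m ε p w (Instr.run [.realCast 20 9] s') :=
      h'.of_frame (P := .instr (.realCast 20 9)) (Frame.instr _ _) rfl
    refine Tr.andThen (groupProg_spec h'' hk (by simp [h1]) (by simp [h2])
      (by simp [h'.nat9]) (by simpa using h4)) ?_ (by omega)
    rintro s₁ f₁ ⟨a1, a2, a3⟩
    have e1 : s₁.nat 22 = k := by rw [f₁.nat 22 rfl]; simpa using hk'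
    have e2 : s₁.nat 21 = k * n := by rw [f₁.nat 21 rfl]; simpa using h2
    have e3 : s₁.nat 0 = n := (h''.of_frame f₁ rfl).nat0
    have e4 : s₁.realArr 1 = s'.realArr 1 := by rw [f₁.realArr 1 rfl]; simp
    refine Tr.block (by simp) ?_ (by simp)
    refine ⟨by simp [a1], by simp [e2, e3, Nat.succ_mul], fun g hg => ?_, fun x hx => ?_⟩
    · simp [e1, e4, Function.update_apply]
      rcases Nat.lt_succ_iff_lt_or_eq.1 hg with hg | rfl
      · rw [if_neg (by omega)]; exact h3 g hg
      · simp [a2]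
    · simpa using a3 x hx
  · rintro s' hf ⟨h1, h2, h3, h4⟩
    exact h3

/-- `v` is the largest of the numbers `e 0, …, e (R - 1)` such that more than half of these numbers
are at least `v`. -/
def IsUpperMedian (R : ℕ) (e : ℕ → ℝ) (v : ℝ) : Prop :=
  (v = 0 ∨ ∃ a < R, v = e a ∧ R < 2 * #{b ∈ range R | e a ≤ e b}) ∧
    ∀ a < R, R < 2 * #{b ∈ range R | e a ≤ e b} → e a ≤ v

/-- The number of estimates that are at least the one in the real register `20`. -/
def rankProg : Prog :=
  .block [.natConst 24 0] ;;
  .forNat 23 4 (.block [.realLoad 21 1 23] ;; .ite (.realLt 21 20) .nop (.block [.natAdd 24 24 3]))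

theorem rankProg_spec (h : Env q m ε p w s) {x : ℝ} (hx : s.real 20 = x) :
    Tr B rankProg s (q.R * 5 + 3)
      (fun s' => s'.nat 24 = #{b ∈ range q.R | x ≤ s.realArr 1 b}) := by
  refine Tr.blockSeq 0 rfl ?_ (by omega)
  refine Tr.forNat (T := 3) (fun k s' => s'.nat 24 = #{b ∈ range k | x ≤ s.realArr 1 b}) q.R rfl
    (by simpa using h.nat3) (by simpa using h.nat4) (by simp) ?_ (fun s' _ h => h) (by omega)
  intro k hk s' hf hk' h1
  have e1 : s'.real 20 = x := by rw [hf.real 20 rfl]; simpa using hx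
  have e2 : s'.realArr 1 = s.realArr 1 := by rw [hf.realArr 1 rfl]; simp
  have e3 : s'.nat 3 = 1 := by rw [hf.nat 3 rfl]; simpa using h.nat3
  refine Tr.blockSeq 0 rfl ?_ (by omega)
  refine Tr.ite (T := 1) ?_ ?_ (by omega)
  · intro hc
    simp [e1, e2, hk'] at hc
    refine Tr.nop ?_
    simp [h1, range_add_one, filter_insert, not_le.2 hc]
  · intro hc
    simp [e1, e2, hk'] at hc
    refine Tr.block (by simp) ?_ (by simp)
    simp [h1, range_add_one, filter_insert, hc, e3]

/-- The upper median of the collision sums goes to the real register `22`. -/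
def medianProg : Prog :=
  .block [.realCast 22 9] ;;
  .forNat 22 4 (.block [.realLoad 20 1 22] ;; rankProg ;; .block [.natAdd 25 24 24] ;;
    .ite (.natLt 4 25) (.ite (.realLt 22 20) (.block [.realAdd 22 20 9]) .nop) .nop)

theorem medianProg_spec (h : Env q m ε p w s) :
    Tr B medianProg s (q.R * (q.R * 5 + 10) + 3)
      (fun s' => IsUpperMedian q.R (s.realArr 1) (s'.real 22)) := by
  refine Tr.blockSeq 0 rfl ?_ (by omega)
  have h₀ : Env q m ε p w (Instr.run [.realCast 22 9] s) :=
    h.of_frame (P := .instr (.realCast 22 9)) (Frame.instr _ _) rfl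
  set e := s.realArr 1 with he
  refine Tr.forNat (T := q.R * 5 + 8) (fun k s' =>
    (s'.real 22 = 0 ∨ ∃ a < q.R, s'.real 22 = e a ∧ q.R < 2 * #{b ∈ range q.R | e a ≤ e b}) ∧
    ∀ a < k, q.R < 2 * #{b ∈ range q.R | e a ≤ e b} → e a ≤ s'.real 22) q.R rfl h₀.nat3 h₀.nat4
    ?_ ?_ (fun s' _ h => h) (by simp)
  · simp [h.nat9]
  · rintro k hk s' hf hk' ⟨h1, h2⟩
    have h' := h₀.of_frame hf rfl
    have e1 : s'.realArr 1 = e := by rw [hf.realArr 1 rfl]; simp [he]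
    refine Tr.blockSeq 0 rfl ?_ (by omega)
    have h'' : Env q m ε p w (Instr.run [.realLoad 20 1 22] s') :=
      h'.of_frame (P := .instr (.realLoad 20 1 22)) (Frame.instr _ _) rfl
    refine Tr.andThen (rankProg_spec h'' rfl) (fun s₁ f₁ a1 => ?_) (by omega)
    simp [e1, hk'] at a1
    have h₁ := h''.of_frame f₁ rfl
    have e2 : s₁.real 20 = e k := by rw [f₁.real 20 rfl]; simp [e1, hk']
    have e3 : s₁.real 22 = s'.real 22 := by rw [f₁.real 22 rfl]; simp
    refine Tr.blockSeq 0 rfl ?_ (by omega)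
    refine Tr.ite (T := 2) (fun hc => ?_) (fun hc => ?_) (by omega)
    · simp [h₁.nat4, a1, ← two_mul] at hc
      refine Tr.ite (T := 1) (fun hd => ?_) (fun hd => ?_) (by omega)
      · simp [e2, e3] at hd
        refine Tr.block (by simp) ⟨?_, ?_⟩ (by simp)
        · right; exact ⟨k, hk, by simp [e2, h₁.real9], hc⟩
        · intro a ha hr
          simp [e2, h₁.real9]
          rcases Nat.lt_succ_iff_lt_or_eq.1 ha with ha | rfl
          · exact (h2 a ha hr).trans hd.le
          · rfl
      · simp [e2, e3] at hd
        refine Tr.nop ⟨by simpa [e3] using h1, ?_⟩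
        intro a ha hr
        simp [e3]
        rcases Nat.lt_succ_iff_lt_or_eq.1 ha with ha | rfl
        · exact h2 a ha hr
        · exact hd
    · simp [h₁.nat4, a1, ← two_mul] at hc
      refine Tr.nop ⟨by simpa [e3] using h1, ?_⟩
      intro a ha hr
      simp [e3]
      rcases Nat.lt_succ_iff_lt_or_eq.1 ha with ha | rfl
      · exact h2 a ha hr
      · exact absurd hr (by omega)

end Makespan

namespace Makespan

open Finset

/-! ### Scheduling the big and the medium jobs -/

namespace Params

variable (q : Params)

/-- The estimate of the total processing time that belongs to the collision sum `v`. It is larger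
than the unbiased one by the factor `1 + 1 / (64 * m * 2 ^ q.a)`, because the algorithm needs an
upper bound. -/
noncomputable def totalEst (m : ℕ) (v : ℝ) : ℝ :=
  q.B * (q.B - 1) * (1 / (64 * m * 2 ^ q.a) + 1) / 2 / v

/-- The threshold for big jobs, for the estimate `V` of the total processing time. -/
noncomputable def bigBound (m : ℕ) (ε V : ℝ) : ℝ := ε * V / m

/-- The largest rounded processing time. It is a power of `1 - δ` away from the threshold for big
jobs, so that this threshold is the boundary between two classes. -/
noncomputable def top (m : ℕ) (ε V : ℝ) : ℝ := bigBound m ε V / (1 - q.δ) ^ q.s₁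

/-- The threshold for medium jobs. -/
noncomputable def mediumBound (m : ℕ) (ε V : ℝ) : ℝ := q.top m ε V * (1 - q.δ) ^ q.s₂

/-- The makespan of list scheduling if the jobs that do not come first are small. -/
noncomputable def listBound (m : ℕ) (ε V : ℝ) : ℝ := V / m + (1 - 1 / m) * bigBound m ε V

end Params

/-- In addition, the estimate `V` of the total processing time and the thresholds are stored. -/
structure ScaledEnv (q : Params) {n : ℕ} (m : ℕ) (ε : ℝ) (p : Fin n → ℝ) (w : ℕ → Fin n) (V : ℝ)
    (s : State) : Prop extends Env q m ε p w s where
  real23 : s.real 23 = V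
  real24 : s.real 24 = Params.bigBound m ε V
  real25 : s.real 25 = q.mediumBound m ε V
  real26 : s.real 26 = q.top m ε V

/-- The program writes none of the locations that `ScaledEnv` refers to. -/
def Prog.keepsScaledEnv (P : Prog) : Bool :=
  P.keepsEnv && !P.wReal 23 && !P.wReal 24 && !P.wReal 25 && !P.wReal 26

variable {q : Params} {n m : ℕ} {ε : ℝ} {p : Fin n → ℝ} {w : ℕ → Fin n} {V : ℝ} {B : BlackBox}
  {s s' : State}

theorem ScaledEnv.of_frame {P : Prog} (h : ScaledEnv q m ε p w V s) (f : Frame P s s')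
    (hP : P.keepsScaledEnv = true) : ScaledEnv q m ε p w V s' := by
  simp only [Prog.keepsScaledEnv, Bool.and_eq_true, Bool.not_eq_true'] at hP
  obtain ⟨⟨⟨⟨h0, h1⟩, h2⟩, h3⟩, h4⟩ := hP
  obtain ⟨he, a1, a2, a3, a4⟩ := h
  exact ⟨he.of_frame f h0, by rw [f.real _ h1, a1], by rw [f.real _ h2, a2],
    by rw [f.real _ h3, a3], by rw [f.real _ h4, a4]⟩

/-- The thresholds, and the bound for list scheduling in the real register `27`, are computed from
the collision sum in the real register `22`. -/
def scaleProg : Prog :=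
  .block [.natConst 20 64, .realCast 30 20, .realMul 30 30 7, .realMul 30 30 6, .realCast 31 3,
    .realDiv 30 31 30, .realAdd 30 30 31, .realCast 32 5, .realSub 33 32 31, .realMul 32 32 33,
    .realMul 32 32 30, .natConst 20 2, .realCast 33 20, .realDiv 32 32 33, .realDiv 23 32 22,
    .realMul 24 0 23, .realDiv 24 24 7, .realDiv 26 24 4, .realMul 25 26 5, .realDiv 34 31 7,
    .realSub 34 31 34, .realMul 34 34 24, .realDiv 35 23 7, .realAdd 27 35 34]

theorem scaleProg_spec (h : Env q m ε p w s) {v : ℝ} (hv : s.real 22 = v) :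
    Tr B scaleProg s 24 (fun s' => ScaledEnv q m ε p w (q.totalEst m v) s' ∧
      s'.real 27 = Params.listBound m ε (q.totalEst m v)) := by
  refine Tr.mono (T := 24) (Q := fun s' => (s'.real 23 = q.totalEst m v ∧
    s'.real 24 = Params.bigBound m ε (q.totalEst m v) ∧
    s'.real 25 = q.mediumBound m ε (q.totalEst m v) ∧ s'.real 26 = q.top m ε (q.totalEst m v)) ∧
    s'.real 27 = Params.listBound m ε (q.totalEst m v)) ?_ le_rfl
    (fun s' f h' => ⟨⟨h.of_frame f rfl, h'.1.1, h'.1.2.1, h'.1.2.2.1, h'.1.2.2.2⟩, h'.2⟩)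
  refine Tr.block (by simp) ?_ (by simp)
  simp [h.nat3, h.nat5, h.real7, h.real6, h.real0, h.real4, h.real5, hv, Params.totalEst,
    Params.listBound, Params.mediumBound, Params.top, Params.bigBound]

/-- The jobs `f 0, …, f (N - 1)` are different, they are marked in the integer array `2`, and their
processing times are in the real array `2`. -/
structure Recorded (p : Fin n → ℝ) (f : ℕ → Fin n) (N : ℕ) (s : State) : Prop where
  inj : Set.InjOn f (Set.Iio N)
  nat26 : s.nat 26 = N
  times : ∀ x < N, s.realArr 2 x = p (f x)
  mark : ∀ j : Fin n, (∃ x < N, f x = j) → s.natArr 2 j = 1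
  unmark : ∀ j : Fin n, (¬ ∃ x < N, f x = j) → s.natArr 2 j = 0

theorem Recorded.congr {f : ℕ → Fin n} {N : ℕ} (h : Recorded p f N s)
    (h1 : s'.nat 26 = s.nat 26) (h2 : s'.realArr 2 = s.realArr 2)
    (h3 : s'.natArr 2 = s.natArr 2) : Recorded p f N s' :=
  ⟨h.inj, by rw [h1, h.nat26], by rw [h2]; exact h.times, by rw [h3]; exact h.mark,
    by rw [h3]; exact h.unmark⟩

theorem exists_update_iff (f : ℕ → Fin n) (N : ℕ) (i j : Fin n) :
    (∃ x < N + 1, Function.update f N i x = j) ↔ (∃ x < N, f x = j) ∨ i = j := by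
  constructor
  · rintro ⟨x, hx, h⟩
    rcases Nat.lt_succ_iff_lt_or_eq.1 hx with hx | rfl
    · rw [Function.update_of_ne hx.ne] at h; exact .inl ⟨x, hx, h⟩
    · rw [Function.update_self] at h; exact .inr h
  · rintro (⟨x, hx, h⟩ | h)
    · exact ⟨x, by omega, by rw [Function.update_of_ne hx.ne, h]⟩
    · exact ⟨N, by omega, by rw [Function.update_self, h]⟩

theorem Recorded.snoc {f : ℕ → Fin n} {N : ℕ} (h : Recorded p f N s) {j : Fin n}
    (hj : ¬ ∃ x < N, f x = j) (h1 : s'.nat 26 = N + 1)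
    (h2 : s'.realArr 2 = Function.update (s.realArr 2) N (p j))
    (h3 : s'.natArr 2 = Function.update (s.natArr 2) j 1) :
    Recorded p (Function.update f N j) (N + 1) s' where
  nat26 := h1
  inj := by
    intro x hx y hy hxy
    simp only [Set.mem_Iio, Nat.lt_succ_iff_lt_or_eq] at hx hy
    rcases hx with hx | rfl <;> rcases hy with hy | rfl
    · rw [Function.update_of_ne hx.ne, Function.update_of_ne hy.ne] at hxy
      exact h.inj hx hy hxy
    · rw [Function.update_of_ne hx.ne, Function.update_self] at hxy
      exact absurd ⟨x, hx, hxy⟩ hj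
    · rw [Function.update_of_ne hy.ne, Function.update_self] at hxy
      exact absurd ⟨y, hy, hxy.symm⟩ hj
    · rfl
  times := by
    intro x hx
    rcases Nat.lt_succ_iff_lt_or_eq.1 hx with hx | rfl
    · rw [h2, Function.update_of_ne hx.ne, Function.update_of_ne hx.ne, h.times x hx]
    · rw [h2, Function.update_self, Function.update_self]
  mark := by
    intro i hi
    rw [exists_update_iff] at hi
    by_cases hij : i = j
    · rw [h3, hij, Function.update_self]
    · rw [h3, Function.update_of_ne (fun e => hij (Fin.ext e))]
      exact h.mark i (hi.resolve_right (Ne.symm hij))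
  unmark := by
    intro i hi
    rw [exists_update_iff, not_or] at hi
    rw [h3, Function.update_of_ne (fun e => hi.2 (Fin.ext e).symm)]
    exact h.unmark i hi.1

/-- Record the big jobs among the samples. -/
def collectProg : Prog :=
  .block [.natConst 26 0] ;;
  .forNat 22 2 (.block [.natLoad 24 0 22, .realLoad 20 0 22] ;;
    .ite (.realLt 24 20)
      (.block [.natLoad 25 2 24] ;;
        .ite (.natLt 25 3) (.block [.natStore 2 24 3, .realStore 2 26 20, .natAdd 26 26 3]) .nop)
      .nop)

theorem exists_lt_succ_iff (w : ℕ → Fin n) (k : ℕ) (j : Fin n) :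
    (∃ i < k + 1, w i = j) ↔ (∃ i < k, w i = j) ∨ w k = j := by
  constructor
  · rintro ⟨i, hi, h⟩
    rcases Nat.lt_succ_iff_lt_or_eq.1 hi with hi | rfl
    · exact .inl ⟨i, hi, h⟩
    · exact .inr h
  · rintro (⟨i, hi, h⟩ | h)
    · exact ⟨i, by omega, h⟩
    · exact ⟨k, by omega, h⟩

theorem collectProg_spec (h : ScaledEnv q m ε p w V s) (hz : ∀ x, s.natArr 2 x = 0) :
    Tr B collectProg s (q.K * 10 + 3) (fun s' => ∃ f N, Recorded p f N s' ∧ N ≤ q.K ∧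
      ∀ j, (∃ x < N, f x = j) ↔ Params.bigBound m ε V < p j ∧ ∃ i < q.K, w i = j) := by
  by_cases hK : q.K = 0 ∧ n = 0
  · exact absurd (w 0).2 (by omega)
  refine Tr.blockSeq 0 rfl ?_ (by omega)
  refine Tr.forNat (T := 8) (fun k s' => ∃ f N, Recorded p f N s' ∧ N ≤ k ∧
    ∀ j, (∃ x < N, f x = j) ↔ Params.bigBound m ε V < p j ∧ ∃ i < k, w i = j) q.K rfl
    (by simpa using h.nat3) (by simpa using h.nat2) ?_ ?_ (fun s' _ h => h) (by omega)
  · exact ⟨w, 0, ⟨by simp [Set.InjOn], by simp, by simp, by simp, by simp [hz]⟩, le_rfl, by simp⟩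
  · rintro k hk s' hf hk' ⟨f, N, h1, h2, h3⟩
    have h₀ : ScaledEnv q m ε p w V (Instr.run [.natConst 26 0] s) :=
      h.of_frame (P := .instr (.natConst 26 0)) (Frame.instr _ _) rfl
    have h' := h₀.of_frame hf rfl
    refine Tr.blockSeq 1 rfl ?_ (by omega)
    refine Tr.ite (T := 5) (fun hc => ?_) (fun hc => ?_) (by omega)
    · simp [h'.real24, hk', h'.vals k hk] at hc
      refine Tr.blockSeq 0 rfl ?_ (by omega)
      refine Tr.ite (T := 3) (fun hd => ?_) (fun hd => ?_) (by omega)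
      · simp [hk', h'.names k hk, h'.nat3] at hd
        have hj : ¬ ∃ x < N, f x = w k := fun hj => by simp [h1.mark _ hj] at hd
        refine Tr.block (by simp) ⟨_, _, h1.snoc (j := w k) hj ?_ ?_ ?_, by omega, ?_⟩ (by simp)
        · simp [h1.nat26, h'.nat3]
        · simp [h1.nat26, h'.vals k hk, hk']
        · simp [h'.nat3, h'.names k hk, hk']
        · intro j
          rw [exists_update_iff, h3, exists_lt_succ_iff]
          constructor
          · rintro (⟨h4, h5⟩ | rfl)
            · exact ⟨h4, .inl h5⟩
            · exact ⟨hc, .inr rfl⟩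
          · rintro ⟨h4, h5 | h5⟩
            · exact .inl ⟨h4, h5⟩
            · exact .inr h5
      · simp [hk', h'.names k hk, h'.nat3] at hd
        have hj : ∃ x < N, f x = w k := by
          by_contra hj
          exact hd (h1.unmark _ hj)
        refine Tr.nop ⟨f, N, h1.congr (by simp) (by simp) (by simp), by omega, fun j => ?_⟩
        rw [h3, exists_lt_succ_iff]
        constructor
        · rintro ⟨h4, h5⟩; exact ⟨h4, .inl h5⟩
        · rintro ⟨h4, h5 | rfl⟩
          · exact ⟨h4, h5⟩
          · exact (h3 _).1 hj
    · simp [h'.real24, hk', h'.vals k hk] at hc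
      refine Tr.nop ⟨f, N, h1.congr (by simp) (by simp) (by simp), by omega, fun j => ?_⟩
      rw [h3, exists_lt_succ_iff]
      constructor
      · rintro ⟨h4, h5⟩; exact ⟨h4, .inl h5⟩
      · rintro ⟨h4, h5 | rfl⟩
        · exact ⟨h4, h5⟩
        · exact absurd h4 (not_lt.2 hc)

/-- Call the black box for the recorded jobs, unless there are more than `m / ε` of them. This may
happen if the total processing time was underestimated, and the call would take too long. -/
def callProg : Prog :=
  .block [.realCast 30 26, .realMul 30 30 0] ;; .ite (.realLt 7 30) .nop (.call 1 26 0 2 3)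

theorem callProg_spec {A : ℕ → ℕ → ℝ → ℕ} (hB : B.IsApproximationScheme) (hA : B.RunsInTime A)
    (hm : 1 ≤ m) (hε : 0 < ε) (hε1 : ε < 1) (hp : ∀ j, 0 < p j)
    (h : ScaledEnv q m ε p w V s) (hz : ∀ x, s.natArr 3 x = 0) {f : ℕ → Fin n} {N : ℕ}
    (hf : Recorded p f N s) :
    Tr B callProg s (A m ⌈(m : ℝ) / ε⌉₊ ε + N + 4) (fun s' => (∀ x < N, s'.natArr 3 x < m) ∧
      (N * ε ≤ m → ∃ σ : Fin N → Fin m, (∀ x, (σ x : ℕ) = s'.natArr 3 x) ∧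
        makespan (fun x : Fin N => p (f x)) σ ≤ (1 + ε) * opt m fun x : Fin N => p (f x))) := by
  refine Tr.blockSeq 1 rfl ?_ (by omega)
  refine Tr.ite (T := A m ⌈(m : ℝ) / ε⌉₊ ε + N + 1) (fun hc => ?_) (fun hc => ?_) (by omega)
  · simp [h.real7, hf.nat26, h.real0] at hc
    exact Tr.nop ⟨by simp [hz]; omega, fun h => absurd hc (not_lt.2 h)⟩
  · simp [h.real7, hf.nat26, h.real0] at hc
    set s₁ := Instr.run [.realCast 30 26, .realMul 30 30 0] s with hs₁
    have e1 : s₁.nat 1 = m := by simp [hs₁, h.nat1]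
    have e2 : s₁.nat 26 = N := by simp [hs₁, hf.nat26]
    have e3 : s₁.real 0 = ε := by simp [hs₁, h.real0]
    have e4 : s₁.jobs 2 N = fun x : Fin N => p (f x) := by
      funext x
      simp [State.jobs, hs₁, hf.times x x.2]
    obtain ⟨σ, hσ, hσ'⟩ := hB m N (fun x => p (f x)) ε hm (fun j => hp _) hε hε1
    have ht := hA m ⌈(m : ℝ) / ε⌉₊ N (fun x => p (f x)) ε hm
      (by exact_mod_cast (le_div_iff₀ hε |>.2 hc).trans (Nat.le_ceil _)) (fun j => hp _) hε hε1
    have hx := Exec.call_eq (B := B) (i := 2) (o := 3) e1 e2 e3 e4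
    have key : ∀ x : Fin N, (s₁.writeNats 3 (B.schedule m N (fun x => p (f x)) ε)).natArr 3 x
        = σ x := fun x => by simp [State.writeNats, hσ]
    exact ⟨_, _, hx, by omega, fun x hx => by rw [key ⟨x, hx⟩]; exact (σ ⟨x, hx⟩).2,
      fun _ => ⟨σ, fun x => (key x).symm, hσ'⟩⟩

/-- The load of machine `i` if job `f x` is on machine `μ x`, for `x < N`. -/
noncomputable def partLoad (p : Fin n → ℝ) (f : ℕ → Fin n) (μ : ℕ → ℕ) (N i : ℕ) : ℝ :=
  ∑ x ∈ range N with μ x = i, p (f x)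

/-- The loads of the machines go to the real array `3`. -/
def loadProg : Prog :=
  .forNat 22 26 (.block [.natLoad 24 3 22, .realLoad 20 2 22, .realLoad 21 3 24,
    .realAdd 21 21 20, .realStore 3 24 21])

theorem loadProg_spec (h3 : s.nat 3 = 1) {f : ℕ → Fin n} {N : ℕ} (hf : Recorded p f N s)
    (hz : ∀ x, s.realArr 3 x = 0) : Tr B loadProg s (N * 7 + 2) (fun s' =>
      ∀ i, s'.realArr 3 i = partLoad p f (s.natArr 3) N i) := by
  refine Tr.forNat (T := 5) (fun k s' => ∀ i, s'.realArr 3 i = partLoad p f (s.natArr 3) k i) N rfl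
    h3 hf.nat26 (by simp [hz, partLoad]) ?_ (fun s' _ h => h) (by omega)
  intro k hk s' hf' hk' h1
  have e1 : s'.natArr 3 = s.natArr 3 := hf'.natArr 3 rfl
  have e2 : s'.realArr 2 k = p (f k) := by rw [hf'.realArr 2 rfl, hf.times k hk]
  refine Tr.block (by simp) (fun i => ?_) (by simp)
  simp [hk', e1, e2, h1, Function.update_apply, partLoad, range_add_one, filter_insert]
  by_cases hi : i = s.natArr 3 k
  · subst hi
    simp [sum_insert]; ring
  · simp [hi, Ne.symm hi]

/-- The makespan, or the bound for list scheduling if that is larger, goes to the real register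
`27`. -/
def valueProg : Prog :=
  .forNat 22 1 (.block [.realLoad 20 3 22] ;;
    .ite (.realLt 27 20) (.block [.realAdd 27 20 9]) .nop)

theorem valueProg_spec (h : ScaledEnv q m ε p w V s) {X : ℝ} (hX : s.real 27 = X) :
    Tr B valueProg s (m * 5 + 2) (fun s' => X ≤ s'.real 27 ∧
      (∀ i < m, s.realArr 3 i ≤ s'.real 27) ∧
      (s'.real 27 = X ∨ ∃ i < m, s'.real 27 = s.realArr 3 i)) := by
  refine Tr.forNat (T := 3) (fun k s' => X ≤ s'.real 27 ∧
      (∀ i < k, s.realArr 3 i ≤ s'.real 27) ∧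
      (s'.real 27 = X ∨ ∃ i < m, s'.real 27 = s.realArr 3 i)) m rfl h.nat3 h.nat1 (by simp [hX])
    ?_ (fun s' _ h => h) (by omega)
  rintro k hk s' hf hk' ⟨h1, h2, h3⟩
  have e1 : s'.realArr 3 = s.realArr 3 := hf.realArr 3 rfl
  have e2 : s'.real 9 = 0 := by rw [hf.real 9 rfl, h.real9]
  refine Tr.blockSeq 0 rfl ?_ (by omega)
  refine Tr.ite (T := 1) (fun hc => ?_) (fun hc => ?_) (by omega)
  · simp [hk', e1] at hc
    refine Tr.block (by simp) ?_ (by simp)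
    simp [hk', e1, e2]
    refine ⟨by linarith, fun i hi => ?_, .inr ⟨k, hk, rfl⟩⟩
    rcases hi.lt_or_eq with hi | rfl
    · exact (h2 i hi).trans hc.le
    · rfl
  · simp [hk', e1] at hc
    refine Tr.nop ?_
    simp
    refine ⟨h1, fun i hi => ?_, h3⟩
    rcases hi.lt_or_eq with hi | rfl
    · exact h2 i hi
    · exact hc

end Makespan

namespace Makespan

open Finset

variable {q : Params} {n m : ℕ} {ε : ℝ} {p : Fin n → ℝ} {w : ℕ → Fin n} {V : ℝ} {B : BlackBox}
  {s s' : State}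

/-- A machine of minimum load goes to the integer register `27`. -/
def argminProg : Prog :=
  .block [.natConst 27 0] ;;
  .forNat 28 1 (.block [.realLoad 21 3 28, .realLoad 22 3 27] ;;
    .ite (.realLt 21 22) (.block [.natAdd 27 28 9]) .nop)

theorem argminProg_spec (h : ScaledEnv q m ε p w V s) (hm : 1 ≤ m) :
    Tr B argminProg s (m * 6 + 3) (fun s' => s'.nat 27 < m ∧
      ∀ i < m, s.realArr 3 (s'.nat 27) ≤ s.realArr 3 i) := by
  refine Tr.blockSeq 0 rfl ?_ (by omega)
  refine Tr.forNat (T := 4) (fun k s' => s'.nat 27 < m ∧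
      ∀ i < k, s.realArr 3 (s'.nat 27) ≤ s.realArr 3 i) m rfl (by simpa using h.nat3)
    (by simpa using h.nat1) (by simp; omega) ?_ (fun s' _ h => h) (by omega)
  rintro k hk s' hf hk' ⟨h1, h2⟩
  have e1 : s'.realArr 3 = s.realArr 3 := by rw [hf.realArr 3 rfl]; simp
  have e2 : s'.nat 9 = 0 := by rw [hf.nat 9 rfl]; simpa using h.nat9
  refine Tr.blockSeq 1 rfl ?_ (by omega)
  refine Tr.ite (T := 1) (fun hc => ?_) (fun hc => ?_) (by omega)
  · simp [hk', e1] at hc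
    refine Tr.block (by simp) ?_ (by simp)
    simp [hk', e2]
    refine ⟨hk, fun i hi => ?_⟩
    rcases hi.lt_or_eq with hi | rfl
    · exact hc.le.trans (h2 i hi)
    · rfl
  · simp [hk', e1] at hc
    refine Tr.nop ?_
    simp
    refine ⟨h1, fun i hi => ?_⟩
    rcases hi.lt_or_eq with hi | rfl
    · exact h2 i hi
    · exact hc

theorem partLoad_snoc {f : ℕ → Fin n} {μ : ℕ → ℕ} {N : ℕ} (j : Fin n) (a i : ℕ) :
    partLoad p (Function.update f N j) (Function.update μ N a) (N + 1) i =
      partLoad p f μ N i + if a = i then p j else 0 := by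
  have h : ∀ x ∈ range N, (if Function.update μ N a x = i then p (Function.update f N j x) else 0) =
      if μ x = i then p (f x) else 0 := fun x hx => by
    rw [Function.update_of_ne (mem_range.1 hx).ne, Function.update_of_ne (mem_range.1 hx).ne]
  simp only [partLoad, sum_filter]
  rw [sum_range_succ, sum_congr rfl h, Function.update_self, Function.update_self]

theorem sum_partLoad {f : ℕ → Fin n} {μ : ℕ → ℕ} {N : ℕ} (h : ∀ x < N, μ x < m) :
    ∑ i ∈ range m, partLoad p f μ N i = ∑ x ∈ range N, p (f x) := by
  unfold partLoad
  exact sum_fiberwise_of_maps_to (fun x hx => mem_range.2 (h x (mem_range.1 hx))) _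

/-- If a job is put on a machine of minimum load, then the new load of this machine is at most the
average load plus `1 - 1 / m` times the processing time of this job. -/
theorem argmin_load_le (hp : ∀ j, 0 < p j) (hm : 1 ≤ m) {f : ℕ → Fin n} {μ : ℕ → ℕ} {N a : ℕ}
    (hμ : ∀ x < N, μ x < m) (hf : Set.InjOn f (Set.Iio N)) {j : Fin n}
    (hj : ¬ ∃ x < N, f x = j) (ha : ∀ i < m, partLoad p f μ N a ≤ partLoad p f μ N i)
    {θ : ℝ} (hθ : p j ≤ θ) :
    partLoad p f μ N a + p j ≤ (∑ j, p j) / m + (1 - 1 / m) * θ := by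
  have h1 : ∑ x ∈ range N, p (f x) + p j ≤ ∑ j, p j := by
    rw [← sum_image (f := p) (g := f) (s := range N)
      (fun x hx y hy => hf (by simpa using hx) (by simpa using hy)), add_comm,
      ← sum_insert (by simpa using hj)]
    exact sum_le_sum_of_subset_of_nonneg (subset_univ _) fun i _ _ => (hp i).le
  have h2 : m * partLoad p f μ N a ≤ ∑ x ∈ range N, p (f x) := by
    rw [← sum_partLoad hμ]
    calc m * partLoad p f μ N a = ∑ i ∈ range m, partLoad p f μ N a := by simp
      _ ≤ _ := sum_le_sum fun i hi => ha i (mem_range.1 hi)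
  have hm' : (1 : ℝ) ≤ m := by exact_mod_cast hm
  have h3 : partLoad p f μ N a ≤ ((∑ j, p j) - p j) / m := by
    rw [le_div_iff₀ (by linarith)]; linarith
  have h4 : (1 - 1 / (m : ℝ)) * p j ≤ (1 - 1 / m) * θ := by
    refine mul_le_mul_of_nonneg_left hθ ?_
    rw [sub_nonneg, div_le_one (by linarith)]; exact hm'
  calc partLoad p f μ N a + p j ≤ ((∑ j, p j) - p j) / m + p j := by linarith
    _ = (∑ j, p j) / m + (1 - 1 / m) * p j := by ring
    _ ≤ _ := by linarith

/-- The recorded jobs are on machines, and the loads of the machines are in the real array `3`. -/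
structure Placed (m : ℕ) (p : Fin n → ℝ) (f : ℕ → Fin n) (μ : ℕ → ℕ) (N : ℕ) (s : State) : Prop
    extends Recorded p f N s where
  machine : ∀ x < N, s.natArr 3 x = μ x
  machine_lt : ∀ x < N, μ x < m
  load : ∀ i, s.realArr 3 i = partLoad p f μ N i

theorem Placed.congr {f : ℕ → Fin n} {μ : ℕ → ℕ} {N : ℕ} (h : Placed m p f μ N s)
    (h1 : s'.nat 26 = s.nat 26) (h2 : s'.realArr 2 = s.realArr 2)
    (h3 : s'.natArr 2 = s.natArr 2) (h4 : s'.natArr 3 = s.natArr 3)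
    (h5 : s'.realArr 3 = s.realArr 3) : Placed m p f μ N s' :=
  ⟨h.toRecorded.congr h1 h2 h3, by rw [h4]; exact h.machine, h.machine_lt,
    by rw [h5]; exact h.load⟩

theorem Placed.snoc {f : ℕ → Fin n} {μ : ℕ → ℕ} {N : ℕ} (h : Placed m p f μ N s) {j : Fin n}
    (hj : ¬ ∃ x < N, f x = j) {a : ℕ} (ha : a < m) (h1 : s'.nat 26 = N + 1)
    (h2 : s'.realArr 2 = Function.update (s.realArr 2) N (p j))
    (h3 : s'.natArr 2 = Function.update (s.natArr 2) j 1)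
    (h4 : s'.natArr 3 = Function.update (s.natArr 3) N a)
    (h5 : s'.realArr 3 = Function.update (s.realArr 3) a (s.realArr 3 a + p j)) :
    Placed m p (Function.update f N j) (Function.update μ N a) (N + 1) s' where
  toRecorded := h.toRecorded.snoc hj h1 h2 h3
  machine := by
    intro x hx
    rcases Nat.lt_succ_iff_lt_or_eq.1 hx with hx | rfl
    · rw [h4, Function.update_of_ne hx.ne, Function.update_of_ne hx.ne, h.machine x hx]
    · rw [h4, Function.update_self, Function.update_self]
  machine_lt := by
    intro x hx
    rcases Nat.lt_succ_iff_lt_or_eq.1 hx with hx | rfl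
    · rw [Function.update_of_ne hx.ne]; exact h.machine_lt x hx
    · rw [Function.update_self]; exact ha
  load := by
    intro i
    rw [partLoad_snoc, h5, Function.update_apply, h.load, h.load]
    by_cases hi : i = a
    · simp [hi]
    · simp [hi, Ne.symm hi]

/-- Record the medium jobs among the samples, and put each of them on a machine of minimum load. -/
def mediumProg : Prog :=
  .forNat 29 2 (.block [.natLoad 24 0 29, .realLoad 20 0 29] ;;
    .ite (.realLt 25 20)
      (.block [.natLoad 25 2 24] ;;
        .ite (.natLt 25 3)
          (argminProg ;; .block [.natStore 3 26 27, .natStore 2 24 3, .realStore 2 26 20,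
            .realLoad 21 3 27, .realAdd 21 21 20, .realStore 3 27 21, .natAdd 26 26 3])
          .nop)
      .nop)

theorem mediumProg_spec (h : ScaledEnv q m ε p w V s) (hm : 1 ≤ m) (hp : ∀ j, 0 < p j)
    {f₀ : ℕ → Fin n} {μ₀ : ℕ → ℕ} {N₀ : ℕ} (h₀ : Placed m p f₀ μ₀ N₀ s)
    (hbig : ∀ j, (∃ x < N₀, f₀ x = j) ↔ Params.bigBound m ε V < p j ∧ ∃ i < q.K, w i = j) :
    Tr B mediumProg s (q.K * (m * 6 + 17) + 2) (fun s' => ∃ f μ N, Placed m p f μ N s' ∧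
      N ≤ N₀ + q.K ∧
      (∀ j, (∃ x < N, f x = j) ↔
        (∃ x < N₀, f₀ x = j) ∨ q.mediumBound m ε V < p j ∧ ∃ i < q.K, w i = j) ∧
      ∀ Y, (∀ i < m, partLoad p f₀ μ₀ N₀ i ≤ Y) →
        (∑ j, p j) / m + (1 - 1 / m) * Params.bigBound m ε V ≤ Y →
        ∀ i < m, partLoad p f μ N i ≤ Y) := by
  refine Tr.forNat (T := m * 6 + 15) (fun k s' => ∃ f μ N, Placed m p f μ N s' ∧ N ≤ N₀ + k ∧
      (∀ j, (∃ x < N, f x = j) ↔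
        (∃ x < N₀, f₀ x = j) ∨ q.mediumBound m ε V < p j ∧ ∃ i < k, w i = j) ∧
      ∀ Y, (∀ i < m, partLoad p f₀ μ₀ N₀ i ≤ Y) →
        (∑ j, p j) / m + (1 - 1 / m) * Params.bigBound m ε V ≤ Y →
        ∀ i < m, partLoad p f μ N i ≤ Y) q.K rfl h.nat3 h.nat2 ?_ ?_ (fun s' _ h => h) le_rfl
  · exact ⟨f₀, μ₀, N₀, h₀.congr (by simp) (by simp) (by simp) (by simp) (by simp), le_rfl,
      by simp, fun Y h _ => h⟩
  · rintro k hk s' hf hk' ⟨f, μ, N, h1, h2, h3, h4⟩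
    have h' := h.of_frame hf rfl
    refine Tr.blockSeq 1 rfl ?_ (by omega)
    refine Tr.ite (T := m * 6 + 12) (fun hc => ?_) (fun hc => ?_) (by omega)
    · simp [h'.real25, hk', h'.vals k hk] at hc
      refine Tr.blockSeq 0 rfl ?_ (by omega)
      refine Tr.ite (T := m * 6 + 10) (fun hd => ?_) (fun hd => ?_) (by omega)
      · simp [hk', h'.names k hk, h'.nat3] at hd
        set s₁ := Instr.run [.natLoad 25 2 24]
          (Instr.run [.natLoad 24 0 29, .realLoad 20 0 29] s') with hs₁
        have hj : ¬ ∃ x < N, f x = w k := fun hj => by simp [h1.mark _ hj] at hd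
        have hfr : Frame (.block [.natLoad 24 0 29, .realLoad 20 0 29, .natLoad 25 2 24]) s' s₁ :=
          Frame.block (by simp) s'
        have hs : ScaledEnv q m ε p w V s₁ := h'.of_frame hfr rfl
        refine Tr.andThen (argminProg_spec hs hm) (fun s₂ f₂ ⟨a1, a2⟩ => ?_) (by omega)
        have e1 : s₂.realArr 3 = s'.realArr 3 := by rw [f₂.realArr 3 rfl]; simp [hs₁]
        have e2 : s₂.realArr 2 = s'.realArr 2 := by rw [f₂.realArr 2 rfl]; simp [hs₁]
        have e3 : s₂.natArr 2 = s'.natArr 2 := by rw [f₂.natArr 2 rfl]; simp [hs₁]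
        have e4 : s₂.natArr 3 = s'.natArr 3 := by rw [f₂.natArr 3 rfl]; simp [hs₁]
        have e5 : s₂.nat 26 = N := by rw [f₂.nat 26 rfl]; simp [hs₁, h1.nat26]
        have e6 : s₂.nat 24 = w k := by rw [f₂.nat 24 rfl]; simp [hs₁, hk', h'.names k hk]
        have e7 : s₂.real 20 = p (w k) := by rw [f₂.real 20 rfl]; simp [hs₁, hk', h'.vals k hk]
        have e8 : s₂.nat 3 = 1 := (hs.of_frame f₂ rfl).nat3
        have a2' : ∀ i < m, partLoad p f μ N (s₂.nat 27) ≤ partLoad p f μ N i := fun i hi => by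
          rw [← h1.load, ← h1.load]; simpa [hs₁] using a2 i hi
        refine Tr.block (by simp) ⟨_, _, _,
          h1.snoc (j := w k) hj a1 ?_ ?_ ?_ ?_ ?_, by omega, ?_, ?_⟩ (by simp)
        · simp [e5, e8]
        · simp [e5, e7, e2]
        · simp [e3, e6, e8]
        · simp [e4, e5]
        · simp [e1, e7]
        · intro j
          rw [exists_update_iff, h3, exists_lt_succ_iff]
          constructor
          · rintro ((h4 | ⟨h4, h5⟩) | rfl)
            · exact .inl h4
            · exact .inr ⟨h4, .inl h5⟩
            · exact .inr ⟨hc, .inr rfl⟩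
          · rintro (h4 | ⟨h4, h5 | h5⟩)
            · exact .inl (.inl h4)
            · exact .inl (.inr ⟨h4, h5⟩)
            · exact .inr h5
        · intro Y hY1 hY2 i hi
          have hsmall : p (w k) ≤ Params.bigBound m ε V := by
            by_contra hlt
            exact hj ((h3 _).2 (.inl ((hbig _).2 ⟨not_le.1 hlt, k, hk, rfl⟩)))
          rw [partLoad_snoc]
          split_ifs with hia
          · rw [← hia]
            exact (argmin_load_le hp hm h1.machine_lt h1.inj hj a2' hsmall).trans hY2
          · rw [add_zero]; exact h4 Y hY1 hY2 i hi
      · simp [hk', h'.names k hk, h'.nat3] at hd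
        have hj : ∃ x < N, f x = w k := by
          by_contra hj
          exact hd (h1.unmark _ hj)
        refine Tr.nop ⟨f, μ, N, h1.congr (by simp) (by simp) (by simp) (by simp) (by simp),
          by omega, fun j => ?_, h4⟩
        rw [h3, exists_lt_succ_iff]
        constructor
        · rintro (h4 | ⟨h4, h5⟩)
          · exact .inl h4
          · exact .inr ⟨h4, .inl h5⟩
        · rintro (h4 | ⟨h4, h5 | rfl⟩)
          · exact .inl h4
          · exact .inr ⟨h4, h5⟩
          · exact (h3 _).1 hj
    · simp [h'.real25, hk', h'.vals k hk] at hc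
      refine Tr.nop ⟨f, μ, N, h1.congr (by simp) (by simp) (by simp) (by simp) (by simp),
        by omega, fun j => ?_, h4⟩
      rw [h3, exists_lt_succ_iff]
      constructor
      · rintro (h4 | ⟨h4, h5⟩)
        · exact .inl h4
        · exact .inr ⟨h4, .inl h5⟩
      · rintro (h4 | ⟨h4, h5 | rfl⟩)
        · exact .inl h4
        · exact .inr ⟨h4, h5⟩
        · exact absurd h4 (not_lt.2 hc)

end Makespan

namespace Makespan

open Finset

/-! ### Computing the sketch schedule -/

variable {q : Params} {n m : ℕ} {ε : ℝ} {p : Fin n → ℝ} {w : ℕ → Fin n} {V : ℝ} {B : BlackBox}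
  {s s' : State}

/-- The number of the class of the processing time `x`, for classes with the upper bounds
`T * (1 - q.δ) ^ k`. It is `q.t` if `x` is too small for all classes. -/
noncomputable def Params.classOf (q : Params) (T x : ℝ) : ℕ :=
  #{k ∈ range q.t | x ≤ T * (1 - q.δ) ^ (k + 1)}

/-- The number of the class of the real register `30` goes to the integer register `30`. -/
def classProg : Prog :=
  .block [.realAdd 31 26 9, .natConst 30 0] ;;
  .forNat 31 7 (.block [.realMul 31 31 8] ;;
    .ite (.realLt 31 30) .nop (.block [.natAdd 30 30 3]))

theorem classProg_spec {T x : ℝ} (h3 : s.nat 3 = 1) (h7 : s.nat 7 = q.t) (h26 : s.real 26 = T)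
    (h8 : s.real 8 = 1 - q.δ) (h9 : s.real 9 = 0) (hx : s.real 30 = x) :
    Tr B classProg s (q.t * 5 + 4) (fun s' => s'.nat 30 = q.classOf T x) := by
  refine Tr.blockSeq 1 rfl ?_ (by omega)
  refine Tr.forNat (T := 3) (fun k s' => s'.real 31 = T * (1 - q.δ) ^ k ∧
    s'.nat 30 = #{k ∈ range k | x ≤ T * (1 - q.δ) ^ (k + 1)}) q.t rfl (by simpa) (by simpa)
    (by simp [h26, h9]) ?_ (fun s' _ h => h.2) (by omega)
  rintro k hk s' hf hk' ⟨h1, h2⟩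
  have e1 : s'.real 30 = x := by rw [hf.real 30 rfl]; simpa
  have e2 : s'.real 8 = 1 - q.δ := by rw [hf.real 8 rfl]; simpa
  have e3 : s'.nat 3 = 1 := by rw [hf.nat 3 rfl]; simpa
  have e4 : T * (1 - q.δ) ^ k * (1 - q.δ) = T * (1 - q.δ) ^ (k + 1) := by ring
  refine Tr.blockSeq 0 rfl ?_ (by omega)
  refine Tr.ite (T := 1) (fun hc => ?_) (fun hc => ?_) (by omega)
  · simp [h1, e1, e2, e4] at hc
    refine Tr.nop ?_
    simp [h1, e2, e4, h2, range_add_one, filter_insert, not_le.2 hc]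
  · simp [h1, e1, e2, e4] at hc
    refine Tr.block (by simp) ?_ (by simp)
    simp [h1, e2, e3, e4, h2, range_add_one, filter_insert, hc]

/-- The number of samples in each class goes to the integer array `4`. -/
def countProg : Prog :=
  .forNat 22 2 (.block [.realLoad 30 0 22] ;; classProg ;;
    .block [.natLoad 25 4 30, .natAdd 25 25 3, .natStore 4 30 25])

theorem countProg_spec (h : ScaledEnv q m ε p w V s) (hz : ∀ x, s.natArr 4 x = 0) :
    Tr B countProg s (q.K * (q.t * 5 + 10) + 2) (fun s' => ∀ k,
      s'.natArr 4 k = #{i ∈ range q.K | q.classOf (q.top m ε V) (p (w i)) = k}) := by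
  refine Tr.forNat (T := q.t * 5 + 8) (fun j s' => ∀ k,
      s'.natArr 4 k = #{i ∈ range j | q.classOf (q.top m ε V) (p (w i)) = k}) q.K rfl h.nat3 h.nat2
    (by simp [hz]) ?_ (fun s' _ h => h) le_rfl
  rintro j hj s' hf hj' h1
  have h' := h.of_frame hf rfl
  refine Tr.blockSeq 0 rfl ?_ (by omega)
  refine Tr.andThen (classProg_spec (q := q) (T := q.top m ε V) (x := p (w j)) ?_ ?_ ?_ ?_ ?_ ?_)
    (fun s₁ f₁ a1 => ?_) (by omega)
  · simp [h'.nat3]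
  · simp [h'.nat7]
  · simp [h'.real26]
  · simp [h'.real8]
  · simp [h'.real9]
  · simp [hj', h'.vals j hj]
  have e1 : s₁.nat 3 = 1 := by rw [f₁.nat 3 rfl]; simp [h'.nat3]
  have e2 : s₁.natArr 4 = s'.natArr 4 := by rw [f₁.natArr 4 rfl]; simp
  refine Tr.block (by simp) (fun k => ?_) (by simp)
  simp [a1, e1, e2, h1, Function.update_apply, range_add_one, filter_insert]
  by_cases hk : k = q.classOf (q.top m ε V) (p (w j))
  · subst hk; simp
  · simp [hk, Ne.symm hk]

/-- The load that each machine may have in the end goes to the real register `28`, and the total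
load that may be added to the machines to the real register `29`. -/
def capacityProg : Prog :=
  .block [.natConst 20 8, .realCast 32 20, .realDiv 32 24 32, .realAdd 28 27 32,
    .realCast 29 9] ;;
  .forNat 22 1 (.block [.realLoad 20 3 22, .realAdd 29 29 20]) ;;
  .block [.realMul 33 7 28, .realSub 29 33 29]

theorem capacityProg_spec (h : ScaledEnv q m ε p w V s) {X : ℝ} (hX : s.real 27 = X) :
    Tr B capacityProg s (m * 4 + 9) (fun s' =>
      s'.real 28 = X + Params.bigBound m ε V / 8 ∧
      s'.real 29 = m * (X + Params.bigBound m ε V / 8) - ∑ i ∈ range m, s.realArr 3 i) := by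
  refine Tr.blockSeq 4 rfl ?_ (by omega)
  refine Tr.andThen (T₁ := m * 4 + 2) (Q' := fun s' => s'.real 29 = ∑ i ∈ range m, s.realArr 3 i)
    ?_ (fun s₁ f₁ h1 => ?_) (by omega)
  · refine Tr.forNat (T := 2) (fun k s' => s'.real 29 = ∑ i ∈ range k, s.realArr 3 i) m rfl
      (by simpa using h.nat3) (by simpa using h.nat1) (by simp [h.nat9]) ?_ (fun s' _ h => h) le_rfl
    intro k hk s' hf hk' h1
    have e1 : s'.realArr 3 = s.realArr 3 := by rw [hf.realArr 3 rfl]; simp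
    refine Tr.block (by simp) ?_ (by simp)
    simp [h1, hk', e1, sum_range_succ]
  · have e1 : s₁.real 28 = X + Params.bigBound m ε V / 8 := by
      rw [f₁.real 28 rfl]; simp [hX, h.real24]
    have e2 : s₁.real 7 = m := by rw [f₁.real 7 rfl]; simp [h.real7]
    refine Tr.block (by simp) ?_ (by simp)
    simp [e1, e2, h1]

/-- The number of recorded jobs in each class on the machine in the integer register `22` goes to
the integer array `5`. -/
def rowProg : Prog :=
  .forNat 23 7 (.block [.natStore 5 23 9]) ;;
  .forNat 32 26 (.block [.natLoad 24 3 32] ;;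
    .ite (.natLt 24 22) .nop (.ite (.natLt 22 24) .nop
      (.block [.realLoad 30 2 32] ;; classProg ;;
        .block [.natLoad 25 5 30, .natAdd 25 25 3, .natStore 5 30 25])))

theorem rowProg_spec {T : ℝ} (h3 : s.nat 3 = 1) (h7 : s.nat 7 = q.t) (hn9 : s.nat 9 = 0)
    (h26 : s.real 26 = T) (h8 : s.real 8 = 1 - q.δ) (h9 : s.real 9 = 0)
    {f : ℕ → Fin n} {μ : ℕ → ℕ} {N i : ℕ} (hp : Placed m p f μ N s) (hi : s.nat 22 = i) :
    Tr B rowProg s (q.t * 3 + 2 + (N * (q.t * 5 + 13) + 2)) (fun s' => ∀ k < q.t,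
      s'.natArr 5 k = #{x ∈ range N | μ x = i ∧ q.classOf T (p (f x)) = k}) := by
  refine Tr.seq (T₁ := q.t * 3 + 2) (Q' := fun s' => ∀ k < q.t, s'.natArr 5 k = 0)
    ?_ (fun s₁ f₁ h1 => ?_) le_rfl
  · refine Tr.forNat (T := 1) (fun k s' => ∀ j < k, s'.natArr 5 j = 0) q.t rfl h3 h7 (by simp)
      ?_ (fun s' _ h => h) le_rfl
    intro k hk s' hf hk' h1
    have e1 : s'.nat 9 = 0 := by rw [hf.nat 9 rfl, hn9]
    refine Tr.block (by simp) (fun j hj => ?_) (by simp)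
    simp [hk', e1, Function.update_apply]
    rcases Nat.lt_succ_iff_lt_or_eq.1 hj with hj | rfl
    · intro _; exact h1 j hj
    · simp
  · refine Tr.forNat (T := q.t * 5 + 11) (fun j s' => ∀ k < q.t,
      s'.natArr 5 k = #{x ∈ range j | μ x = i ∧ q.classOf T (p (f x)) = k}) N rfl
      (by rw [f₁.nat 3 rfl, h3]) (by rw [f₁.nat 26 rfl, hp.nat26]) (by simpa using h1) ?_
      (fun s' _ h => h) le_rfl
    intro j hj s' hf hj' h2
    have e1 : s'.nat 3 = 1 := by rw [hf.nat 3 rfl, f₁.nat 3 rfl, h3]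
    have e2 : s'.nat 22 = i := by rw [hf.nat 22 rfl, f₁.nat 22 rfl, hi]
    have e3 : s'.natArr 3 j = μ j := by
      rw [hf.natArr 3 rfl, f₁.natArr 3 rfl, hp.machine j hj]
    have e4 : s'.realArr 2 j = p (f j) := by
      rw [hf.realArr 2 rfl, f₁.realArr 2 rfl, hp.times j hj]
    refine Tr.blockSeq 0 rfl ?_ (by omega)
    refine Tr.ite (T := q.t * 5 + 9) (fun hc => ?_) (fun hc => ?_) (by omega)
    · simp [hj', e2, e3] at hc
      refine Tr.nop ?_
      simp [range_add_one, filter_insert, hc.ne]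
      exact h2
    simp [hj', e2, e3] at hc
    refine Tr.ite (T := q.t * 5 + 8) (fun hd => ?_) (fun hd => ?_) (by omega)
    · simp [hj', e2, e3] at hd
      refine Tr.nop ?_
      simp [range_add_one, filter_insert, hd.ne']
      exact h2
    simp [hj', e2, e3] at hd
    have hμ : μ j = i := le_antisymm hd hc
    refine Tr.blockSeq 0 rfl ?_ (by omega)
    refine Tr.andThen (classProg_spec (q := q) (T := T) (x := p (f j)) ?_ ?_ ?_ ?_ ?_ ?_)
      (fun s₂ f₂ a1 => ?_) (by omega)
    · simp [e1]
    · simp; rw [hf.nat 7 rfl, f₁.nat 7 rfl, h7]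
    · simp; rw [hf.real 26 rfl, f₁.real 26 rfl, h26]
    · simp; rw [hf.real 8 rfl, f₁.real 8 rfl, h8]
    · simp; rw [hf.real 9 rfl, f₁.real 9 rfl, h9]
    · simp [hj', e4]
    have e5 : s₂.nat 3 = 1 := by rw [f₂.nat 3 rfl]; simp [e1]
    have e6 : s₂.natArr 5 = s'.natArr 5 := by rw [f₂.natArr 5 rfl]; simp
    refine Tr.block (by simp) (fun k hk => ?_) (by simp)
    simp [a1, e5, e6, Function.update_apply, range_add_one, filter_insert, hμ]
    by_cases hk' : k = q.classOf T (p (f j))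
    · rw [if_pos hk', if_pos hk'.symm, card_insert_of_notMem (by simp), ← hk', h2 k hk]
    · rw [if_neg hk', if_neg (Ne.symm hk'), h2 k hk]

/-- The real register `34` is rounded up by computing the binary digits of the largest integer below
it; the integer register `28` runs through the powers of two. -/
def ceilProg : Prog :=
  .block [.natConst 27 0, .natAdd 28 8 9] ;;
  .loop (.natLt 9 28) (.block [.natAdd 24 27 28, .realCast 31 24] ;;
    .ite (.realLt 31 34) (.block [.natAdd 27 24 9]) .nop ;; .block [.natHalf 28 28]) ;;
  .block [.natAdd 27 27 3]

/-- `z` is a rounded value of `x`, unless `x` is too large. -/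
def IsCeil (f : ℕ) (x : ℝ) (z : ℕ) : Prop := 0 < x → x ≤ 2 ^ (f + 1) → x ≤ z ∧ (z : ℝ) ≤ x + 1

theorem ceilProg_spec {x : ℝ} {f : ℕ} (h3 : s.nat 3 = 1) (h8 : s.nat 8 = 2 ^ f)
    (h9 : s.nat 9 = 0) (hx : s.real 34 = x) :
    Tr B ceilProg s (f * 6 + 10) (fun s' => IsCeil f x (s'.nat 27)) := by
  refine Tr.blockSeq 1 rfl ?_ (by omega)
  refine Tr.andThen (T₁ := (f + 1) * 6 + 1) (Q' := fun s' => 0 < x → x ≤ 2 ^ (f + 1) →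
    (s'.nat 27 : ℝ) < x ∧ x ≤ s'.nat 27 + 1) ?_ (fun s₁ f₁ h1 => ?_) (by omega)
  · refine Tr.loop (T := 5) (fun k s' => s'.nat 28 = 2 ^ f / 2 ^ k ∧ (0 < x → x ≤ 2 ^ (f + 1) →
      (s'.nat 27 : ℝ) < x ∧ x ≤ s'.nat 27 + 2 ^ (f + 1 - k))) (f + 1) ?_ ?_ ?_ ?_ le_rfl
    · simp [h8, h9]; exact fun h h' => ⟨h, h'⟩
    · rintro k hk s' hf ⟨h1, h2⟩
      have e1 : s'.nat 9 = 0 := by rw [hf.nat 9 rfl]; simpa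
      have e2 : s'.real 34 = x := by rw [hf.real 34 rfl]; simpa
      have hkf : k ≤ f := by omega
      have e3 : 2 ^ f / 2 ^ k = 2 ^ (f - k) := Nat.pow_div hkf (by norm_num)
      have e4 : 2 ^ f / 2 ^ k / 2 = 2 ^ f / 2 ^ (k + 1) := by
        rw [Nat.div_div_eq_div_mul, pow_succ]
      have e5 : (2 : ℝ) ^ (f + 1 - k) = 2 ^ (f - k) + 2 ^ (f - k) := by
        rw [show f + 1 - k = f - k + 1 by omega]; ring
      refine ⟨by simp [e1, h1, e3], ?_⟩
      refine Tr.blockSeq 1 rfl ?_ (by omega)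
      refine Tr.andThen (T₁ := 2) (Q' := fun s'' => s''.nat 28 = 2 ^ f / 2 ^ k ∧
        (0 < x → x ≤ 2 ^ (f + 1) → (s''.nat 27 : ℝ) < x ∧ x ≤ s''.nat 27 + 2 ^ (f - k))) ?_ ?_
        (by omega)
      · refine Tr.ite (T := 1) (fun hc => ?_) (fun hc => ?_) (by omega)
        · simp [h1, e2, e3] at hc
          refine Tr.block (by simp) ⟨by simp [h1], fun hx0 hx1 => ?_⟩ (by simp)
          have := h2 hx0 hx1
          rw [e5] at this
          simp [h1, e1, e3]
          exact ⟨hc, by linarith⟩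
        · simp [h1, e2, e3] at hc
          refine Tr.nop ⟨by simp [h1], fun hx0 hx1 => ?_⟩
          have := h2 hx0 hx1
          simp
          exact ⟨this.1, hc⟩
      · rintro s₁ f₁ ⟨h3, h4⟩
        refine Tr.block (by simp) ⟨by simp [h3, e4], fun hx0 hx1 => ?_⟩ (by simp)
        simpa using h4 hx0 hx1
    · rintro s' hf ⟨h1, h2⟩
      have e1 : s'.nat 9 = 0 := by rw [hf.nat 9 rfl]; simpa
      have : 2 ^ f / 2 ^ (f + 1) = 0 := Nat.div_eq_of_lt (Nat.pow_lt_pow_right (by norm_num)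
        (by omega))
      simp [e1, h1, this]
    · rintro s' hf ⟨h1, h2⟩ hx0 hx1
      simpa using h2 hx0 hx1
  · have e1 : s₁.nat 3 = 1 := by rw [f₁.nat 3 rfl]; simpa
    refine Tr.block (by simp) (fun hx0 hx1 => ?_) (by simp; omega)
    simp [e1]
    exact ⟨(h1 hx0 hx1).2, (h1 hx0 hx1).1.le⟩

end Makespan

namespace Makespan

open Finset

variable {q : Params} {n m : ℕ} {ε : ℝ} {p : Fin n → ℝ} {w : ℕ → Fin n} {V : ℝ} {B : BlackBox}
  {s s' : State}

/-- The number of slots, before rounding, for a class of small jobs: `c` of the samples are in the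
class `k`, and a fraction `φ` of these jobs is put on the machine. The number of jobs in the class
is deliberately overestimated: with `λ = 1 / (128 * 2 ^ q.a)`, the expected number of samples is
most likely at most `(1 + λ) * c + (1 + λ) / λ * q.R`, and the last term is at most
`2 / λ * q.R`. -/
noncomputable def Params.slots (q : Params) (m : ℕ) (ε V φ : ℝ) (c k : ℕ) : ℝ :=
  (c * (1 / (128 * 2 ^ q.a) + 1) + (128 * 2 ^ q.a + 128 * 2 ^ q.a) * q.R) * (φ * V) / q.K /
    (q.top m ε V * (1 - q.δ) ^ (k + 1))

/-- The entry of the sketch schedule for the machine `i` and the class `k`, from the binary digits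
of a real number or from the integer array `5`, goes to the integer register `27`. -/
def cellProg : Prog :=
  .block [.realMul 35 35 8] ;;
  .ite (.natLt 23 6) (.block [.natLoad 27 5 23])
    (.block [.natLoad 25 4 23, .realCast 33 25, .natConst 20 128, .realCast 36 20, .realMul 36 36 6,
      .realCast 37 3, .realDiv 38 37 36, .realAdd 38 38 37, .realMul 33 33 38, .realAdd 36 36 36,
      .realCast 37 4, .realMul 36 36 37, .realAdd 33 33 36, .realMul 33 33 32, .realCast 37 2,
      .realDiv 33 33 37, .realDiv 34 33 35] ;; ceilProg)

theorem cellProg_spec (h : q.Stored n m ε s) {k : ℕ} (hk : s.nat 23 = k) {φ : ℝ}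
    (h32 : s.real 32 = φ * V) (h35 : s.real 35 = q.top m ε V * (1 - q.δ) ^ k) :
    Tr B cellProg s (q.f * 6 + 29) (fun s' =>
      s'.real 35 = q.top m ε V * (1 - q.δ) ^ (k + 1) ∧ (k < q.s₂ → s'.nat 27 = s.natArr 5 k) ∧
      (q.s₂ ≤ k → IsCeil q.f (q.slots m ε V φ (s.natArr 4 k) k) (s'.nat 27))) := by
  refine Tr.blockSeq 0 rfl ?_ (by omega)
  have e0 : q.top m ε V * (1 - q.δ) ^ k * (1 - q.δ) = q.top m ε V * (1 - q.δ) ^ (k + 1) := by ring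
  refine Tr.ite (T := q.f * 6 + 27) (fun hc => ?_) (fun hc => ?_) (by omega)
  · simp [hk, h.nat6] at hc
    refine Tr.block (by simp) ?_ (by simp)
    simp [hk, h35, h.real8, e0, not_le.2 hc]
  · simp [hk, h.nat6] at hc
    refine Tr.blockSeq 16 rfl ?_ (by omega)
    refine (ceilProg_spec (x := q.slots m ε V φ (s.natArr 4 k) k) (f := q.f)
      (by simp [h.nat3]) (by simp [h.nat8]) (by simp [h.nat9]) ?_).mono (by omega)
      (fun s' f' h' => ⟨?_, fun hk' => absurd hk' (not_lt.2 hc), fun _ => h'⟩)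
    · simp [hk, h35, h.real8, h.real6, h.nat3, h.nat4, h.nat2, h32, e0, Params.slots]
    · rw [f'.real 35 rfl]; simp [h35, h.real8, e0]

/-- The entries of the sketch schedule go to the integer array `0`, which held the names of the
samples until then. -/
def outputProg : Prog :=
  .block [.natConst 21 0] ;;
  .forNat 22 1 (rowProg ;;
    .block [.realLoad 32 3 22, .realSub 32 28 32, .realDiv 32 32 29, .realMul 32 32 23,
      .realAdd 35 26 9] ;;
    .forNat 23 7 (cellProg ;; .block [.natStore 0 21 27, .natAdd 21 21 3]))

theorem outputProg_spec (h : ScaledEnv q m ε p w V s) {f : ℕ → Fin n} {μ : ℕ → ℕ} {N : ℕ}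
    (hp : Placed m p f μ N s) {Y C : ℝ} (hY : s.real 28 = Y) (hC : s.real 29 = C) :
    Tr B outputProg s (m * (q.t * (q.f * 6 + 36) + N * (q.t * 5 + 13) + 13) + 3) (fun s' =>
      ∀ i < m, ∀ k < q.t,
        (k < q.s₂ → s'.natArr 0 (i * q.t + k) =
          #{x ∈ range N | μ x = i ∧ q.classOf (q.top m ε V) (p (f x)) = k}) ∧
        (q.s₂ ≤ k → IsCeil q.f (q.slots m ε V ((Y - partLoad p f μ N i) / C) (s.natArr 4 k) k)
          (s'.natArr 0 (i * q.t + k)))) := by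
  set cell : ℕ → ℕ → ℕ → Prop := fun i k z =>
    (k < q.s₂ → z = #{x ∈ range N | μ x = i ∧ q.classOf (q.top m ε V) (p (f x)) = k}) ∧
        (q.s₂ ≤ k → IsCeil q.f (q.slots m ε V ((Y - partLoad p f μ N i) / C) (s.natArr 4 k) k)
          z) with hcell
  refine Tr.blockSeq 0 rfl ?_ (by omega)
  set s₀ := Instr.run [.natConst 21 0] s with hs₀
  have g₀ : Frame (.instr (.natConst 21 0)) s s₀ := Frame.instr _ _
  have h₀ := h.of_frame g₀ rfl
  refine Tr.forNat (T := q.t * (q.f * 6 + 36) + N * (q.t * 5 + 13) + 11)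
    (fun i s' => s'.nat 21 = i * q.t ∧
      ∀ i' < i, ∀ k < q.t, cell i' k (s'.natArr 0 (i' * q.t + k))) m rfl
    h₀.nat3 h₀.nat1 (by simp [hs₀]) ?_ (fun s' _ h => h.2) le_rfl
  rintro i hi s₁ f₁ hi' ⟨h1, h2⟩
  have g₁ : Frame outputProg s s₁ := g₀.left.trans f₁.right
  refine Tr.andThen (rowProg_spec (q := q) (T := q.top m ε V) (f := f) (μ := μ) (N := N) (m := m)
    (p := p) ?_ ?_ ?_ ?_ ?_ ?_ (hp.congr ?_ ?_ ?_ ?_ ?_) hi') (fun s₂ f₂ h3 => ?_) (by nlinarith)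
  · rw [g₁.nat 3 rfl, h.nat3]
  · rw [g₁.nat 7 rfl, h.nat7]
  · rw [g₁.nat 9 rfl, h.nat9]
  · rw [g₁.real 26 rfl, h.real26]
  · rw [g₁.real 8 rfl, h.real8]
  · rw [g₁.real 9 rfl, h.real9]
  · rw [g₁.nat 26 rfl]
  · rw [g₁.realArr 2 rfl]
  · rw [g₁.natArr 2 rfl]
  · rw [g₁.natArr 3 rfl]
  · rw [g₁.realArr 3 rfl]
  refine Tr.blockSeq 4 rfl ?_ ?_
  rotate_left
  · have : q.t * (q.f * 6 + 36) = q.t * (q.f * 6 + 33) + q.t * 3 := by ring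
    omega
  have e3 : s₂.nat 3 = 1 := by rw [f₂.nat 3 rfl, g₁.nat 3 rfl, h.nat3]
  have e7 : s₂.nat 7 = q.t := by rw [f₂.nat 7 rfl, g₁.nat 7 rfl, h.nat7]
  have e22 : s₂.nat 22 = i := by rw [f₂.nat 22 rfl, hi']
  have e26 : s₂.real 26 = q.top m ε V := by rw [f₂.real 26 rfl, g₁.real 26 rfl, h.real26]
  have e9 : s₂.real 9 = 0 := by rw [f₂.real 9 rfl, g₁.real 9 rfl, h.real9]
  have e28 : s₂.real 28 = Y := by rw [f₂.real 28 rfl, g₁.real 28 rfl, hY]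
  have e29 : s₂.real 29 = C := by rw [f₂.real 29 rfl, g₁.real 29 rfl, hC]
  have e23 : s₂.real 23 = V := by rw [f₂.real 23 rfl, g₁.real 23 rfl, h.real23]
  have e30 : s₂.realArr 3 = s.realArr 3 := by rw [f₂.realArr 3 rfl, g₁.realArr 3 rfl]
  have e0 : s₂.natArr 0 = s₁.natArr 0 := by rw [f₂.natArr 0 rfl]
  have e21 : s₂.nat 21 = i * q.t := by rw [f₂.nat 21 rfl, h1]
  have e4 : s₂.natArr 4 = s.natArr 4 := by rw [f₂.natArr 4 rfl, g₁.natArr 4 rfl]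
  refine Tr.forNat (T := q.f * 6 + 31) (fun k s' => s'.nat 21 = i * q.t + k ∧
      s'.real 35 = q.top m ε V * (1 - q.δ) ^ k ∧
      (∀ i' < i, ∀ k < q.t, cell i' k (s'.natArr 0 (i' * q.t + k))) ∧
      ∀ k' < k, cell i k' (s'.natArr 0 (i * q.t + k'))) q.t rfl
    (by simp [e3]) (by simp [e7]) ?_ ?_ ?_ ?_
  · simp [e21, e26, e9, e0]; exact h2
  · rintro k hk s₃ f₃ hk' ⟨h4, h5, h6, h7⟩
    have g₃ : Frame outputProg s s₃ := g₁.trans <| Frame.right <| Frame.body <|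
      f₂.left.trans <| Frame.right <| (Frame.block (by simp) s₂).left.trans f₃.right
    have hst : q.Stored n m ε s₃ := by
      refine ⟨?_, ?_, ?_, ?_, ?_, ?_, ?_, ?_, ?_, ?_, ?_, ?_, ?_, ?_, ?_, ?_, ?_, ?_⟩
      · rw [g₃.nat 0 rfl, h.nat0]
      · rw [g₃.nat 1 rfl, h.nat1]
      · rw [g₃.nat 2 rfl, h.nat2]
      · rw [g₃.nat 3 rfl, h.nat3]
      · rw [g₃.nat 4 rfl, h.nat4]
      · rw [g₃.nat 5 rfl, h.nat5]
      · rw [g₃.nat 6 rfl, h.nat6]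
      · rw [g₃.nat 7 rfl, h.nat7]
      · rw [g₃.nat 8 rfl, h.nat8]
      · rw [g₃.nat 9 rfl, h.nat9]
      · rw [g₃.real 0 rfl, h.real0]
      · rw [g₃.real 3 rfl, h.real3]
      · rw [g₃.real 4 rfl, h.real4]
      · rw [g₃.real 5 rfl, h.real5]
      · rw [g₃.real 6 rfl, h.real6]
      · rw [g₃.real 7 rfl, h.real7]
      · rw [g₃.real 8 rfl, h.real8]
      · rw [g₃.real 9 rfl, h.real9]
    have a32 : s₃.real 32 = (Y - partLoad p f μ N i) / C * V := by
      rw [f₃.real 32 rfl]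
      simp [e22, e28, e29, e23, e30, hp.load]
    have a5 : s₃.natArr 5 k =
        #{x ∈ range N | μ x = i ∧ q.classOf (q.top m ε V) (p (f x)) = k} := by
      rw [f₃.natArr 5 rfl]; simpa using h3 k hk
    have a4 : s₃.natArr 4 k = s.natArr 4 k := by rw [g₃.natArr 4 rfl]
    refine Tr.andThen (cellProg_spec hst hk' a32 h5) (fun s₄ f₄ ⟨b1, b2, b3⟩ => ?_) (by omega)
    have c21 : s₄.nat 21 = i * q.t + k := by rw [f₄.nat 21 rfl, h4]
    have c3 : s₄.nat 3 = 1 := by rw [f₄.nat 3 rfl, hst.nat3]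
    have c0 : s₄.natArr 0 = s₃.natArr 0 := f₄.natArr 0 rfl
    refine Tr.block (by simp) ⟨by simp [c21, c3]; omega, by simpa using b1, ?_, ?_⟩ (by simp)
    · intro i' hi'' k' hk''
      have : i' * q.t + k' ≠ i * q.t + k := by
        have := Nat.mul_le_mul_right q.t (Nat.succ_le_of_lt hi'')
        rw [Nat.succ_mul] at this
        omega
      simpa [c21, c0, Function.update_apply, this] using h6 i' hi'' k' hk''
    · intro k' hk''
      rcases Nat.lt_succ_iff_lt_or_eq.1 hk'' with hk'' | rfl
      · simpa [c21, c0, Function.update_apply, hk''.ne] using h7 k' hk''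
      · simp only [hcell, Instr.run_cons, Instr.run_nil, Instr.apply]
        simp [c21]
        rw [a5] at b2
        rw [a4] at b3
        exact ⟨b2, b3⟩
  · rintro s₃ f₃ ⟨h4, h5, h6, h7⟩
    refine ⟨by simp [h4]; ring, fun i' hi'' k hk => ?_⟩
    rcases Nat.lt_succ_iff_lt_or_eq.1 hi'' with hi'' | rfl
    · exact h6 i' hi'' k hk
    · exact h7 k hk
  · have : q.t * (q.f * 6 + 36) = q.t * (q.f * 6 + 33) + q.t * 3 := by ring
    simp only [show q.f * 6 + 31 + 2 = q.f * 6 + 33 by ring]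
    omega

end Makespan

namespace Makespan

open Finset

variable {q : Params} {n m : ℕ} {ε : ℝ} {p : Fin n → ℝ} {w : ℕ → Fin n} {B : BlackBox}
  {s s' : State}

/-- The program that processes the samples. -/
def mainProg : Prog :=
  estimateProg ;; medianProg ;; scaleProg ;; collectProg ;; callProg ;; loadProg ;; valueProg ;;
  mediumProg ;; countProg ;; capacityProg ;; outputProg ;;
  .block [.natAdd 0 7 9, .realAdd 1 3 9, .realAdd 2 26 9, .realAdd 0 27 9]

/-- The result of the main program. The collision sum `v` leads to the estimate `V` of the total
processing time. The big jobs are `f₀ 0, …, f₀ (N₀ - 1)`, and the black box puts `f₀ x` on machine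
`μ₀ x`. The big and the medium jobs are `f 0, …, f (N - 1)`, and `f x` is on machine `μ x`. -/
structure Result (q : Params) {n : ℕ} (m : ℕ) (ε : ℝ) (p : Fin n → ℝ) (w : ℕ → Fin n) (v V : ℝ)
    (f₀ f : ℕ → Fin n) (μ₀ μ : ℕ → ℕ) (N₀ N : ℕ) (s : State) : Prop where
  median : IsUpperMedian q.R (fun g => collisions p (fun b => w (g * q.B + b)) q.B) v
  total : V = q.totalEst m v
  big_inj : Set.InjOn f₀ (Set.Iio N₀)
  big_iff : ∀ j, (∃ x < N₀, f₀ x = j) ↔ Params.bigBound m ε V < p j ∧ ∃ i < q.K, w i = j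
  big_lt : ∀ x < N₀, μ₀ x < m
  big_makespan : N₀ * ε ≤ m → ∃ σ : Fin N₀ → Fin m, (∀ x, (σ x : ℕ) = μ₀ x) ∧
    makespan (fun x : Fin N₀ => p (f₀ x)) σ ≤ (1 + ε) * opt m fun x : Fin N₀ => p (f₀ x)
  listBound_le : Params.listBound m ε V ≤ s.real 0
  big_le : ∀ i < m, partLoad p f₀ μ₀ N₀ i ≤ s.real 0
  value : s.real 0 = Params.listBound m ε V ∨ ∃ i < m, s.real 0 = partLoad p f₀ μ₀ N₀ i
  inj : Set.InjOn f (Set.Iio N)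
  iff : ∀ j, (∃ x < N, f x = j) ↔
    (∃ x < N₀, f₀ x = j) ∨ q.mediumBound m ε V < p j ∧ ∃ i < q.K, w i = j
  lt : ∀ x < N, μ x < m
  load_le : ∀ Y, (∀ i < m, partLoad p f₀ μ₀ N₀ i ≤ Y) →
    (∑ j, p j) / m + (1 - 1 / m) * Params.bigBound m ε V ≤ Y →
    ∀ i < m, partLoad p f μ N i ≤ Y
  nat0 : s.nat 0 = q.t
  real1 : s.real 1 = q.δ
  real2 : s.real 2 = q.top m ε V
  cell_big : ∀ i < m, ∀ k < q.t, k < q.s₂ → s.natArr 0 (i * q.t + k) =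
    #{x ∈ range N | μ x = i ∧ q.classOf (q.top m ε V) (p (f x)) = k}
  cell_small : ∀ i < m, ∀ k < q.t, q.s₂ ≤ k → IsCeil q.f
    (q.slots m ε V ((s.real 0 + Params.bigBound m ε V / 8 - partLoad p f μ N i) /
      (m * (s.real 0 + Params.bigBound m ε V / 8) - ∑ i ∈ range m, partLoad p f μ N i))
      #{i ∈ range q.K | q.classOf (q.top m ε V) (p (w i)) = k} k)
    (s.natArr 0 (i * q.t + k))

theorem IsUpperMedian.congr {R : ℕ} {e e' : ℕ → ℝ} {v : ℝ} (h : IsUpperMedian R e v)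
    (he : ∀ a < R, e a = e' a) : IsUpperMedian R e' v := by
  have hc : ∀ a < R, #{b ∈ range R | e' a ≤ e' b} = #{b ∈ range R | e a ≤ e b} := fun a ha => by
    congr 1
    exact filter_congr fun b hb => by rw [he a ha, he b (mem_range.1 hb)]
  refine ⟨h.1.imp_right ?_, fun a ha hr => ?_⟩
  · rintro ⟨a, ha, hv, hr⟩
    exact ⟨a, ha, by rw [hv, he a ha], by rwa [hc a ha]⟩
  · rw [← he a ha]; exact h.2 a ha (by rwa [← hc a ha])

/-- A bound for the number of steps of the main program, without those of the black box. -/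
def Params.mainTime (q : Params) (m : ℕ) : ℕ :=
  q.R * (q.B * 12 + 7) + 4 + (q.R * (q.R * 5 + 10) + 3) + 24 + (q.K * 10 + 3) + (q.K + 4) +
    (q.K * 7 + 2) + (m * 5 + 2) + (q.K * (m * 6 + 17) + 2) + (q.K * (q.t * 5 + 10) + 2) +
    (m * 4 + 9) + (m * (q.t * (q.f * 6 + 36) + (q.K + q.K) * (q.t * 5 + 13) + 13) + 3) + 4

theorem mainProg_spec {A : ℕ → ℕ → ℝ → ℕ} (hB : B.IsApproximationScheme) (hA : B.RunsInTime A)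
    (hm : 1 ≤ m) (hε : 0 < ε) (hε1 : ε < 1) (hp : ∀ j, 0 < p j) (h : Env q m ε p w s)
    (hN : ∀ a, a ≠ 0 → ∀ x, s.natArr a x = 0) (hR : ∀ a, a ≠ 0 → ∀ x, s.realArr a x = 0) :
    Tr B mainProg s (q.mainTime m + A m ⌈(m : ℝ) / ε⌉₊ ε) (fun s' =>
      ∃ v V f₀ f μ₀ μ N₀ N, Result q m ε p w v V f₀ f μ₀ μ N₀ N s') := by
  refine Tr.andThen (estimateProg_spec h (hN 1 (by norm_num))) (fun s₁ g₁ a₁ => ?_)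
    (by unfold Params.mainTime; omega)
  have h₁ := h.of_frame g₁ rfl
  refine Tr.andThen (medianProg_spec h₁) (fun s₂ g₂ a₂ => ?_) (by unfold Params.mainTime; omega)
  have h₂ := h₁.of_frame g₂ rfl
  refine Tr.andThen (scaleProg_spec h₂ rfl) (fun s₃ g₃ ⟨h₃, a₃⟩ => ?_)
    (by unfold Params.mainTime; omega)
  set v := s₂.real 22
  set V := q.totalEst m v with hV
  refine Tr.andThen (collectProg_spec h₃ fun x => ?_) (fun s₄ g₄ ⟨f₀, N₀, r₄, hN₀, a₄⟩ => ?_)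
    (by unfold Params.mainTime; omega)
  · rw [g₃.natArr 2 rfl, g₂.natArr 2 rfl, g₁.natArr 2 rfl, hN 2 (by norm_num)]
  have h₄ := h₃.of_frame g₄ rfl
  refine Tr.andThen (callProg_spec hB hA hm hε hε1 hp h₄ (fun x => ?_) r₄)
    (fun s₅ g₅ ⟨a₅, b₅⟩ => ?_) (by unfold Params.mainTime; omega)
  · rw [g₄.natArr 3 rfl, g₃.natArr 3 rfl, g₂.natArr 3 rfl, g₁.natArr 3 rfl, hN 3 (by norm_num)]
  have h₅ := h₄.of_frame g₅ rfl
  have r₅ : Recorded p f₀ N₀ s₅ :=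
    r₄.congr (g₅.nat 26 rfl) (g₅.realArr 2 rfl) (g₅.natArr 2 rfl)
  refine Tr.andThen ((loadProg_spec h₅.nat3 r₅ fun x => ?_).mono
      (by gcongr : N₀ * 7 + 2 ≤ q.K * 7 + 2) fun _ _ h => h)
    (fun s₆ g₆ a₆ => ?_) (by unfold Params.mainTime; omega)
  · rw [g₅.realArr 3 rfl, g₄.realArr 3 rfl, g₃.realArr 3 rfl, g₂.realArr 3 rfl, g₁.realArr 3 rfl,
      hR 3 (by norm_num)]
  have h₆ := h₅.of_frame g₆ rfl
  set μ₀ := s₅.natArr 3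
  have r₆ : Placed m p f₀ μ₀ N₀ s₆ :=
    ⟨r₅.congr (g₆.nat 26 rfl) (g₆.realArr 2 rfl) (g₆.natArr 2 rfl),
      fun x _ => by rw [g₆.natArr 3 rfl], a₅, a₆⟩
  have a₆' : s₆.real 27 = Params.listBound m ε V := by
    rw [g₆.real 27 rfl, g₅.real 27 rfl, g₄.real 27 rfl, a₃]
  refine Tr.andThen (valueProg_spec h₆ a₆') (fun s₇ g₇ ⟨a₇, b₇, c₇⟩ => ?_)
    (by unfold Params.mainTime; omega)
  have h₇ := h₆.of_frame g₇ rfl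
  have r₇ : Placed m p f₀ μ₀ N₀ s₇ := r₆.congr (g₇.nat 26 rfl) (g₇.realArr 2 rfl)
    (g₇.natArr 2 rfl) (g₇.natArr 3 rfl) (g₇.realArr 3 rfl)
  simp only [a₆] at b₇ c₇
  refine Tr.andThen (mediumProg_spec h₇ hm hp r₇ a₄)
    (fun s₈ g₈ ⟨f, μ, N, r₈, hN', a₈, b₈⟩ => ?_) (by unfold Params.mainTime; omega)
  have h₈ := h₇.of_frame g₈ rfl
  refine Tr.andThen (countProg_spec h₈ fun x => ?_) (fun s₉ g₉ a₉ => ?_)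
    (by unfold Params.mainTime; omega)
  · rw [g₈.natArr 4 rfl, g₇.natArr 4 rfl, g₆.natArr 4 rfl, g₅.natArr 4 rfl, g₄.natArr 4 rfl,
      g₃.natArr 4 rfl, g₂.natArr 4 rfl, g₁.natArr 4 rfl, hN 4 (by norm_num)]
  have h₉ := h₈.of_frame g₉ rfl
  refine Tr.andThen (capacityProg_spec h₉ rfl) (fun s₁₀ g₁₀ ⟨a₁₀, b₁₀⟩ => ?_)
    (by unfold Params.mainTime; omega)
  have h₁₀ := h₉.of_frame g₁₀ rfl
  have r₁₀ : Placed m p f μ N s₁₀ :=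
    (r₈.congr (g₉.nat 26 rfl) (g₉.realArr 2 rfl) (g₉.natArr 2 rfl) (g₉.natArr 3 rfl)
      (g₉.realArr 3 rfl) : Placed m p f μ N s₉).congr (g₁₀.nat 26 rfl) (g₁₀.realArr 2 rfl)
      (g₁₀.natArr 2 rfl) (g₁₀.natArr 3 rfl) (g₁₀.realArr 3 rfl)
  have hNK : N ≤ q.K + q.K := by omega
  refine Tr.andThen ((outputProg_spec h₁₀ r₁₀ a₁₀ b₁₀).mono
      (by gcongr : _ ≤ m * (q.t * (q.f * 6 + 36) + (q.K + q.K) * (q.t * 5 + 13) + 13) + 3)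
      fun _ _ h => h) (fun s₁₁ g₁₁ a₁₁ => ?_) (by unfold Params.mainTime; omega)
  have e7 : s₁₁.nat 7 = q.t := by rw [g₁₁.nat 7 rfl, h₁₀.nat7]
  have e9 : s₁₁.nat 9 = 0 := by rw [g₁₁.nat 9 rfl, h₁₀.nat9]
  have f3 : s₁₁.real 3 = q.δ := by rw [g₁₁.real 3 rfl, h₁₀.real3]
  have f9 : s₁₁.real 9 = 0 := by rw [g₁₁.real 9 rfl, h₁₀.real9]
  have f26 : s₁₁.real 26 = q.top m ε V := by rw [g₁₁.real 26 rfl, h₁₀.real26]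
  have e27 : s₉.real 27 = s₇.real 27 := by rw [g₉.real 27 rfl, g₈.real 27 rfl]
  have f27 : s₁₁.real 27 = s₇.real 27 := by rw [g₁₁.real 27 rfl, g₁₀.real 27 rfl, e27]
  have e4 : ∀ k, s₁₀.natArr 4 k = #{i ∈ range q.K | q.classOf (q.top m ε V) (p (w i)) = k} :=
    fun k => by rw [g₁₀.natArr 4 rfl, a₉]
  have e3 : ∀ i, s₉.realArr 3 i = partLoad p f μ N i := fun i => by
    rw [g₉.realArr 3 rfl, r₈.load]
  simp only [e27, e3, e4] at a₁₁
  refine Tr.block (by simp) ⟨v, V, f₀, f, μ₀, μ, N₀, N, ?_⟩ ?_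
  · constructor
    · exact a₂.congr a₁
    · exact hV
    · exact r₄.inj
    · exact a₄
    · exact a₅
    · exact b₅
    · simpa [f27, f9] using a₇
    · simpa [f27, f9] using b₇
    · simpa [f27, f9] using c₇
    · exact r₁₀.inj
    · exact a₈
    · exact r₁₀.machine_lt
    · exact b₈
    · simp [e7, e9]
    · simp [f3, f9]
    · simp [f26, f9]
    · intro i hi k hk hk'
      simpa using (a₁₁ i hi k hk).1 hk'
    · intro i hi k hk hk'
      simpa [f27, f9] using (a₁₁ i hi k hk).2 hk'
  · simp only [List.length_cons, List.length_nil]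
    unfold Params.mainTime; omega

end Makespan

namespace Makespan

open Finset

/-! ### Independent samples -/

section Sampling

variable {ι α κ : Type*} [Fintype ι] [DecidableEq ι] [Fintype α] {q : α → ℝ}

/-- The expectation of a function of independent samples with the distribution `q`. -/
noncomputable def sampleExp (q : α → ℝ) (F : (ι → α) → ℝ) : ℝ := ∑ ω, (∏ i, q (ω i)) * F ω

/-- The probability of an event for independent samples with the distribution `q`. -/
noncomputable def eventProb (q : α → ℝ) (E : Set (ι → α)) : ℝ :=
  ∑ ω, E.indicator (fun ω => ∏ i, q (ω i)) ω

theorem sampleExp_prod (g : ι → α → ℝ) :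
    sampleExp q (fun ω => ∏ i, g i (ω i)) = ∏ i, ∑ a, q a * g i a := by
  rw [prod_univ_sum, Fintype.piFinset_univ]
  simp [sampleExp, prod_mul_distrib]

theorem sampleExp_sum {s : Finset κ} (F : κ → (ι → α) → ℝ) :
    sampleExp q (fun ω => ∑ k ∈ s, F k ω) = ∑ k ∈ s, sampleExp q (F k) := by
  simp only [sampleExp, mul_sum]
  exact sum_comm

theorem sampleExp_mul_left (c : ℝ) (F : (ι → α) → ℝ) :
    sampleExp q (fun ω => c * F ω) = c * sampleExp q F := by
  simp only [sampleExp, mul_sum]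
  exact sum_congr rfl fun ω _ => by ring

theorem sampleExp_const (hq1 : ∑ a, q a = 1) (c : ℝ) :
    sampleExp q (fun _ : ι → α => c) = c := by
  have h := sampleExp_prod (q := q) (fun (_ : ι) (_ : α) => (1 : ℝ))
  simp only [prod_const_one, mul_one, hq1] at h
  have := sampleExp_mul_left (q := q) (ι := ι) c fun _ => 1
  simp only [mul_one, h] at this
  exact this

/-- One of the samples may be averaged out first. -/
theorem sampleExp_resample (hq1 : ∑ a, q a = 1) (x : ι) (F : (ι → α) → ℝ) :
    sampleExp q F = sampleExp q (fun ω => ∑ a, q a * F (Function.update ω x a)) := by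
  have hsplit : ∀ G : (ι → α) → ℝ, sampleExp q G = ∑ ρ : {j // j ≠ x} → α,
      (∏ j, q (ρ j)) * ∑ c, q c * G ((Equiv.funSplitAt x α).symm (c, ρ)) := fun G => by
    rw [sampleExp, ← (Equiv.funSplitAt x α).symm.sum_comp, Fintype.sum_prod_type, sum_comm]
    refine sum_congr rfl fun ρ _ => ?_
    rw [mul_sum]
    refine sum_congr rfl fun c _ => ?_
    have : ∏ i, q ((Equiv.funSplitAt x α).symm (c, ρ) i) = q c * ∏ j, q (ρ j) := by
      rw [Fintype.prod_eq_mul_prod_subtype_ne _ x]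
      simp only [Equiv.funSplitAt_symm_apply, dif_pos]
      congr 1
      exact prod_congr rfl fun j _ => by rw [dif_neg j.2]
    rw [this]; ring
  rw [hsplit, hsplit]
  refine sum_congr rfl fun ρ _ => ?_
  congr 1
  have hu : ∀ c a, Function.update ((Equiv.funSplitAt x α).symm (c, ρ)) x a =
      (Equiv.funSplitAt x α).symm (a, ρ) := fun c a => by
    funext i
    by_cases hi : i = x
    · subst hi; simp
    · simp [hi]
  simp only [hu]
  rw [← sum_mul, hq1, one_mul]

theorem eventProb_le_sampleExp (hq : ∀ a, 0 ≤ q a) {E : Set (ι → α)} {F : (ι → α) → ℝ}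
    (h0 : ∀ ω, 0 ≤ F ω) (h1 : ∀ ω ∈ E, 1 ≤ F ω) : eventProb q E ≤ sampleExp q F := by
  classical
  refine sum_le_sum fun ω _ => ?_
  have hp : 0 ≤ ∏ i, q (ω i) := prod_nonneg fun i _ => hq _
  rw [Set.indicator_apply]
  split_ifs with h
  · exact le_mul_of_one_le_right hp (h1 ω h)
  · exact mul_nonneg hp (h0 ω)

theorem eventProb_mono (hq : ∀ a, 0 ≤ q a) {E E' : Set (ι → α)} (h : E ⊆ E') :
    eventProb q E ≤ eventProb q E' :=
  sum_le_sum fun _ _ => Set.indicator_le_indicator_of_subset h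
    (fun _ => prod_nonneg fun _ _ => hq _) _

theorem eventProb_compl (hq1 : ∑ a, q a = 1) (E : Set (ι → α)) :
    eventProb q Eᶜ = 1 - eventProb q E := by
  have h := sampleExp_const (ι := ι) hq1 1
  simp only [sampleExp, mul_one] at h
  rw [eq_sub_iff_add_eq, eventProb, eventProb, ← sum_add_distrib, ← h]
  exact sum_congr rfl fun ω _ => congrFun (Set.indicator_compl_add_self E _) ω

theorem eventProb_union_le (hq : ∀ a, 0 ≤ q a) (E E' : Set (ι → α)) :
    eventProb q (E ∪ E') ≤ eventProb q E + eventProb q E' := by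
  classical
  rw [eventProb, eventProb, eventProb, ← sum_add_distrib]
  refine sum_le_sum fun ω _ => ?_
  have hp : 0 ≤ ∏ i, q (ω i) := prod_nonneg fun i _ => hq _
  by_cases h : ω ∈ E <;> by_cases h' : ω ∈ E' <;> simp [h, h', hp]

theorem eventProb_iUnion_le [Fintype κ] (hq : ∀ a, 0 ≤ q a) (E : κ → Set (ι → α)) :
    eventProb q (⋃ k, E k) ≤ ∑ k, eventProb q (E k) := by
  classical
  simp only [eventProb]
  rw [sum_comm]
  refine sum_le_sum fun ω _ => ?_
  have hp : 0 ≤ ∏ i, q (ω i) := prod_nonneg fun i _ => hq _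
  rw [Set.indicator_apply]
  split_ifs with h
  · obtain ⟨k, hk⟩ := Set.mem_iUnion.1 h
    calc ∏ i, q (ω i) = (E k).indicator (fun ω => ∏ i, q (ω i)) ω := by simp [hk]
      _ ≤ _ := single_le_sum (f := fun k => (E k).indicator (fun ω => ∏ i, q (ω i)) ω)
        (fun k _ => Set.indicator_apply_nonneg fun _ => hp) (mem_univ k)
  · exact sum_nonneg fun k _ => Set.indicator_apply_nonneg fun _ => hp

theorem exp_neg_le {l : ℝ} (h0 : 0 ≤ l) : l / (1 + l) ≤ 1 - Real.exp (-l) := by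
  have h : 1 + l ≤ Real.exp l := by linarith [Real.add_one_le_exp l]
  rw [Real.exp_neg, div_le_iff₀ (by linarith)]
  have h2 : (Real.exp l)⁻¹ ≤ (1 + l)⁻¹ := inv_anti₀ (by linarith) h
  have h3 : (1 + l) * (1 + l)⁻¹ = 1 := mul_inv_cancel₀ (by linarith)
  nlinarith

/-- A Chernoff bound for the lower tail, in a form with a multiplicative and an additive error:
the set `S` of jobs is hit by at least about as many samples as expected. -/
theorem eventProb_few_hits_le [DecidableEq α] (hq : ∀ a, 0 ≤ q a) (hq1 : ∑ a, q a = 1)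
    (S : Finset α) {l r : ℝ} (h0 : 0 < l) :
    eventProb q {ω : ι → α | (1 + l) * #{i | ω i ∈ S} + (1 + l) / l * r <
      (∑ a ∈ S, q a) * Fintype.card ι} ≤ Real.exp (-r) := by
  set Q := ∑ a ∈ S, q a with hQ
  set K : ℝ := (Fintype.card ι : ℝ) with hK
  have hQ0 : 0 ≤ Q := sum_nonneg fun a _ => hq a
  have hK0 : 0 ≤ K := by positivity
  refine (eventProb_le_sampleExp (F := fun ω => Real.exp ((1 - Real.exp (-l)) * Q * K - r) *
    ∏ i, Real.exp (if ω i ∈ S then -l else 0)) hq (fun ω => by positivity) ?_).trans ?_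
  · intro ω hω
    rw [← Real.exp_sum, ← Real.exp_add]
    apply Real.one_le_exp
    have hc : ∑ i, (if ω i ∈ S then -l else 0) = -l * #{i | ω i ∈ S} := by
      rw [sum_ite]; simp; ring
    rw [hc]
    simp only [Set.mem_ofPred_eq] at hω
    have h2 : l * #{i | ω i ∈ S} + r < l / (1 + l) * (Q * K) := by
      calc _ = l / (1 + l) * ((1 + l) * #{i | ω i ∈ S} + (1 + l) / l * r) := by field_simp
        _ < _ := by gcongr
    have h3 := mul_le_mul_of_nonneg_right (exp_neg_le h0.le) (mul_nonneg hQ0 hK0)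
    linarith
  · rw [sampleExp_mul_left, sampleExp_prod (fun _ a => Real.exp (if a ∈ S then -l else 0))]
    have h2 : ∑ a, q a * Real.exp (if a ∈ S then -l else 0) = 1 - (1 - Real.exp (-l)) * Q := by
      have : ∀ a, q a * Real.exp (if a ∈ S then -l else 0) =
          q a - (1 - Real.exp (-l)) * if a ∈ S then q a else 0 := fun a => by
        split_ifs
        · ring
        · simp
      rw [sum_congr rfl fun a _ => this a, sum_sub_distrib, hq1, ← mul_sum, hQ, sum_ite_mem,
        univ_inter]
    rw [h2, prod_const, card_univ]
    have h3 : 1 - (1 - Real.exp (-l)) * Q ≤ Real.exp (-((1 - Real.exp (-l)) * Q)) := by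
      linarith [Real.add_one_le_exp (-((1 - Real.exp (-l)) * Q))]
    have h4 : 0 ≤ 1 - (1 - Real.exp (-l)) * Q := by
      rw [← h2]; exact sum_nonneg fun a _ => mul_nonneg (hq a) (Real.exp_pos _).le
    calc _ ≤ Real.exp ((1 - Real.exp (-l)) * Q * K - r) *
          Real.exp (-((1 - Real.exp (-l)) * Q)) ^ Fintype.card ι := by gcongr
      _ = _ := by
        rw [← Real.exp_nat_mul, ← Real.exp_add]
        congr 1; rw [← hK]; ring

end Sampling

/-- Functions of disjoint groups of samples are independent. -/
theorem sampleExp_groups {α : Type*} [Fintype α] {q : α → ℝ} {R B : ℕ} (h : (Fin B → α) → ℝ) :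
    sampleExp q (fun ω : Fin (R * B) → α => ∏ g, h fun b => ω (finProdFinEquiv (g, b))) =
      sampleExp q h ^ R := by
  classical
  have h1 := sampleExp_prod (ι := Fin R) (α := Fin B → α) (q := fun ρ => ∏ b, q (ρ b))
    fun _ => h
  simp only [prod_const, card_univ, Fintype.card_fin] at h1
  rw [show sampleExp q h = ∑ a, (∏ b, q (a b)) * h a from rfl, ← h1]
  simp only [sampleExp]
  refine Fintype.sum_equiv ((finProdFinEquiv.symm.arrowCongr (Equiv.refl α)).trans
    (Equiv.curry _ _ _)) _ _ fun ω => ?_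
  congr 1
  rw [← finProdFinEquiv.prod_comp, Fintype.prod_prod_type]
  rfl

/-- If an event has probability at most `1 / 16` for each group of samples, then it is unlikely
that it happens for at least half of the groups. -/
theorem eventProb_half_le {α : Type*} [Fintype α] {q : α → ℝ} (hq : ∀ a, 0 ≤ q a)
    (hq1 : ∑ a, q a = 1) {R B : ℕ} {E : Set (Fin B → α)} [DecidablePred (· ∈ E)]
    (hE : eventProb q E ≤ 1 / 16) :
    eventProb q {ω : Fin (R * B) → α |
      R ≤ 2 * #{g : Fin R | (fun b => ω (finProdFinEquiv (g, b))) ∈ E}} ≤ (1 / 2) ^ R := by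
  classical
  -- Markov's inequality for `16 ^ c`, where `c` is the number of groups for which `E` happens
  refine (eventProb_le_sampleExp (F := fun ω => (1 / 4) ^ R *
    ∏ g : Fin R, (fun ρ => if ρ ∈ E then 16 else 1) fun b => ω (finProdFinEquiv (g, b))) hq
    (fun ω => ?_) ?_).trans ?_
  · exact mul_nonneg (by positivity) (prod_nonneg fun g _ => by dsimp only; split_ifs <;> norm_num)
  · intro ω hω
    simp only [Set.mem_ofPred_eq] at hω
    dsimp only
    rw [prod_ite, prod_const, prod_const_one, mul_one, one_div, inv_pow,
      ← div_eq_inv_mul, le_div_iff₀ (by positivity), one_mul,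
      show (16 : ℝ) = 4 ^ 2 by norm_num, ← pow_mul]
    exact pow_le_pow_right₀ (by norm_num) hω
  · rw [sampleExp_mul_left,
      sampleExp_groups (fun ρ => if ρ ∈ E then (16 : ℝ) else 1), ← mul_pow]
    have h1 : sampleExp q (fun ρ : Fin B → α => if ρ ∈ E then (16 : ℝ) else 1) =
        1 + 15 * eventProb q E := by
      have h0 : ∑ ω : Fin B → α, ∏ i, q (ω i) = 1 := by
        simpa [sampleExp] using sampleExp_const (ι := Fin B) hq1 1
      rw [eventProb, mul_sum, ← h0, ← sum_add_distrib]
      refine sum_congr rfl fun ω _ => ?_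
      by_cases h : ω ∈ E
      · simp only [h, if_true, Set.indicator_of_mem]; ring
      · simp [h, h0]
    have h2 : 0 ≤ eventProb q E := sum_nonneg fun ω _ =>
      Set.indicator_nonneg (fun ω _ => prod_nonneg fun i _ => hq _) _
    rw [h1]
    exact pow_le_pow_left₀ (by linarith) (by linarith) R

end Makespan

namespace Makespan

open Finset

/-! ### The variance of the collision sums -/

section Collisions

variable {n B : ℕ} {p : Fin n → ℝ}

/-- The pairs of samples in a group. -/
def samplePairs (B : ℕ) : Finset (Fin B × Fin B) := {e | e.1 < e.2}

theorem card_samplePairs (B : ℕ) : (#(samplePairs B) : ℝ) = B * (B - 1) / 2 := by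
  have h : #(samplePairs B) = ∑ b ∈ range B, b := by
    rw [samplePairs, card_filter, Fintype.sum_prod_type_right, Finset.sum_range]
    refine sum_congr rfl fun b _ => ?_
    rw [← card_filter]
    simp [Finset.filter_gt_eq_Iio]
  have h2 := Finset.sum_range_id_mul_two B
  rw [← h] at h2
  have h3 : (#(samplePairs B) : ℝ) * 2 = B * ((B - 1 : ℕ) : ℝ) := by exact_mod_cast h2
  rcases B with _ | B
  · simp at h3; simp [h3]
  · simp at h3 ⊢; linarith

/-- The contribution of a pair of samples to the collision sum, minus its mean. -/
noncomputable def pairTerm (p : Fin n → ℝ) (e : Fin B × Fin B) (ω : Fin B → Fin n) : ℝ :=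
  (if ω e.1 = ω e.2 then 1 / p (ω e.2) else 0) - 1 / ∑ j, p j

theorem collisions_eq {w : ℕ → Fin n} {ω : Fin B → Fin n} (h : ∀ b : Fin B, w b = ω b) :
    collisions p w B - B * (B - 1) / 2 / ∑ j, p j = ∑ e ∈ samplePairs B, pairTerm p e ω := by
  simp only [pairTerm, sum_sub_distrib, sum_const, nsmul_eq_mul, card_samplePairs]
  rw [mul_one_div, sub_left_inj, collisions, Finset.sum_range, samplePairs, sum_filter,
    Fintype.sum_prod_type_right]
  refine sum_congr rfl fun b _ => ?_
  rw [← sum_filter, ← sum_filter, filter_filter, sum_congr rfl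
    (g := fun _ => 1 / p (ω b)) (fun x _ => rfl), sum_const, nsmul_eq_mul, mul_one_div, h b]
  congr 1
  rw [Nat.cast_inj]
  symm
  refine card_bij (fun a _ => (a : ℕ)) ?_ (fun a _ a' _ h => Fin.ext h) ?_
  · intro a ha
    simp only [mem_filter, mem_univ, true_and] at ha
    simp [h, ha.1, ha.2]
  · intro x hx
    simp only [mem_filter, mem_range] at hx
    have hxB : x < B := hx.1.trans b.2
    exact ⟨⟨x, hxB⟩, mem_filter.2 ⟨mem_univ _, hx.1, (h ⟨x, hxB⟩).symm.trans hx.2⟩, rfl⟩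

/-- Averaging out one of the two samples of a pair gives zero. -/
theorem sum_pairTerm_eq_zero (hp : ∀ j, 0 < p j) {e : Fin B × Fin B} (he : e.1 < e.2) {x : Fin B}
    (hx : x = e.1 ∨ x = e.2) (ω : Fin B → Fin n) :
    ∑ a, p a / (∑ j, p j) * pairTerm p e (Function.update ω x a) = 0 := by
  have hW : 0 < ∑ j, p j := sum_pos (fun j _ => hp j) ⟨ω e.1, mem_univ _⟩
  have h1 : ∑ a, p a / (∑ j, p j) = 1 := by rw [← sum_div, div_self hW.ne']
  simp only [pairTerm, mul_sub, sum_sub_distrib]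
  rw [← sum_mul, h1, one_mul, sub_eq_zero]
  rcases hx with rfl | rfl
  · simp only [Function.update_self, Function.update_of_ne he.ne']
    simp only [mul_ite, mul_zero, sum_ite_eq', mem_univ, if_true]
    field_simp [(hp (ω e.2)).ne']
  · simp only [Function.update_self, Function.update_of_ne he.ne]
    simp only [mul_ite, mul_zero, sum_ite_eq, mem_univ, if_true]
    field_simp [(hp (ω e.1)).ne']

/-- Different pairs are uncorrelated, also if they share a sample: there is a sample that belongs
to only one of them, and averaging it out gives zero. -/
theorem sampleExp_pairTerm_mul (hp : ∀ j, 0 < p j) (hn : 1 ≤ n) {e e' : Fin B × Fin B}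
    (he : e.1 < e.2) (he' : e'.1 < e'.2) (hne : e ≠ e') :
    sampleExp (fun j => p j / ∑ j, p j) (fun ω => pairTerm p e ω * pairTerm p e' ω) = 0 := by
  have hW : 0 < ∑ j, p j := sum_pos (fun j _ => hp j) ⟨⟨0, hn⟩, mem_univ _⟩
  have h1 : ∑ a, p a / (∑ j, p j) = 1 := by rw [← sum_div, div_self hW.ne']
  obtain ⟨x, hx, hx1, hx2⟩ : ∃ x, (x = e.1 ∨ x = e.2) ∧ x ≠ e'.1 ∧ x ≠ e'.2 := by
    by_contra! h
    have h1 := h e.1 (.inl rfl)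
    have h2 := h e.2 (.inr rfl)
    apply hne
    by_cases h3 : e.1 = e'.1
    · exact Prod.ext h3 (h2 (by rw [← h3]; exact he.ne'))
    · have h4 := h1 h3
      by_cases h5 : e.2 = e'.1
      · rw [h4, h5] at he; exact absurd he (not_lt.2 he'.le)
      · rw [h4, h2 h5] at he; exact absurd he (lt_irrefl _)
  rw [sampleExp_resample h1 x]
  have : ∀ ω : Fin B → Fin n, ∑ a, p a / (∑ j, p j) *
      (pairTerm p e (Function.update ω x a) * pairTerm p e' (Function.update ω x a)) = 0 := by
    intro ω
    have h2 : ∀ a, pairTerm p e' (Function.update ω x a) = pairTerm p e' ω := fun a => by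
      simp only [pairTerm, Function.update_of_ne hx1.symm, Function.update_of_ne hx2.symm]
    simp only [h2, ← mul_assoc, ← sum_mul]
    rw [sum_pairTerm_eq_zero hp he hx, zero_mul]
  simp only [this]
  simp [sampleExp]

/-- The second moment of `1 / p j` for a colliding pair is `∑ j, (p j / W) ^ 2 * (1 / p j) ^ 2`,
which is `n / W ^ 2` for the total processing time `W`. -/
theorem sampleExp_pairTerm_sq_le (hp : ∀ j, 0 < p j) (hn : 1 ≤ n) {e : Fin B × Fin B}
    (he : e.1 < e.2) :
    sampleExp (fun j => p j / ∑ j, p j) (fun ω => pairTerm p e ω * pairTerm p e ω) ≤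
      n / (∑ j, p j) ^ 2 := by
  have hW : 0 < ∑ j, p j := sum_pos (fun j _ => hp j) ⟨⟨0, hn⟩, mem_univ _⟩
  set W := ∑ j, p j with hWdef
  have h1 : ∑ a, p a / W = 1 := by rw [← sum_div, div_self hW.ne']
  rw [sampleExp_resample h1 e.1, sampleExp_resample h1 e.2]
  have h2 : ∀ ω : Fin B → Fin n, ∑ a, p a / W *
      (pairTerm p e (Function.update ω e.1 a) * pairTerm p e (Function.update ω e.1 a)) =
      1 / (W * p (ω e.2)) - 1 / W ^ 2 := by
    intro ω
    have h3 := sum_pairTerm_eq_zero hp he (.inl rfl) ω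
    rw [← hWdef] at h3
    have h4 : ∀ a, p a / W *
        (pairTerm p e (Function.update ω e.1 a) * pairTerm p e (Function.update ω e.1 a)) =
        (if a = ω e.2 then 1 / (W * p a) else 0) - 2 / W * (p a / W *
          pairTerm p e (Function.update ω e.1 a)) - p a / W * (1 / W ^ 2) := by
      intro a
      have := hp a
      simp only [pairTerm, Function.update_self, Function.update_of_ne he.ne', ← hWdef]
      split_ifs with h
      · subst h; field_simp; ring
      · field_simp; ring
    rw [sum_congr rfl fun a _ => h4 a, sum_sub_distrib, sum_sub_distrib, ← mul_sum, h3, ← sum_mul,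
      h1]
    simp
  simp only [h2, Function.update_self]
  rw [sampleExp_const h1]
  have h5 : ∀ a, p a / W * (1 / (W * p a) - 1 / W ^ 2) = 1 / W ^ 2 - p a / W * (1 / W ^ 2) := by
    intro a
    have := hp a
    field_simp
  rw [sum_congr rfl fun a _ => h5 a, sum_sub_distrib, ← sum_mul, h1]
  simp
  have : 0 ≤ (W ^ 2)⁻¹ := by positivity
  rw [div_eq_mul_inv]; linarith

/-- Chebyshev's inequality for the collision sum of a group of samples. -/
theorem eventProb_collisions_le (hp : ∀ j, 0 < p j) (hn : 1 ≤ n) (hB : 2 ≤ B) {η : ℝ}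
    (hη : 0 < η) :
    eventProb (fun j => p j / ∑ j, p j) {ω : Fin B → Fin n |
      η * (B * (B - 1) / 2 / ∑ j, p j) < |∑ e ∈ samplePairs B, pairTerm p e ω|} ≤
      n / (η ^ 2 * (B * (B - 1) / 2)) := by
  have hW : 0 < ∑ j, p j := sum_pos (fun j _ => hp j) ⟨⟨0, hn⟩, mem_univ _⟩
  set W := ∑ j, p j with hWdef
  have hB' : (2 : ℝ) ≤ B := by exact_mod_cast hB
  set P : ℝ := B * (B - 1) / 2 with hP
  have hP0 : 0 < P := by
    rw [hP]; have : 0 < (B : ℝ) - 1 := by linarith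
    positivity
  refine (eventProb_le_sampleExp (F := fun ω => 1 / (η * (P / W)) ^ 2 *
    ∑ e ∈ samplePairs B, ∑ e' ∈ samplePairs B, pairTerm p e ω * pairTerm p e' ω)
    (fun j => (div_pos (hp j) hW).le) (fun ω => ?_) ?_).trans ?_
  · rw [← sum_mul_sum]
    exact mul_nonneg (by positivity) (mul_self_nonneg _)
  · intro ω hω
    simp only [Set.mem_ofPred_eq] at hω
    have h0 : 0 < η * (P / W) := by positivity
    rw [← sum_mul_sum, one_div, ← div_eq_inv_mul, le_div_iff₀ (by positivity), one_mul, ← sq,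
      ← sq_abs (∑ e ∈ samplePairs B, pairTerm p e ω)]
    gcongr
  · rw [sampleExp_mul_left, sampleExp_sum]
    have h1 : ∀ e ∈ samplePairs B, sampleExp (fun j => p j / W)
        (fun ω => ∑ e' ∈ samplePairs B, pairTerm p e ω * pairTerm p e' ω) ≤ n / W ^ 2 := by
      intro e he
      rw [sampleExp_sum, sum_eq_single_of_mem e he]
      · exact sampleExp_pairTerm_sq_le hp hn (by simpa [samplePairs] using he)
      · intro e' he' hne
        exact sampleExp_pairTerm_mul hp hn (by simpa [samplePairs] using he)
          (by simpa [samplePairs] using he') hne.symm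
    calc _ ≤ 1 / (η * (P / W)) ^ 2 * ∑ e ∈ samplePairs B, (n / W ^ 2 : ℝ) := by
          gcongr with e he; exact h1 e he
      _ = n / (η ^ 2 * P) := by
        rw [sum_const, nsmul_eq_mul, card_samplePairs, ← hP]
        field_simp

end Collisions

end Makespan

namespace Makespan

open Finset

/-! ### Bounds for the parameters -/

section Bounds

variable {q : Params} {n m : ℕ} {ε γ : ℝ}

/-- The setting of the theorem, with the parameters that the algorithm computes. -/
structure Setting (q : Params) (n m : ℕ) (ε γ : ℝ) : Prop extends q.Valid n m ε γ where
  hn : 1 ≤ n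
  hm : 1 ≤ m
  ε_pos : 0 < ε
  ε_lt : ε < 1
  γ_pos : 0 < γ
  γ_lt : γ < 1

theorem Setting.n_ge (h : Setting q n m ε γ) : (1 : ℝ) ≤ n := by exact_mod_cast h.hn
theorem Setting.m_ge (h : Setting q n m ε γ) : (1 : ℝ) ≤ m := by exact_mod_cast h.hm

theorem Setting.a_ge (h : Setting q n m ε γ) : 1 / ε ≤ 2 ^ q.a := h.a.le
theorem Setting.a_le (h : Setting q n m ε γ) : (2 : ℝ) ^ q.a ≤ 2 / ε := by
  have := h.a.ge (by rw [le_div_iff₀ h.ε_pos]; linarith [h.ε_lt])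
  rwa [mul_one_div] at this
theorem Params.one_le_a (q : Params) : (1 : ℝ) ≤ 2 ^ q.a := one_le_pow₀ (by norm_num)

theorem Setting.one_le_mul_a (h : Setting q n m ε γ) : 1 ≤ ε * 2 ^ q.a := by
  have := h.a_ge
  rwa [div_le_iff₀ h.ε_pos, mul_comm] at this

theorem Setting.l_ge (h : Setting q n m ε γ) : 64 * n * m * 2 ^ q.a ≤ (2 : ℝ) ^ q.l := h.l.le

theorem Setting.one_le_nma (h : Setting q n m ε γ) : (1 : ℝ) ≤ n * m * 2 ^ q.a :=
  one_le_mul_of_one_le_of_one_le (one_le_mul_of_one_le_of_one_le h.n_ge h.m_ge) q.one_le_a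

theorem Setting.l_le (h : Setting q n m ε γ) : (2 : ℝ) ^ q.l ≤ 128 * (n * m * 2 ^ q.a) := by
  have := h.l.ge (by linarith [h.one_le_nma])
  linarith

theorem Setting.R_ge (h : Setting q n m ε γ) : 64 * n * n * m * 2 ^ q.a / γ ≤ (2 : ℝ) ^ q.R :=
  h.R.le

theorem Setting.R_le (h : Setting q n m ε γ) :
    (2 : ℝ) ^ q.R ≤ 128 * (n * (n * m * 2 ^ q.a)) / γ := by
  have h1 : 1 ≤ (n : ℝ) * (n * m * 2 ^ q.a) := one_le_mul_of_one_le_of_one_le h.n_ge h.one_le_nma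
  have := h.R.ge (by rw [le_div_iff₀ h.γ_pos]; linarith [h.γ_lt])
  calc _ ≤ _ := this
    _ = _ := by ring

theorem Params.T_ge (q : Params) : (8 : ℝ) ≤ q.T := by
  unfold Params.T; push_cast; linarith [Nat.cast_nonneg (α := ℝ) q.l, Nat.cast_nonneg (α := ℝ) q.a]

theorem Setting.B_ge (h : Setting q n m ε γ) :
    1048576 * 2 ^ q.a * 2 ^ q.a * 2 ^ q.a * m * q.T * √n ≤ (q.B : ℝ) := by
  have h1 := h.b
  have h2 : (1048576 * 2 ^ q.a * 2 ^ q.a * 2 ^ q.a * m * q.T *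
      (1048576 * 2 ^ q.a * 2 ^ q.a * 2 ^ q.a * m * q.T) * n : ℝ) =
      (1048576 * 2 ^ q.a * 2 ^ q.a * 2 ^ q.a * m * q.T * √n) *
      (1048576 * 2 ^ q.a * 2 ^ q.a * 2 ^ q.a * m * q.T * √n) := by
    have : √(n : ℝ) * √n = n := Real.mul_self_sqrt (Nat.cast_nonneg n)
    rw [← this]; simp only [this]; ring_nf; rw [Real.sq_sqrt (Nat.cast_nonneg n)]
  rw [h2] at h1
  simpa [Params.B] using h1.le

theorem Setting.one_le_sqrt (h : Setting q n m ε γ) : 1 ≤ √(n : ℝ) := Real.one_le_sqrt.2 h.n_ge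

theorem Setting.B_le (h : Setting q n m ε γ) :
    (q.B : ℝ) ≤ 2097152 * 2 ^ q.a * 2 ^ q.a * 2 ^ q.a * m * q.T * √n := by
  have h1 := h.b
  have h2 : (1048576 * 2 ^ q.a * 2 ^ q.a * 2 ^ q.a * m * q.T *
      (1048576 * 2 ^ q.a * 2 ^ q.a * 2 ^ q.a * m * q.T) * n : ℝ) =
      (1048576 * 2 ^ q.a * 2 ^ q.a * 2 ^ q.a * m * q.T * √n) *
      (1048576 * 2 ^ q.a * 2 ^ q.a * 2 ^ q.a * m * q.T * √n) := by
    have : √(n : ℝ) * √n = n := Real.mul_self_sqrt (Nat.cast_nonneg n)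
    rw [← this]; simp only [this]; ring_nf; rw [Real.sq_sqrt (Nat.cast_nonneg n)]
  rw [h2] at h1
  have ha := q.one_le_a
  have h3 : 1 ≤ 1048576 * 2 ^ q.a * 2 ^ q.a * 2 ^ q.a * m * q.T * √(n : ℝ) := by
    have e1 : (1 : ℝ) ≤ 1048576 * 2 ^ q.a := by linarith
    have e2 := one_le_mul_of_one_le_of_one_le e1 ha
    have e3 := one_le_mul_of_one_le_of_one_le e2 ha
    have e4 := one_le_mul_of_one_le_of_one_le e3 h.m_ge
    have e5 := one_le_mul_of_one_le_of_one_le e4 (by linarith [q.T_ge] : (1 : ℝ) ≤ q.T)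
    exact one_le_mul_of_one_le_of_one_le e5 h.one_le_sqrt
  have := h1.ge h3
  simp only [Params.B, Nat.cast_pow, Nat.cast_ofNat]
  linarith

theorem Setting.f_ge (h : Setting q n m ε γ) :
    262144 * 2 ^ q.l * 2 ^ q.l * 2 ^ q.l * 2 ^ q.a * 2 ^ q.a ≤ (2 : ℝ) ^ q.f :=
  h.f.le

theorem Setting.f_le (h : Setting q n m ε γ) : (2 : ℝ) ^ q.f ≤ 2 ^ (19 + 3 * q.l + 2 * q.a) := by
  have ha := q.one_le_a
  have hl : (1 : ℝ) ≤ 2 ^ q.l := one_le_pow₀ (by norm_num)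
  have e1 : (1 : ℝ) ≤ 262144 * 2 ^ q.l := by linarith
  have e2 := one_le_mul_of_one_le_of_one_le e1 hl
  have e3 := one_le_mul_of_one_le_of_one_le e2 hl
  have e4 := one_le_mul_of_one_le_of_one_le e3 ha
  have e5 := one_le_mul_of_one_le_of_one_le e4 ha
  calc _ ≤ _ := h.f.ge e5
    _ = _ := by rw [pow_add, pow_add, pow_mul', pow_mul']; norm_num; ring

theorem Setting.R_pos (h : Setting q n m ε γ) : 1 ≤ q.R := by
  by_contra hR
  have h0 : q.R = 0 := by omega
  have h1 := h.R_ge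
  rw [h0, pow_zero, div_le_iff₀ h.γ_pos] at h1
  have h2 : 1 ≤ (n : ℝ) * (n * m * 2 ^ q.a) := one_le_mul_of_one_le_of_one_le h.n_ge h.one_le_nma
  nlinarith [h.γ_lt]

end Bounds

/-! ### The event that the samples are representative -/

variable {q : Params} {n m : ℕ} {ε γ : ℝ} {p : Fin n → ℝ}

/-- The samples are representative: more than half of the collision sums are close to their mean,
every set of jobs that is an interval of processing times is hit by about as many samples as
expected, and every job that is likely enough is hit. -/
structure Good (q : Params) {n : ℕ} (m : ℕ) (p : Fin n → ℝ) (w : ℕ → Fin n) : Prop where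
  median : q.R < 2 * #{g ∈ range q.R | |collisions p (fun b => w (g * q.B + b)) q.B -
    q.B * (q.B - 1) / 2 / ∑ j, p j| ≤ 1 / (64 * m * 2 ^ q.a) * (q.B * (q.B - 1) / 2 / ∑ j, p j)}
  interval : ∀ a b, (∑ j with p a ≤ p j ∧ p j ≤ p b, p j / ∑ j, p j) * q.K ≤
    (1 + 1 / (128 * 2 ^ q.a)) * #{i ∈ range q.K | p a ≤ p (w i) ∧ p (w i) ≤ p b} +
      (1 + 1 / (128 * 2 ^ q.a)) / (1 / (128 * 2 ^ q.a)) * q.R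
  single : ∀ j, p j / (∑ j, p j) * q.K ≤ 2 * #{i ∈ range q.K | w i = j} + 2 * q.R

/-- An outcome of the sampling, continued to an infinite sequence. -/
def extend {K : ℕ} (hn : 1 ≤ n) (ω : Fin K → Fin n) (i : ℕ) : Fin n :=
  if h : i < K then ω ⟨i, h⟩ else ⟨0, hn⟩

theorem extend_apply {K : ℕ} (hn : 1 ≤ n) (ω : Fin K → Fin n) (i : Fin K) :
    extend hn ω i = ω i := by simp [extend]

theorem card_extend {K : ℕ} (hn : 1 ≤ n) (ω : Fin K → Fin n) (P : Fin n → Prop)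
    [DecidablePred P] : #{i ∈ range K | P (extend hn ω i)} = #{i | P (ω i)} := by
  symm
  refine card_bij (fun a _ => (a : ℕ)) ?_ (fun a _ a' _ h => Fin.ext h) ?_
  · intro a ha
    simp only [mem_filter, mem_univ, true_and] at ha
    simp [extend_apply, ha]
  · intro x hx
    simp only [mem_filter, mem_range] at hx
    exact ⟨⟨x, hx.1⟩, mem_filter.2 ⟨mem_univ _, by
      have := hx.2; rwa [← extend_apply hn ω ⟨x, hx.1⟩]⟩, rfl⟩

/-- The collision sum of a group of samples is close to its mean with constant probability. -/
theorem eventProb_group_le (h : Setting q n m ε γ) (hp : ∀ j, 0 < p j) :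
    eventProb (fun j => p j / ∑ j, p j) {ω : Fin q.B → Fin n |
      1 / (64 * m * 2 ^ q.a) * (q.B * (q.B - 1) / 2 / ∑ j, p j) <
        |∑ e ∈ samplePairs q.B, pairTerm p e ω|} ≤ 1 / 16 := by
  have ha := q.one_le_a
  have hm := h.m_ge
  have hn := h.n_ge
  have hs := h.one_le_sqrt
  have hss : √(n : ℝ) * √n = n := Real.mul_self_sqrt (Nat.cast_nonneg n)
  -- `B` is much larger than `m / ε * √n`
  have hB : 1024 * (m * 2 ^ q.a * √n) ≤ (q.B : ℝ) := by
    refine le_trans ?_ h.B_ge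
    have hT := q.T_ge
    have e1 : (1 : ℝ) ≤ 2 ^ q.a * 2 ^ q.a := one_le_mul_of_one_le_of_one_le ha ha
    have e2 : (1 : ℝ) ≤ 2 ^ q.a * 2 ^ q.a * q.T := one_le_mul_of_one_le_of_one_le e1 (by linarith)
    have e3 : 0 ≤ m * 2 ^ q.a * √(n : ℝ) := by positivity
    calc _ ≤ 1048576 * (m * 2 ^ q.a * √n) * 1 := by linarith
      _ ≤ 1048576 * (m * 2 ^ q.a * √n) * (2 ^ q.a * 2 ^ q.a * q.T) := by gcongr
      _ = _ := by ring
  have e4 : (1 : ℝ) ≤ m * 2 ^ q.a * √n :=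
    one_le_mul_of_one_le_of_one_le (one_le_mul_of_one_le_of_one_le hm ha) hs
  have hB2 : (2 : ℝ) ≤ q.B := by linarith
  refine (eventProb_collisions_le hp h.hn (by exact_mod_cast hB2) (by positivity)).trans ?_
  have e5 : (q.B : ℝ) ^ 2 / 4 ≤ q.B * (q.B - 1) / 2 := by nlinarith
  have e6 : (1024 * (m * 2 ^ q.a * √n)) ^ 2 ≤ (q.B : ℝ) ^ 2 := by gcongr
  have e7 : (m * 2 ^ q.a * √(n : ℝ)) ^ 2 = (m * 2 ^ q.a) ^ 2 * n := by
    rw [mul_pow, sq (√(n : ℝ)), hss]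
  rw [mul_pow, e7] at e6
  have e8 : 0 < (q.B : ℝ) ^ 2 / 4 := by positivity
  have e9 : (0 : ℝ) < m * 2 ^ q.a := by positivity
  have e10 : 0 < (q.B : ℝ) * (q.B - 1) / 2 := e8.trans_le e5
  rw [div_le_iff₀ (mul_pos (by positivity) e10)]
  calc (n : ℝ)
      = 1 / 16 * ((1 / (64 * m * 2 ^ q.a)) ^ 2 * (16 * 4096 * ((m * 2 ^ q.a) ^ 2 * n))) := by
        field_simp; ring
    _ ≤ 1 / 16 * ((1 / (64 * m * 2 ^ q.a)) ^ 2 * (q.B * (q.B - 1) / 2)) := by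
        gcongr; nlinarith

theorem exp_neg_le_half_pow (R : ℕ) : Real.exp (-R) ≤ (1 / 2) ^ R := by
  have h1 : Real.exp (-1) ≤ 1 / 2 := by
    rw [Real.exp_neg, one_div]
    exact inv_anti₀ (by norm_num) (by linarith [Real.add_one_le_exp 1])
  calc Real.exp (-R) = Real.exp (-1) ^ R := by rw [← Real.exp_nat_mul]; congr 1; ring
    _ ≤ _ := by gcongr

/-- The number of groups of samples whose collision sum is close to its mean. -/
theorem card_good_groups {R B : ℕ} (hn : 1 ≤ n) (ω : Fin (R * B) → Fin n) (d : ℝ)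
    (E : Set (Fin B → Fin n)) [DecidablePred (· ∈ E)]
    (hE : ∀ ρ, ρ ∈ E ↔ d < |∑ e ∈ samplePairs B, pairTerm p e ρ|) :
    #{g ∈ range R | |collisions p (fun b => extend hn ω (g * B + b)) B -
      B * (B - 1) / 2 / ∑ j, p j| ≤ d} =
    #{g : Fin R | ¬ (fun b : Fin B => ω (finProdFinEquiv (g, b))) ∈ E} := by
  symm
  have hg : ∀ g : Fin R, (fun b : Fin B => ω (finProdFinEquiv (g, b))) ∈ E ↔
      ¬ |collisions p (fun b => extend hn ω (g * B + b)) B -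
        B * (B - 1) / 2 / ∑ j, p j| ≤ d := fun g => by
    rw [hE, collisions_eq (ω := fun b : Fin B => ω (finProdFinEquiv (g, b))), not_le]
    intro b
    rw [← extend_apply hn ω (finProdFinEquiv (g, b))]
    congr 1
    rw [finProdFinEquiv_apply_val]; ring
  refine card_bij (fun a _ => (a : ℕ)) ?_ (fun a _ a' _ h => Fin.ext h) ?_
  · intro g hg'
    simp only [mem_filter, mem_univ, true_and, hg, not_not] at hg'
    exact mem_filter.2 ⟨mem_range.2 g.2, hg'⟩
  · intro g hg'
    obtain ⟨hg1, hg2⟩ := mem_filter.1 hg'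
    refine ⟨⟨g, mem_range.1 hg1⟩, mem_filter.2 ⟨mem_univ _, ?_⟩, rfl⟩
    rw [hg, not_not]; exact hg2

/-- The union bound over the median, the intervals between two jobs, and the single jobs. -/
theorem failure_bound (h : Setting q n m ε γ) :
    (1 / 2 : ℝ) ^ q.R + n * n * (1 / 2) ^ q.R + n * (1 / 2) ^ q.R ≤ γ := by
  have c1 := h.R_ge
  have c2 : (0 : ℝ) < 2 ^ q.R := by positivity
  have c3 := h.n_ge
  rw [div_le_iff₀ h.γ_pos] at c1
  rw [one_div, inv_pow, ← one_div, mul_one_div, mul_one_div, ← add_div, ← add_div,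
    div_le_iff₀ c2]
  have c4 : (1 : ℝ) ≤ m * 2 ^ q.a := one_le_mul_of_one_le_of_one_le h.m_ge q.one_le_a
  have c5 : (n : ℝ) * n ≤ n * n * (m * 2 ^ q.a) := le_mul_of_one_le_right (by positivity) c4
  nlinarith

/-- The numbers `R` and `B` are generalized, as the type of the samples depends on them. -/
theorem eventProb_not_good (h : Setting q n m ε γ) (hp : ∀ j, 0 < p j) {R B : ℕ} (hR : R = q.R)
    (hB : B = q.B) (hK : q.K = R * B) :
    eventProb (fun j => p j / ∑ j, p j)
      ({ω : Fin (R * B) → Fin n | Good q m p (extend h.hn ω)}ᶜ) ≤ γ := by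
  have hn := h.hn
  have hW : 0 < ∑ j, p j := sum_pos (fun j _ => hp j) ⟨⟨0, hn⟩, mem_univ _⟩
  have hq : ∀ j, 0 ≤ p j / ∑ j, p j := fun j => (div_pos (hp j) hW).le
  have hq1 : ∑ a, p a / (∑ j, p j) = 1 := by rw [← sum_div, div_self hW.ne']
  have hl0 : (0 : ℝ) < 1 / (128 * 2 ^ q.a) := by positivity
  obtain ⟨E, hE⟩ : ∃ E : Set (Fin B → Fin n), ∀ ρ, ρ ∈ E ↔ 1 / (64 * m * 2 ^ q.a) *
    (B * (B - 1) / 2 / ∑ j, p j) < |∑ e ∈ samplePairs B, pairTerm p e ρ| :=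
    ⟨{ρ | _}, fun ρ => Iff.rfl⟩
  have hdec : DecidablePred (· ∈ E) := Classical.decPred _
  have b0 : eventProb (fun j => p j / ∑ j, p j) E ≤ 1 / 16 := by
    subst hB
    refine (eventProb_mono hq fun ρ hρ => ?_).trans (eventProb_group_le h hp)
    exact (hE ρ).1 hρ
  -- the events that the median is wrong, that an interval of processing times is hit too rarely,
  -- and that a single job is hit too rarely
  obtain ⟨E₁, hE₁, b1⟩ : ∃ E₁ : Set (Fin (R * B) → Fin n), (∀ ω, ω ∉ E₁ →
      ¬ R ≤ 2 * #{g : Fin R | (fun b : Fin B => ω (finProdFinEquiv (g, b))) ∈ E}) ∧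
      eventProb (fun j => p j / ∑ j, p j) E₁ ≤ (1 / 2) ^ R :=
    ⟨_, fun ω h => h, eventProb_half_le (E := E) hq hq1 b0⟩
  obtain ⟨E₂, hE₂, b2⟩ : ∃ E₂ : Fin n × Fin n → Set (Fin (R * B) → Fin n),
      (∀ ab, ∀ ω, ω ∉ E₂ ab → ¬ (1 + 1 / (128 * 2 ^ q.a)) *
          #{i | ω i ∈ univ.filter fun j => p ab.1 ≤ p j ∧ p j ≤ p ab.2} +
        (1 + 1 / (128 * 2 ^ q.a)) / (1 / (128 * 2 ^ q.a)) * R <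
        (∑ j with p ab.1 ≤ p j ∧ p j ≤ p ab.2, p j / ∑ j, p j) * Fintype.card (Fin (R * B))) ∧
      ∀ ab, eventProb (fun j => p j / ∑ j, p j) (E₂ ab) ≤ (1 / 2) ^ R :=
    ⟨fun ab => _, fun ab ω h => h, fun ab =>
      (eventProb_few_hits_le hq hq1 _ hl0).trans (exp_neg_le_half_pow _)⟩
  obtain ⟨E₃, hE₃, b3⟩ : ∃ E₃ : Fin n → Set (Fin (R * B) → Fin n),
      (∀ j, ∀ ω, ω ∉ E₃ j → ¬ (1 + 1) * #{i | ω i ∈ ({j} : Finset (Fin n))} + (1 + 1) / 1 * R <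
        (∑ j ∈ {j}, p j / ∑ j, p j) * Fintype.card (Fin (R * B))) ∧
      ∀ j, eventProb (fun j => p j / ∑ j, p j) (E₃ j) ≤ (1 / 2) ^ R :=
    ⟨fun j => _, fun j ω h => h, fun j =>
      (eventProb_few_hits_le hq hq1 _ one_pos).trans (exp_neg_le_half_pow _)⟩
  have hbad : {ω : Fin (R * B) → Fin n | Good q m p (extend hn ω)}ᶜ ⊆
      (E₁ ∪ ⋃ ab, E₂ ab) ∪ ⋃ j, E₃ j := by
    intro ω hω
    by_contra hcon
    simp only [Set.mem_union, Set.mem_iUnion, not_or, not_exists] at hcon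
    obtain ⟨⟨h1, h2⟩, h3⟩ := hcon
    refine hω (show Good q m p (extend hn ω) from ⟨?_, fun a b => ?_, fun j => ?_⟩)
    · rw [← hR, ← hB, card_good_groups hn ω _ E hE]
      have h4 := card_filter_add_card_filter_not (s := (univ : Finset (Fin R)))
        (fun g => (fun b : Fin B => ω (finProdFinEquiv (g, b))) ∈ E)
      rw [card_univ, Fintype.card_fin] at h4
      have h5 := hE₁ ω h1
      omega
    · have h4 := hE₂ (a, b) ω (h2 (a, b))
      simp only [not_lt, mem_filter, mem_univ, true_and, Fintype.card_fin] at h4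
      rw [hK, card_extend hn ω fun j => p a ≤ p j ∧ p j ≤ p b, ← hR]
      exact h4
    · have h4 := hE₃ j ω (h3 j)
      simp only [not_lt, mem_singleton, sum_singleton, Fintype.card_fin] at h4
      rw [hK, card_extend hn ω fun i => i = j, ← hR]
      linarith
  refine le_trans ?_ (hR ▸ failure_bound h)
  refine (eventProb_mono hq hbad).trans ((eventProb_union_le hq _ _).trans
    (add_le_add ((eventProb_union_le hq _ _).trans (add_le_add b1 ?_)) ?_))
  · refine (eventProb_iUnion_le hq _).trans ((sum_le_sum fun ab _ => b2 ab).trans ?_)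
    simp
  · refine (eventProb_iUnion_le hq _).trans ((sum_le_sum fun ab _ => b3 ab).trans ?_)
    simp

/-- With probability at least `1 - γ` the samples are representative. -/
theorem sampleProb_good (h : Setting q n m ε γ) (hp : ∀ j, 0 < p j) :
    1 - γ ≤ sampleProb p q.K {ω | Good q m p (extend h.hn ω)} := by
  have hW : 0 < ∑ j, p j := sum_pos (fun j _ => hp j) ⟨⟨0, h.hn⟩, mem_univ _⟩
  have b := eventProb_not_good h hp rfl rfl rfl
  rw [eventProb_compl (by rw [← sum_div, div_self hW.ne'])] at b
  have e : sampleProb p q.K {ω | Good q m p (extend h.hn ω)} =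
    eventProb (fun j => p j / ∑ j, p j)
      {ω : Fin (q.R * q.B) → Fin n | Good q m p (extend h.hn ω)} := rfl
  rw [e]
  linarith

end Makespan

namespace Makespan

open Finset

/-! ### The minimum makespan -/

section Opt

variable {n m : ℕ} {p : Fin n → ℝ}

theorem load_le_makespan (σ : Fin n → Fin m) (i : Fin m) : load p σ i ≤ makespan p σ :=
  le_ciSup (f := fun i => load p σ i) (Set.finite_range _).bddAbove i

theorem makespan_le (hm : 1 ≤ m) {σ : Fin n → Fin m} {Y : ℝ} (h : ∀ i, load p σ i ≤ Y) :
    makespan p σ ≤ Y :=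
  haveI : Nonempty (Fin m) := ⟨⟨0, hm⟩⟩
  ciSup_le h

theorem opt_le (σ : Fin n → Fin m) : opt m p ≤ makespan p σ :=
  ciInf_le (Set.finite_range _).bddBelow σ

theorem exists_opt (hm : 1 ≤ m) (p : Fin n → ℝ) : ∃ σ : Fin n → Fin m, makespan p σ = opt m p :=
  haveI : Nonempty (Fin n → Fin m) := ⟨fun _ => ⟨0, hm⟩⟩
  exists_eq_ciInf_of_finite

theorem sum_load (σ : Fin n → Fin m) : ∑ i, load p σ i = ∑ j, p j :=
  sum_fiberwise univ σ p

theorem sum_le_mul_opt (hm : 1 ≤ m) (p : Fin n → ℝ) : ∑ j, p j ≤ m * opt m p := by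
  obtain ⟨σ, hσ⟩ := exists_opt hm p
  rw [← sum_load σ, ← hσ]
  calc _ ≤ ∑ i : Fin m, makespan p σ := sum_le_sum fun i _ => load_le_makespan σ i
    _ = _ := by simp

theorem opt_le_sum (hm : 1 ≤ m) (hp : ∀ j, 0 < p j) : opt m p ≤ ∑ j, p j := by
  refine (opt_le fun _ => ⟨0, hm⟩).trans (makespan_le hm fun i => ?_)
  exact sum_le_sum_of_subset_of_nonneg (filter_subset _ _) fun j _ _ => (hp j).le

theorem opt_comp_le (hm : 1 ≤ m) (hp : ∀ j, 0 < p j) {N : ℕ} {g : Fin N → Fin n}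
    (hg : Function.Injective g) : opt m (fun x => p (g x)) ≤ opt m p := by
  obtain ⟨σ, hσ⟩ := exists_opt hm p
  rw [← hσ]
  refine (opt_le fun x => σ (g x)).trans (makespan_le hm fun i =>
    le_trans ?_ (load_le_makespan σ i))
  unfold load
  rw [← sum_image (f := p) (g := g) hg.injOn]
  refine sum_le_sum_of_subset_of_nonneg ?_ fun j _ _ => (hp j).le
  intro j hj
  obtain ⟨x, hx, rfl⟩ := mem_image.1 hj
  simpa using hx

/-- List scheduling: if a partial schedule has loads at most `X`, and the other jobs are at most
`θ`, where `X` is at least the average load plus `(1 - 1 / m) * θ`, then there is a schedule of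
makespan at most `X`. -/
theorem opt_le_of_partLoad_le (hm : 1 ≤ m) (hp : ∀ j, 0 < p j) {X θ : ℝ}
    (hX : (∑ j, p j) / m + (1 - 1 / m) * θ ≤ X) (d : ℕ) :
    ∀ (f : ℕ → Fin n) (μ : ℕ → ℕ) (N : ℕ), n - N = d → Set.InjOn f (Set.Iio N) →
      (∀ x < N, μ x < m) → (∀ j, (¬ ∃ x < N, f x = j) → p j ≤ θ) →
      (∀ i < m, partLoad p f μ N i ≤ X) → opt m p ≤ X := by
  induction d with
  | zero =>
    intro f μ N hd hf hμ hj hl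
    have hinj : Function.Injective fun x : Fin N => f x := fun x y h => Fin.ext (hf x.2 y.2 h)
    have hN : N = n := le_antisymm (by simpa using Fintype.card_le_of_injective _ hinj) (by omega)
    subst hN
    obtain ⟨e, he⟩ : ∃ e : Fin N ≃ Fin N, ∀ x, e x = f x :=
      ⟨Equiv.ofBijective _ (Finite.injective_iff_bijective.1 hinj), fun x => rfl⟩
    refine (opt_le fun j => ⟨μ (e.symm j), hμ _ (e.symm j).2⟩).trans (makespan_le hm fun i => ?_)
    refine le_trans (le_of_eq ?_) (hl i i.2)
    rw [load, partLoad, sum_filter, sum_filter, ← Fin.sum_univ_eq_sum_range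
      (fun x => if μ x = i then p (f x) else 0), ← e.sum_comp]
    refine sum_congr rfl fun x _ => ?_
    simp only [← he, Equiv.symm_apply_apply, Fin.ext_iff]
  | succ d ih =>
    intro f μ N hd hf hμ hj hl
    obtain ⟨j, hjn⟩ : ∃ j, ¬ ∃ x < N, f x = j := by
      by_contra! hcon
      have hsurj : Function.Surjective fun x : Fin N => f x := fun j => by
        obtain ⟨x, hx, h⟩ := hcon j
        exact ⟨⟨x, hx⟩, h⟩
      have := Fintype.card_le_of_surjective _ hsurj
      simp at this
      omega
    obtain ⟨a, ha, ha'⟩ := exists_min_image (range m) (partLoad p f μ N) ⟨0, mem_range.2 hm⟩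
    have hload := argmin_load_le hp hm hμ hf hjn (fun i hi => ha' i (mem_range.2 hi))
      (hj j hjn)
    refine ih (Function.update f N j) (Function.update μ N a) (N + 1) (by omega) ?_ ?_ ?_ ?_
    · intro x hx y hy hxy
      have hx : x < N + 1 := hx
      have hy : y < N + 1 := hy
      rcases (Nat.lt_succ_iff_lt_or_eq.1 hx) with hx | rfl <;>
        rcases (Nat.lt_succ_iff_lt_or_eq.1 hy) with hy | rfl
      · rw [Function.update_of_ne hx.ne, Function.update_of_ne hy.ne] at hxy
        exact hf hx hy hxy
      · rw [Function.update_of_ne hx.ne, Function.update_self] at hxy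
        exact absurd ⟨x, hx, hxy⟩ hjn
      · rw [Function.update_of_ne hy.ne, Function.update_self] at hxy
        exact absurd ⟨y, hy, hxy.symm⟩ hjn
      · rfl
    · intro x hx
      rcases (Nat.lt_succ_iff_lt_or_eq.1 hx) with hx | rfl
      · rw [Function.update_of_ne hx.ne]; exact hμ x hx
      · rw [Function.update_self]; exact mem_range.1 ha
    · intro j' hj'
      refine hj j' fun ⟨x, hx, h⟩ => hj' ⟨x, by omega, ?_⟩
      rw [Function.update_of_ne hx.ne, h]
    · intro i hi
      rw [partLoad_snoc]
      split_ifs with h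
      · subst h; exact hload.trans hX
      · simpa using hl i hi

end Opt

/-! ### Schedules generated from a sketch schedule with enough slots -/

section Sketch

variable {n m : ℕ} {p : Fin n → ℝ} {S : SketchSchedule m}

theorem SketchSchedule.procTime_antitone (hδ : 0 < S.delta) (hδ1 : S.delta < 1) (hT : 0 ≤ S.top) :
    Antitone S.procTime := fun k l hkl =>
  mul_le_mul_of_nonneg_left (pow_le_pow_of_le_one (by linarith) (by linarith) hkl) hT

theorem SketchSchedule.jobClass_unique (hδ : 0 < S.delta) (hδ1 : S.delta < 1) (hT : 0 ≤ S.top)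
    {j : Fin n} {k l : ℕ} (hk : j ∈ S.jobClass p k) (hl : j ∈ S.jobClass p l) : k = l := by
  classical
  simp only [SketchSchedule.jobClass, mem_filter, Set.mem_Ioc] at hk hl
  have ha := SketchSchedule.procTime_antitone hδ hδ1 hT
  rcases lt_trichotomy k l with h | h | h
  · have := ha (Nat.succ_le_of_lt h)
    simp only [Nat.succ_eq_add_one] at this
    linarith [hk.2.1, hl.2.2]
  · exact h
  · have := ha (Nat.succ_le_of_lt h)
    simp only [Nat.succ_eq_add_one] at this
    linarith [hl.2.1, hk.2.2]

theorem SketchSchedule.exists_jobClass (hc : S.Covers p) (j : Fin n) :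
    (∃ k : Fin S.t, j ∈ S.jobClass p k) ∨ p j ≤ S.procTime S.t := by
  classical
  by_cases h : p j ≤ S.procTime S.t
  · exact Or.inr h
  · left
    have hex : ∃ k, ¬ p j ≤ S.procTime k := ⟨_, h⟩
    have h0 : Nat.find hex ≠ 0 := fun h0 => by
      have := Nat.find_spec hex
      rw [h0] at this
      exact this (by simpa [SketchSchedule.procTime] using hc.2.2 j)
    obtain ⟨k, hk⟩ := Nat.exists_eq_succ_of_ne_zero h0
    have hle : Nat.find hex ≤ S.t := Nat.find_min' hex h
    refine ⟨⟨k, by omega⟩, ?_⟩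
    simp only [SketchSchedule.jobClass, mem_filter, mem_univ, true_and, Set.mem_Ioc]
    have h1 := Nat.find_spec hex
    rw [hk] at h1
    exact ⟨not_le.1 h1, not_not.1 (Nat.find_min hex (m := k) (by omega))⟩

/-- If there are enough slots for all jobs, then there is a generated schedule. -/
theorem SketchSchedule.exists_generates (hm : 1 ≤ m) (hc : S.Covers p) (hT : 0 ≤ S.top)
    (h : ∀ k : Fin S.t, #(S.jobClass p k) ≤ S.total k) : ∃ σ, S.Generates p σ := by
  classical
  have hg : ∀ k : Fin S.t, ∃ g : Fin n → Fin m,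
      ∀ i, #{j ∈ S.jobClass p k | g j = i} ≤ S.count i k := fun k => by
    have hcard : Fintype.card (S.jobClass p k) ≤
        Fintype.card ((i : Fin m) × Fin (S.count i k)) := by
      simpa [SketchSchedule.total] using h k
    obtain ⟨e⟩ := Function.Embedding.nonempty_of_card_le hcard
    refine ⟨fun j => if hj : j ∈ S.jobClass p k then (e ⟨j, hj⟩).1 else ⟨0, hm⟩, fun i => ?_⟩
    have : Fintype.card {j // j ∈ ({j ∈ S.jobClass p k | (if hj : j ∈ S.jobClass p k then
        (e ⟨j, hj⟩).1 else ⟨0, hm⟩) = i} : Finset (Fin n))} ≤ Fintype.card (Fin (S.count i k)) := by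
      have hmem : ∀ j : {j // j ∈ ({j ∈ S.jobClass p k | (if hj : j ∈ S.jobClass p k then
        (e ⟨j, hj⟩).1 else ⟨0, hm⟩) = i} : Finset (Fin n))}, ∃ hj : j.1 ∈ S.jobClass p k,
          (e ⟨j.1, hj⟩).1 = i := fun j => by
        obtain ⟨h1, h2⟩ := mem_filter.1 j.2
        rw [dif_pos h1] at h2
        exact ⟨h1, h2⟩
      choose u hu using hmem
      refine Fintype.card_le_of_injective
        (fun j => (Fin.cast (by rw [hu j]) (e ⟨j.1, u j⟩).2 : Fin (S.count i k))) fun a b hab => ?_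
      have h3 : e ⟨a.1, u a⟩ = e ⟨b.1, u b⟩ := by
        refine Sigma.ext ((hu a).trans (hu b).symm) ?_
        have h4 : ((e ⟨a.1, u a⟩).2 : ℕ) = (e ⟨b.1, u b⟩).2 := congrArg Fin.val hab
        refine (Fin.heq_ext_iff ?_).2 h4
        rw [hu a, hu b]
      exact Subtype.ext (congrArg (fun z => z.1) (e.injective h3))
    rwa [Fintype.card_coe, Fintype.card_fin] at this
  choose g hg using hg
  have hcl : ∀ j, ∃ i : Fin m, ∀ k : Fin S.t, j ∈ S.jobClass p k → i = g k j := fun j => by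
    by_cases hj : ∃ k : Fin S.t, j ∈ S.jobClass p k
    · obtain ⟨k, hk⟩ := hj
      refine ⟨g k j, fun k' hk' => ?_⟩
      rw [Fin.ext (SketchSchedule.jobClass_unique hc.1 hc.2.1 hT hk hk')]
    · exact ⟨⟨0, hm⟩, fun k hk => absurd ⟨k, hk⟩ hj⟩
  choose σ hσ using hcl
  refine ⟨σ, fun k _ => ⟨fun _ i => ?_, fun hlt => absurd (h k) (not_le.2 hlt)⟩⟩
  refine le_trans (le_of_eq ?_) (hg k i)
  congr 1
  exact filter_congr fun j hj => by rw [hσ j k hj]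

/-- If there are enough slots for all jobs, then the load of a machine in a generated schedule is
bounded by the rounded processing times of its slots and of the jobs outside of all classes. -/
theorem SketchSchedule.load_le_of_generates (hc : S.Covers p) (hT : 0 ≤ S.top)
    (h : ∀ k : Fin S.t, #(S.jobClass p k) ≤ S.total k) {σ : Fin n → Fin m} (hσ : S.Generates p σ)
    (i : Fin m) :
    load p σ i ≤ ∑ k : Fin S.t, S.count i k * S.procTime k + n * S.procTime S.t := by
  classical
  have hpos : ∀ k, 0 ≤ S.procTime k := fun k =>
    mul_nonneg hT (pow_nonneg (by linarith [hc.2.1]) k)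
  have h1 : ∀ j, p j ≤ ∑ k : Fin S.t, (if j ∈ S.jobClass p k then S.procTime k else 0) +
      S.procTime S.t := fun j => by
    rcases SketchSchedule.exists_jobClass hc j with ⟨k, hk⟩ | hj
    · have h2 : p j ≤ S.procTime k := by
        simp only [SketchSchedule.jobClass, mem_filter, Set.mem_Ioc] at hk
        exact hk.2.2
      have h3 := single_le_sum (f := fun k : Fin S.t => if j ∈ S.jobClass p k then S.procTime k
        else 0) (fun k _ => by split_ifs; exacts [hpos _, le_rfl]) (mem_univ k)
      simp only [hk, if_true] at h3
      linarith [hpos S.t]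
    · have : 0 ≤ ∑ k : Fin S.t, (if j ∈ S.jobClass p k then S.procTime k else 0) :=
        sum_nonneg fun k _ => by split_ifs; exacts [hpos _, le_rfl]
      linarith
  refine (sum_le_sum fun j _ => h1 j).trans ?_
  rw [sum_add_distrib, sum_comm]
  refine add_le_add (sum_le_sum fun k _ => ?_) ?_
  · rw [← sum_filter, sum_const, nsmul_eq_mul]
    refine mul_le_mul_of_nonneg_right ?_ (hpos _)
    have h2 : (univ.filter fun j => σ j = i).filter (fun j => j ∈ S.jobClass p k) =
        {j ∈ S.jobClass p k | σ j = i} := by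
      ext j; simp [and_comm]
    rw [h2]
    rcases Nat.eq_zero_or_pos (S.total k) with h0 | h0
    · have := h k
      rw [h0, Nat.le_zero, card_eq_zero] at this
      simp [this]
    · exact_mod_cast (hσ k h0).1 (h k) i
  · rw [sum_const, nsmul_eq_mul]
    refine mul_le_mul_of_nonneg_right ?_ (hpos _)
    exact_mod_cast (card_le_univ _).trans (by simp)

end Sketch

end Makespan

namespace Makespan

open Finset

/-! ### Representative samples lead to a good sketch schedule -/

section Rounding

variable {q : Params} {n m : ℕ} {ε γ : ℝ}

theorem Params.D_pos (q : Params) : (16 : ℝ) * 2 ^ q.a = q.D := by simp [Params.D]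

theorem Params.δ_pos (q : Params) : 0 < q.δ := by
  have : (0 : ℝ) < q.D := by rw [← q.D_pos]; positivity
  unfold Params.δ; positivity

theorem Params.δ_le (q : Params) : q.δ ≤ 1 / 16 := by
  unfold Params.δ
  rw [← q.D_pos]
  exact one_div_le_one_div_of_le (by norm_num) (by linarith [q.one_le_a])

theorem Params.pow_D_le (q : Params) : (1 - q.δ) ^ q.D ≤ 1 / 2 := by
  have hD : (0 : ℝ) < q.D := by rw [← q.D_pos]; positivity
  have h1 : 1 - q.δ ≤ Real.exp (-q.δ) := by linarith [Real.add_one_le_exp (-q.δ)]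
  have h2 : Real.exp (-1) ≤ 1 / 2 := by
    rw [Real.exp_neg, one_div]
    exact inv_anti₀ (by norm_num) (by linarith [Real.add_one_le_exp 1])
  calc (1 - q.δ) ^ q.D ≤ Real.exp (-q.δ) ^ q.D :=
        pow_le_pow_left₀ (by linarith [q.δ_le]) h1 _
    _ = Real.exp (-1) := by
        rw [← Real.exp_nat_mul]; congr 1; unfold Params.δ; field_simp
    _ ≤ _ := h2

theorem Params.le_pow_D (q : Params) : 1 / 4 ≤ (1 - q.δ) ^ q.D := by
  have h1 : q.D = 8 * 2 ^ q.a * 2 := by unfold Params.D; ring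
  have h2 : (1 : ℝ) / 2 ≤ (1 - q.δ) ^ (8 * 2 ^ q.a) := by
    have := one_add_mul_le_pow (a := -q.δ) (by linarith [q.δ_le]) (8 * 2 ^ q.a)
    have e : ((8 * 2 ^ q.a : ℕ) : ℝ) * -q.δ = -(1 / 2) := by
      unfold Params.δ; rw [← q.D_pos]; push_cast; field_simp; norm_num
    rw [e] at this
    rw [sub_eq_add_neg]
    linarith
  rw [h1, pow_mul]
  nlinarith

theorem Params.pow_mul_D_le (q : Params) (k : ℕ) : (1 - q.δ) ^ (k * q.D) ≤ 1 / 2 ^ k := by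
  rw [mul_comm, pow_mul, ← one_div_pow]
  exact pow_le_pow_left₀ (pow_nonneg (by linarith [q.δ_le]) _) q.pow_D_le _

theorem Params.le_pow_mul_D (q : Params) (k : ℕ) : 1 / 4 ^ k ≤ (1 - q.δ) ^ (k * q.D) := by
  rw [mul_comm, pow_mul, ← one_div_pow]
  exact pow_le_pow_left₀ (by norm_num) q.le_pow_D _

theorem Params.pow_pos (q : Params) (k : ℕ) : 0 < (1 - q.δ) ^ k :=
  _root_.pow_pos (by linarith [q.δ_le]) k

/-- The classes are nested as the powers of `1 - δ`. -/
theorem Params.mul_pow_le (q : Params) {T : ℝ} (hT : 0 ≤ T) {k l : ℕ} (h : k ≤ l) :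
    T * (1 - q.δ) ^ l ≤ T * (1 - q.δ) ^ k :=
  mul_le_mul_of_nonneg_left
    (pow_le_pow_of_le_one (by linarith [q.δ_le]) (by linarith [q.δ_pos]) h) hT

theorem Params.classOf_eq_iff (q : Params) {T x : ℝ} (hx : x ≤ T) (hT : 0 ≤ T) {k : ℕ}
    (hk : k < q.t) : q.classOf T x = k ↔ T * (1 - q.δ) ^ (k + 1) < x ∧ x ≤ T * (1 - q.δ) ^ k := by
  -- the bounds above `x` form an initial segment
  have key : ∀ l, l < q.t → (x ≤ T * (1 - q.δ) ^ (l + 1) ↔ l < q.classOf T x) := fun l hl => by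
    constructor
    · intro h
      have : range (l + 1) ⊆ {k ∈ range q.t | x ≤ T * (1 - q.δ) ^ (k + 1)} := fun i hi => by
        rw [mem_range] at hi
        exact mem_filter.2 ⟨mem_range.2 (by omega), h.trans (q.mul_pow_le hT (by omega))⟩
      have := card_le_card this
      rw [card_range] at this
      exact this
    · intro h
      by_contra hcon
      have : {k ∈ range q.t | x ≤ T * (1 - q.δ) ^ (k + 1)} ⊆ range l := fun i hi => by
        obtain ⟨-, h2⟩ := mem_filter.1 hi
        rw [mem_range]
        by_contra hli
        exact hcon (h2.trans (q.mul_pow_le hT (by omega)))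
      have := card_le_card this
      rw [card_range] at this
      exact absurd h (not_lt.2 this)
  rw [← not_le, key k hk]
  rcases Nat.eq_zero_or_pos k with rfl | h0
  · simp [hx, Nat.pos_iff_ne_zero]
  · have h1 := key (k - 1) (by omega)
    rw [Nat.sub_add_cancel h0] at h1
    rw [h1]
    omega

end Rounding

section Deterministic

variable {q : Params} {n m : ℕ} {ε γ : ℝ} {p : Fin n → ℝ} {w : ℕ → Fin n}

theorem Setting.sum_pos (h : Setting q n m ε γ) (hp : ∀ j, 0 < p j) : 0 < ∑ j, p j :=
  Finset.sum_pos (fun j _ => hp j) ⟨⟨0, h.hn⟩, mem_univ _⟩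

/-- The number of samples in a group is large; the factor `ε * 2 ^ q.a` is at least `1`. -/
theorem Setting.mul_le_B (h : Setting q n m ε γ) :
    1048576 * 8 * (2 ^ q.a * 2 ^ q.a * m * (2 ^ q.a : ℝ)) ≤ q.B := by
  refine le_trans ?_ h.B_ge
  have h1 : (8 : ℝ) ≤ q.T * √n := by nlinarith [q.T_ge, h.one_le_sqrt]
  have h2 : (0 : ℝ) ≤ 1048576 * (2 ^ q.a * 2 ^ q.a * m * (2 ^ q.a : ℝ)) := by positivity
  calc _ = 1048576 * (2 ^ q.a * 2 ^ q.a * m * (2 ^ q.a : ℝ)) * 8 := by ring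
    _ ≤ 1048576 * (2 ^ q.a * 2 ^ q.a * m * (2 ^ q.a : ℝ)) * (q.T * √n) := by gcongr
    _ = _ := by ring

theorem Setting.two_le_B (h : Setting q n m ε γ) : (2 : ℝ) ≤ q.B := by
  refine le_trans ?_ h.mul_le_B
  have h1 := one_le_mul_of_one_le_of_one_le (one_le_mul_of_one_le_of_one_le
    (one_le_mul_of_one_le_of_one_le q.one_le_a q.one_le_a) h.m_ge) q.one_le_a
  linarith

/-- The median of the collision sums is close to their mean. -/
theorem Good.median_bounds (h : Setting q n m ε γ) (G : Good q m p w) {v : ℝ} (hp : ∀ j, 0 < p j)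
    (hv : IsUpperMedian q.R (fun g => collisions p (fun b => w (g * q.B + b)) q.B) v) :
    (1 - 1 / (64 * m * 2 ^ q.a)) * (q.B * (q.B - 1) / 2 / ∑ j, p j) ≤ v ∧
      v ≤ (1 + 1 / (64 * m * 2 ^ q.a)) * (q.B * (q.B - 1) / 2 / ∑ j, p j) := by
  have hB := h.two_le_B
  have hc : 0 < q.B * (q.B - 1) / 2 / ∑ j, p j :=
    div_pos (by nlinarith) (h.sum_pos hp)
  have hη : 1 / (64 * m * 2 ^ q.a) < (1 : ℝ) := by
    rw [div_lt_one (by have := h.m_ge; positivity)]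
    nlinarith [h.m_ge, q.one_le_a]
  have hm := G.median
  set c := q.B * (q.B - 1) / 2 / ∑ j, p j
  set η : ℝ := 1 / (64 * m * 2 ^ q.a)
  set e : ℕ → ℝ := fun g => collisions p (fun b => w (g * q.B + b)) q.B with he
  change q.R < 2 * #{g ∈ range q.R | |e g - c| ≤ η * c} at hm
  have hlow : (1 - η) * c ≤ v := by
    obtain ⟨a, ha, ha'⟩ := exists_min_image {g ∈ range q.R | |e g - c| ≤ η * c} e
      (card_pos.1 (by omega))
    obtain ⟨h1, h2⟩ := mem_filter.1 ha
    have h3 := hv.2 a (mem_range.1 h1) (hm.trans_le (Nat.mul_le_mul_left 2 (card_le_card fun b hb =>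
      mem_filter.2 ⟨(mem_filter.1 hb).1, ha' b hb⟩)))
    linarith [abs_le.1 h2]
  refine ⟨hlow, ?_⟩
  have hv0 : 0 < v := lt_of_lt_of_le (mul_pos (by linarith) hc) hlow
  rcases hv.1 with h0 | ⟨a, ha, hva, hr⟩
  · exact absurd h0 hv0.ne'
  · rw [hva]
    change q.R < 2 * #{b ∈ range q.R | e a ≤ e b} at hr
    by_contra! hcon
    have hd : Disjoint {g ∈ range q.R | |e g - c| ≤ η * c} {b ∈ range q.R | e a ≤ e b} := by
      rw [disjoint_left]
      intro b hb hb'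
      have := (abs_le.1 (mem_filter.1 hb).2).2
      have := (mem_filter.1 hb').2
      linarith
    have h1 := card_le_card (union_subset (filter_subset (fun g => |e g - c| ≤ η * c) (range q.R))
      (filter_subset (fun b => e a ≤ e b) (range q.R)))
    rw [card_union_of_disjoint hd, card_range] at h1
    omega

/-- The estimate of the total processing time is an upper bound, and almost tight. -/
theorem Good.totalEst_bounds (h : Setting q n m ε γ) (G : Good q m p w) {v : ℝ}
    (hp : ∀ j, 0 < p j)
    (hv : IsUpperMedian q.R (fun g => collisions p (fun b => w (g * q.B + b)) q.B) v) :
    ∑ j, p j ≤ q.totalEst m v ∧ q.totalEst m v ≤ (1 + ε / (16 * m)) * ∑ j, p j := by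
  obtain ⟨h1, h2⟩ := G.median_bounds h hp hv
  have hB := h.two_le_B
  have hW := h.sum_pos hp
  have hP : (0 : ℝ) < q.B * (q.B - 1) / 2 := by nlinarith
  have hm := h.m_ge
  have ha := q.one_le_a
  have hη : 1 / (64 * m * 2 ^ q.a) ≤ (1 : ℝ) / 2 := by
    refine one_div_le_one_div_of_le (by norm_num) ?_
    nlinarith
  have hη4 : 4 * (1 / (64 * m * 2 ^ q.a)) ≤ ε / (16 * m) := by
    have := h.one_le_mul_a
    rw [mul_one_div, div_le_div_iff₀ (by positivity) (by positivity)]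
    nlinarith
  have hη0 : (0 : ℝ) < 1 / (64 * m * 2 ^ q.a) := by positivity
  have e : q.totalEst m v = q.B * (q.B - 1) / 2 * (1 + 1 / (64 * m * 2 ^ q.a)) / v := by
    unfold Params.totalEst; ring
  rw [e]
  set P : ℝ := q.B * (q.B - 1) / 2
  set η : ℝ := 1 / (64 * m * 2 ^ q.a)
  set W := ∑ j, p j
  have hv0 : 0 < v := lt_of_lt_of_le (mul_pos (by linarith) (div_pos hP hW)) h1
  constructor
  · rw [le_div_iff₀ hv0]
    calc W * v ≤ W * ((1 + η) * (P / W)) := by gcongr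
      _ = _ := by field_simp
  · rw [div_le_iff₀ hv0]
    have e2 : 1 + η ≤ (1 + 4 * η) * (1 - η) := by nlinarith
    calc P * (1 + η) ≤ P * ((1 + 4 * η) * (1 - η)) := by gcongr
      _ = (1 + 4 * η) * W * ((1 - η) * (P / W)) := by field_simp
      _ ≤ (1 + ε / (16 * m)) * W * v := by
        have := h.ε_pos
        have : 0 ≤ (1 - η) * (P / W) := mul_nonneg (by linarith) (by positivity)
        gcongr

/-- An order-convex set of jobs is hit about as often as expected, or more often. -/
theorem Good.sum_le (h : Setting q n m ε γ) (G : Good q m p w) (A : Finset (Fin n))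
    (hA : ∀ a ∈ A, ∀ b ∈ A, ∀ j, p a ≤ p j → p j ≤ p b → j ∈ A) (hp : ∀ j, 0 < p j) :
    (∑ j ∈ A, p j) * q.K ≤ (∑ j, p j) * (#{i ∈ range q.K | w i ∈ A} * (1 / (128 * 2 ^ q.a) + 1) +
      (128 * 2 ^ q.a + 1) * q.R) := by
  have hW := h.sum_pos hp
  rcases A.eq_empty_or_nonempty with rfl | hne
  · simp only [sum_empty, zero_mul]; positivity
  · obtain ⟨a, ha, ha'⟩ := exists_min_image A p hne
    obtain ⟨b, hb, hb'⟩ := exists_max_image A p hne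
    have hiff : ∀ j, j ∈ A ↔ p a ≤ p j ∧ p j ≤ p b := fun j =>
      ⟨fun hj => ⟨ha' j hj, hb' j hj⟩, fun hj => hA a ha b hb j hj.1 hj.2⟩
    have h1 := G.interval a b
    have h2 : (univ.filter fun j => p a ≤ p j ∧ p j ≤ p b) = A := by ext j; simp [hiff]
    have h3 : {i ∈ range q.K | p a ≤ p (w i) ∧ p (w i) ≤ p b} = {i ∈ range q.K | w i ∈ A} :=
      filter_congr fun i _ => (hiff _).symm
    rw [h2, h3, ← sum_div, div_mul_eq_mul_div, div_le_iff₀ hW] at h1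
    refine h1.trans (le_of_eq ?_)
    field_simp
    ring

theorem Result.bounds (h : Setting q n m ε γ) (G : Good q m p w) (hp : ∀ j, 0 < p j)
    {v V : ℝ} {f₀ f : ℕ → Fin n} {μ₀ μ : ℕ → ℕ} {N₀ N : ℕ} {s : State}
    (r : Result q m ε p w v V f₀ f μ₀ μ N₀ N s) :
    ∑ j, p j ≤ V ∧ V ≤ (1 + ε / (16 * m)) * ∑ j, p j := by
  rw [r.total]
  exact G.totalEst_bounds h hp r.median

theorem Params.mediumBound_eq (q : Params) (m : ℕ) (ε V : ℝ) :
    q.mediumBound m ε V = Params.bigBound m ε V * (1 - q.δ) ^ ((q.a + 8) * q.D) := by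
  have e : q.s₂ = q.s₁ + (q.a + 8) * q.D := by unfold Params.s₂ Params.s₁; ring
  have := (q.pow_pos q.s₁).ne'
  rw [Params.mediumBound, Params.top, e, pow_add]
  field_simp

theorem Params.smallBound_eq (q : Params) (m : ℕ) (ε V : ℝ) :
    q.top m ε V * (1 - q.δ) ^ q.t =
      Params.bigBound m ε V * (1 - q.δ) ^ ((q.l + q.a + 8) * q.D) := by
  have e : q.t = q.s₁ + (q.l + q.a + 8) * q.D := by unfold Params.t Params.T Params.s₁; ring
  have := (q.pow_pos q.s₁).ne'
  rw [Params.top, e, pow_add]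
  field_simp

/-- All big and medium jobs are sampled. -/
theorem Good.sampled (h : Setting q n m ε γ) (G : Good q m p w) (hp : ∀ j, 0 < p j) {V : ℝ}
    (hV : ∑ j, p j ≤ V) {j : Fin n} (hj : q.mediumBound m ε V < p j) : ∃ i < q.K, w i = j := by
  have hW := h.sum_pos hp
  have hm := h.m_ge
  have hε := h.ε_pos
  have hV0 := hW.trans_le hV
  by_contra! hcon
  have h1 := G.single j
  have h2 : #{i ∈ range q.K | w i = j} = 0 := by
    rw [card_eq_zero, filter_eq_empty_iff]
    exact fun i hi => hcon i (mem_range.1 hi)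
  rw [h2] at h1
  rw [Params.mediumBound_eq] at hj
  have h3 : Params.bigBound m ε V * (1 / 4 ^ (q.a + 8)) < p j := by
    refine lt_of_le_of_lt ?_ hj
    have := q.le_pow_mul_D (q.a + 8)
    have : 0 ≤ Params.bigBound m ε V := by unfold Params.bigBound; positivity
    gcongr
  have h4 : (4 : ℝ) ^ (q.a + 8) = 65536 * (2 ^ q.a * 2 ^ q.a) := by
    rw [pow_add, ← mul_pow]; norm_num; ring
  rw [h4] at h3
  have h5 : Params.bigBound m ε V = ε * V / m := rfl
  have hR : (1 : ℝ) ≤ q.R := by exact_mod_cast h.R_pos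
  have hB := h.mul_le_B
  have hEE : (0 : ℝ) < 2 ^ q.a * 2 ^ q.a := by positivity
  have h6 : ε * (∑ j, p j) < p j * (m * (65536 * (2 ^ q.a * 2 ^ q.a))) := by
    calc ε * (∑ j, p j) ≤ ε * V := by gcongr
      _ = Params.bigBound m ε V * (1 / (65536 * (2 ^ q.a * 2 ^ q.a))) *
          (m * (65536 * (2 ^ q.a * 2 ^ q.a))) := by rw [h5]; field_simp
      _ < _ := by gcongr
  have h7 : (q.K : ℝ) = q.R * q.B := by simp [Params.K]
  rw [h7, Nat.cast_zero, mul_zero, zero_add, div_mul_eq_mul_div, div_le_iff₀ hW] at h1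
  have h8 : p j * q.B ≤ 2 * ∑ j, p j := by
    refine le_of_mul_le_mul_right (a := (q.R : ℝ)) ?_ (by linarith)
    linarith
  have h9 : ε * (∑ j, p j) * 128 * 2 ^ q.a < 2 * ∑ j, p j := by
    calc ε * (∑ j, p j) * 128 * 2 ^ q.a
        < p j * (m * (65536 * (2 ^ q.a * 2 ^ q.a))) * 128 * 2 ^ q.a := by gcongr
      _ = p j * (1048576 * 8 * (2 ^ q.a * 2 ^ q.a * m * 2 ^ q.a)) := by ring
      _ ≤ p j * q.B := mul_le_mul_of_nonneg_left hB (hp j).le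
      _ ≤ _ := h8
  have h10 := h.one_le_mul_a
  nlinarith

end Deterministic

end Makespan

namespace Makespan

open Finset

variable {q : Params} {n m : ℕ} {ε γ : ℝ} {p : Fin n → ℝ} {w : ℕ → Fin n}
  {v V : ℝ} {f₀ f : ℕ → Fin n} {μ₀ μ : ℕ → ℕ} {N₀ N : ℕ} {s : State}

/-- The estimate of the total processing time of the jobs of a class with `c` samples. -/
noncomputable def Params.classEst (q : Params) (V : ℝ) (c : ℕ) : ℝ :=
  (c * (1 / (128 * 2 ^ q.a) + 1) + (128 * 2 ^ q.a + 128 * 2 ^ q.a) * q.R) * V / q.K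

theorem Params.slots_eq (q : Params) (m : ℕ) (ε V φ : ℝ) (c k : ℕ) :
    q.slots m ε V φ c k = φ * q.classEst V c / (q.top m ε V * (1 - q.δ) ^ (k + 1)) := by
  unfold Params.slots Params.classEst; ring

theorem Setting.opt_pos (h : Setting q n m ε γ) (hp : ∀ j, 0 < p j) : 0 < opt m p :=
  pos_of_mul_pos_right ((h.sum_pos hp).trans_le (sum_le_mul_opt h.hm p)) (Nat.cast_nonneg m)

section

variable (h : Setting q n m ε γ) (G : Good q m p w) (hp : ∀ j, 0 < p j)
  (r : Result q m ε p w v V f₀ f μ₀ μ N₀ N s)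
include h G hp r

theorem Result.V_pos : 0 < V := (h.sum_pos hp).trans_le (r.bounds h G hp).1

theorem Result.bigBound_pos : 0 < Params.bigBound m ε V := by
  have := r.V_pos h G hp
  have := h.ε_pos
  have := h.m_ge
  unfold Params.bigBound; positivity

theorem Result.mediumBound_le : q.mediumBound m ε V ≤ Params.bigBound m ε V := by
  rw [Params.mediumBound_eq]
  exact mul_le_of_le_one_right (r.bigBound_pos h G hp).le
    (pow_le_one₀ (by linarith [q.δ_le]) (by linarith [q.δ_pos]))

theorem Result.big_mem {j : Fin n} : (∃ x < N₀, f₀ x = j) ↔ Params.bigBound m ε V < p j := by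
  rw [r.big_iff]
  refine ⟨fun h => h.1, fun hj => ⟨hj, G.sampled h hp (r.bounds h G hp).1 ?_⟩⟩
  exact (r.mediumBound_le h G hp).trans_lt hj

theorem Result.mem {j : Fin n} : (∃ x < N, f x = j) ↔ q.mediumBound m ε V < p j := by
  rw [r.iff, r.big_mem h G hp]
  constructor
  · rintro (hj | hj)
    · exact (r.mediumBound_le h G hp).trans_lt hj
    · exact hj.1
  · exact fun hj => Or.inr ⟨hj, G.sampled h hp (r.bounds h G hp).1 hj⟩

/-- There are few big jobs. -/
theorem Result.card_big_le : N₀ * ε ≤ m := by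
  have hV := r.V_pos h G hp
  have hm := h.m_ge
  have h1 : ∑ x ∈ range N₀, p (f₀ x) ≤ ∑ j, p j := by
    rw [← sum_image (f := p) (g := f₀) (s := range N₀)
      (fun x hx y hy => r.big_inj (by simpa using hx) (by simpa using hy))]
    exact sum_le_sum_of_subset_of_nonneg (subset_univ _) fun i _ _ => (hp i).le
  have h2 : N₀ * Params.bigBound m ε V ≤ ∑ x ∈ range N₀, p (f₀ x) := by
    calc _ = ∑ x ∈ range N₀, Params.bigBound m ε V := by simp
      _ ≤ _ := sum_le_sum fun x hx =>
        ((r.big_mem h G hp).1 ⟨x, mem_range.1 hx, rfl⟩).le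
  have h3 : N₀ * (ε * V / m) ≤ V := h2.trans (h1.trans (r.bounds h G hp).1)
  rw [mul_div_assoc', div_le_iff₀ (by linarith)] at h3
  nlinarith

/-- The condition on the value under which list scheduling keeps all loads below it. -/
theorem Result.list_le :
    (∑ j, p j) / m + (1 - 1 / m) * Params.bigBound m ε V ≤ s.value := by
  refine le_trans ?_ r.listBound_le
  have := (r.bounds h G hp).1
  have := h.m_ge
  unfold Params.listBound
  gcongr

/-- The output value is an upper bound for the minimum makespan. -/
theorem Result.opt_le_value : opt m p ≤ s.value :=
  opt_le_of_partLoad_le h.hm hp (r.list_le h G hp) _ f₀ μ₀ N₀ rfl r.big_inj r.big_lt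
    (fun _ hj => not_lt.1 fun hlt => hj ((r.big_mem h G hp).2 hlt)) r.big_le

theorem Result.V_le : V ≤ (1 + ε / (16 * m)) * (m * opt m p) := by
  have := h.ε_pos
  exact (r.bounds h G hp).2.trans
    (mul_le_mul_of_nonneg_left (sum_le_mul_opt h.hm p) (by positivity))

/-- The output value is a good approximation of the minimum makespan. -/
theorem Result.value_le : s.value ≤ (1 + ε) * opt m p := by
  have hm := h.m_ge
  have hε := h.ε_pos
  have hε1 := h.ε_lt
  have ho := h.opt_pos hp
  rcases r.value with hX | ⟨i, hi, hX⟩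
  · change s.value = _ at hX
    rw [hX, Params.listBound, Params.bigBound]
    have h1 := r.V_le h G hp
    obtain ⟨x, hx⟩ : ∃ x, x = ε / m := ⟨_, rfl⟩
    have hx0 : 0 < x := by rw [hx]; positivity
    have hx1 : x ≤ ε := by rw [hx]; exact div_le_self hε.le hm
    have e1 : ε / (16 * m) = x / 16 := by rw [hx]; field_simp
    have e2 : V / m + (1 - 1 / m) * (ε * V / m) = V / m * (1 + ε - x) := by rw [hx]; ring
    rw [e1] at h1
    have h2 : V / m ≤ (1 + x / 16) * opt m p := by
      rw [div_le_iff₀ (by linarith)]; linarith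
    rw [e2]
    calc V / m * (1 + ε - x) ≤ (1 + x / 16) * opt m p * (1 + ε - x) :=
          mul_le_mul_of_nonneg_right h2 (by linarith)
      _ = ((1 + x / 16) * (1 + ε - x)) * opt m p := by ring
      _ ≤ (1 + ε) * opt m p := by
          refine mul_le_mul_of_nonneg_right ?_ ho.le
          nlinarith
  · obtain ⟨σ, hσ, h1⟩ := r.big_makespan (r.card_big_le h G hp)
    have hinj : Function.Injective fun x : Fin N₀ => f₀ x := fun x y e =>
      Fin.ext (r.big_inj x.2 y.2 e)
    have h2 := opt_comp_le h.hm hp hinj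
    change s.value = _ at hX
    rw [hX]
    have h3 : partLoad p f₀ μ₀ N₀ i = load (fun x : Fin N₀ => p (f₀ x)) σ ⟨i, hi⟩ := by
      rw [load, partLoad, sum_filter, sum_filter, ← Fin.sum_univ_eq_sum_range
        (fun x => if μ₀ x = i then p (f₀ x) else 0)]
      simp only [Fin.ext_iff, hσ]
    rw [h3]
    refine (load_le_makespan σ _).trans (h1.trans ?_)
    gcongr

theorem Result.load_le_value : ∀ i < m, partLoad p f μ N i ≤ s.value :=
  r.load_le s.value r.big_le (r.list_le h G hp)

theorem Result.top_pos : 0 < q.top m ε V :=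
  div_pos (r.bigBound_pos h G hp) (q.pow_pos _)

/-- The largest rounded processing time is an upper bound for the total processing time. -/
theorem Result.le_top (j : Fin n) : p j ≤ q.top m ε V := by
  have hV := r.V_pos h G hp
  have hm := h.m_ge
  have hn := h.n_ge
  have hε := h.ε_pos
  have h1 : p j ≤ V := (single_le_sum (fun i _ => (hp i).le) (mem_univ j)).trans
    (r.bounds h G hp).1
  refine h1.trans ?_
  have h2 := q.pow_mul_D_le q.l
  have h3 := h.l_ge
  have h4 := h.one_le_mul_a
  have h5 : (m : ℝ) * (1 / 2 ^ q.l) ≤ ε := by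
    rw [mul_one_div, div_le_iff₀ (by positivity)]
    calc (m : ℝ) = 1 * m * 1 := by ring
      _ ≤ 64 * n * m * (ε * 2 ^ q.a) := by gcongr; linarith
      _ = ε * (64 * n * m * 2 ^ q.a) := by ring
      _ ≤ _ := by gcongr
  rw [Params.top, le_div_iff₀ (q.pow_pos _), Params.bigBound, le_div_iff₀ (by linarith), Params.s₁]
  calc V * (1 - q.δ) ^ (q.l * q.D) * m ≤ V * (1 / 2 ^ q.l) * m := by gcongr
    _ = V * (m * (1 / 2 ^ q.l)) := by ring
    _ ≤ V * ε := by gcongr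
    _ = _ := by ring

theorem Result.covers : (s.sketch m).Covers p := by
  refine ⟨?_, ?_, fun j => ?_⟩
  · change 0 < s.real 1
    rw [r.real1]; exact q.δ_pos
  · change s.real 1 < 1
    rw [r.real1]; linarith [q.δ_le]
  · change p j ≤ s.real 2
    rw [r.real2]; exact r.le_top h G hp j

end

end Makespan

namespace Makespan

open Finset

variable {q : Params} {n m : ℕ} {ε γ : ℝ} {p : Fin n → ℝ} {w : ℕ → Fin n}
  {v V : ℝ} {f₀ f : ℕ → Fin n} {μ₀ μ : ℕ → ℕ} {N₀ N : ℕ} {s : State}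

theorem Params.s₂_le (q : Params) : q.s₂ ≤ q.t := by
  unfold Params.s₂ Params.t Params.T
  exact Nat.mul_le_mul_right _ (by omega)

theorem Params.t_sub (q : Params) : q.t - q.s₂ = q.l * q.D := by
  unfold Params.s₂ Params.t Params.T
  rw [← Nat.sub_mul]; congr 1; omega

theorem Setting.classEst_pos (h : Setting q n m ε γ) (hV : 0 < V) (c : ℕ) :
    0 < q.classEst V c := by
  have hR : (1 : ℝ) ≤ q.R := by exact_mod_cast h.R_pos
  have hB := h.two_le_B
  have hK : (0 : ℝ) < q.K := by
    simp only [Params.K, Nat.cast_mul]; exact mul_pos (by linarith) (by linarith)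
  unfold Params.classEst
  positivity

section

variable (h : Setting q n m ε γ) (G : Good q m p w) (hp : ∀ j, 0 < p j)
  (r : Result q m ε p w v V f₀ f μ₀ μ N₀ N s)
include h G hp r

/-- For order-convex sets of jobs, the estimate from the samples is an upper bound. -/
theorem Result.sum_le_classEst (A : Finset (Fin n))
    (hA : ∀ a ∈ A, ∀ b ∈ A, ∀ j, p a ≤ p j → p j ≤ p b → j ∈ A) :
    ∑ j ∈ A, p j ≤ q.classEst V #{i ∈ range q.K | w i ∈ A} := by
  have hR : (1 : ℝ) ≤ q.R := by exact_mod_cast h.R_pos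
  have hB := h.two_le_B
  have hK : (0 : ℝ) < q.K := by
    simp only [Params.K, Nat.cast_mul]; exact mul_pos (by linarith) (by linarith)
  have h1 := G.sum_le h A hA hp
  have h2 := (r.bounds h G hp).1
  have h3 := h.sum_pos hp
  rw [Params.classEst, le_div_iff₀ hK]
  refine h1.trans ?_
  rw [mul_comm]
  have : (1 : ℝ) ≤ 128 * 2 ^ q.a := by linarith [q.one_le_a]
  gcongr

theorem Result.classOf_eq_iff (j : Fin n) {k : ℕ} (hk : k < q.t) :
    q.classOf (q.top m ε V) (p j) = k ↔ q.top m ε V * (1 - q.δ) ^ (k + 1) < p j ∧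
      p j ≤ q.top m ε V * (1 - q.δ) ^ k :=
  q.classOf_eq_iff (r.le_top h G hp j) (r.top_pos h G hp).le hk

theorem Result.mem_jobClass {j : Fin n} {k : ℕ} (hk : k < q.t) :
    j ∈ (s.sketch m).jobClass p k ↔ q.classOf (q.top m ε V) (p j) = k := by
  classical
  have e : ∀ k, (s.sketch m).procTime k = q.top m ε V * (1 - q.δ) ^ k := fun k => by
    change s.real 2 * (1 - s.real 1) ^ k = _
    rw [r.real1, r.real2]
  rw [r.classOf_eq_iff h G hp j hk]
  simp only [SketchSchedule.jobClass, mem_filter, mem_univ, true_and, Set.mem_Ioc, e]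

/-- The total processing time of a class is at most its estimate. -/
theorem Result.sum_class_le {k : ℕ} (hk : k < q.t) :
    ∑ j with q.classOf (q.top m ε V) (p j) = k, p j ≤
      q.classEst V #{i ∈ range q.K | q.classOf (q.top m ε V) (p (w i)) = k} := by
  refine (r.sum_le_classEst h G hp _ ?_).trans (le_of_eq ?_)
  · intro a ha b hb j haj hjb
    simp only [mem_filter, mem_univ, true_and, r.classOf_eq_iff h G hp _ hk] at ha hb ⊢
    exact ⟨ha.1.trans_le haj, hjb.trans hb.2⟩
  · simp

theorem Result.sum_medium :
    ∑ i ∈ range m, partLoad p f μ N i = ∑ j with q.mediumBound m ε V < p j, p j := by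
  rw [sum_partLoad r.lt, ← sum_image (f := p) (g := f) (s := range N)
    (fun x hx y hy => r.inj (by simpa using hx) (by simpa using hy))]
  congr 1
  ext j
  rw [mem_filter, ← r.mem h G hp]
  simp

/-- The number of samples in the classes of small jobs. -/
theorem Result.sum_card_small_le :
    ∑ k ∈ Ico q.s₂ q.t, #{i ∈ range q.K | q.classOf (q.top m ε V) (p (w i)) = k} ≤
      #{i ∈ range q.K | ¬ q.mediumBound m ε V < p (w i)} := by
  rw [← card_biUnion]
  · refine card_le_card fun i hi => ?_
    simp only [mem_biUnion, mem_filter, mem_Ico] at hi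
    obtain ⟨k, ⟨hk1, hk2⟩, hi, hc⟩ := hi
    refine mem_filter.2 ⟨hi, not_lt.2 ?_⟩
    exact ((r.classOf_eq_iff h G hp _ hk2).1 hc).2.trans
      (q.mul_pow_le (r.top_pos h G hp).le hk1)
  · intro k _ l _ hkl
    refine disjoint_left.2 ?_
    intro i hi hi'
    exact hkl ((mem_filter.1 hi).2.symm.trans (mem_filter.1 hi').2)

/-- The estimates for the classes of small jobs add up to at most the capacity that remains on the
machines. -/
theorem Result.sum_classEst_le :
    ∑ k ∈ Ico q.s₂ q.t,
        q.classEst V #{i ∈ range q.K | q.classOf (q.top m ε V) (p (w i)) = k} ≤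
      m * (s.value + Params.bigBound m ε V / 8) - ∑ i ∈ range m, partLoad p f μ N i := by
  have hV := r.V_pos h G hp
  have hm := h.m_ge
  have hε := h.ε_pos
  have ha := q.one_le_a
  have hεa := h.one_le_mul_a
  have hR : (1 : ℝ) ≤ q.R := by exact_mod_cast h.R_pos
  have hB0 := h.two_le_B
  have hK' : (q.K : ℝ) = q.R * q.B := by simp [Params.K]
  have hK : (0 : ℝ) < q.K := by rw [hK']; exact mul_pos (by linarith) (by linarith)
  have hW := (r.bounds h G hp).1
  -- the value is at least the average load
  have hX : V ≤ m * s.value := by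
    have h1 := r.listBound_le
    have h2 : 0 ≤ (1 - 1 / (m : ℝ)) * Params.bigBound m ε V := by
      refine mul_nonneg ?_ (r.bigBound_pos h G hp).le
      rw [sub_nonneg, div_le_one (by linarith)]; exact hm
    have h3 : V / m ≤ s.value := by
      unfold Params.listBound at h1
      exact (le_add_of_nonneg_right h2).trans h1
    rwa [div_le_iff₀ (by linarith), mul_comm] at h3
  have hθ : m * (Params.bigBound m ε V / 8) = ε * V / 8 := by
    unfold Params.bigBound; field_simp
  rw [r.sum_medium h G hp, mul_add, hθ]
  -- the big and medium jobs are hit often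
  have hA := G.sum_le h ({j | q.mediumBound m ε V < p j} : Finset (Fin n))
    (fun a ha b _ j haj _ => by
      simp only [mem_filter, mem_univ, true_and] at ha ⊢; linarith) hp
  simp only [mem_filter, mem_univ, true_and] at hA
  set P := ∑ j with q.mediumBound m ε V < p j, p j with hP
  have hP0 : 0 ≤ P := sum_nonneg fun j _ => (hp j).le
  have hcard := card_filter_add_card_filter_not (s := range q.K)
    (fun i => q.mediumBound m ε V < p (w i))
  rw [card_range] at hcard
  have hsum := r.sum_card_small_le h G hp
  set c : ℕ → ℕ := fun k => #{i ∈ range q.K | q.classOf (q.top m ε V) (p (w i)) = k} with hc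
  set x := #{i ∈ range q.K | q.mediumBound m ε V < p (w i)}
  set y := #{i ∈ range q.K | ¬ q.mediumBound m ε V < p (w i)}
  have hcard' : (x : ℝ) + y = q.K := by exact_mod_cast hcard
  have hsum' : ∑ k ∈ Ico q.s₂ q.t, (c k : ℝ) ≤ y := by exact_mod_cast hsum
  set lam : ℝ := 1 / (128 * 2 ^ q.a) with hl
  have hl0 : 0 < lam := by positivity
  have hlε : lam ≤ ε / 128 := by
    rw [hl, div_le_div_iff₀ (by positivity) (by norm_num)]
    linarith
  have hB := h.B_ge
  have hT : (q.l : ℝ) ≤ q.T := by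
    unfold Params.T; push_cast
    linarith [Nat.cast_nonneg (α := ℝ) q.l, Nat.cast_nonneg (α := ℝ) q.a]
  -- the additive errors are small, because there are many samples in a group
  have herr : (128 * 2 ^ q.a + 128 * 2 ^ q.a) * ((q.l * (16 * 2 ^ q.a)) : ℝ) ≤ ε / 256 * q.B := by
    have e1 : (1 : ℝ) ≤ m * √n := one_le_mul_of_one_le_of_one_le hm h.one_le_sqrt
    calc (128 * 2 ^ q.a + 128 * 2 ^ q.a) * ((q.l * (16 * 2 ^ q.a)) : ℝ)
        ≤ (128 * 2 ^ q.a + 128 * 2 ^ q.a) * (q.T * (16 * 2 ^ q.a)) := by gcongr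
      _ = 1 / 256 * (1048576 * 2 ^ q.a * 2 ^ q.a * q.T) * 1 * 1 := by ring
      _ ≤ 1 / 256 * (1048576 * 2 ^ q.a * 2 ^ q.a * q.T) * (ε * 2 ^ q.a) * (m * √n) := by gcongr
      _ = ε / 256 * (1048576 * 2 ^ q.a * 2 ^ q.a * 2 ^ q.a * m * q.T * √n) := by ring
      _ ≤ _ := by gcongr
  have herr2 : 128 * 2 ^ q.a + 1 ≤ ε / 256 * q.B := by
    have e1 := h.mul_le_B
    have e2 : (1 : ℝ) ≤ 2 ^ q.a * 2 ^ q.a * m :=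
      one_le_mul_of_one_le_of_one_le (one_le_mul_of_one_le_of_one_le ha ha) hm
    calc (128 * 2 ^ q.a + 1 : ℝ) ≤ 1 / 256 * (1048576 * 8) * 2 ^ q.a * 1 * 1 := by linarith
      _ ≤ 1 / 256 * (1048576 * 8) * 2 ^ q.a * m * (ε * 2 ^ q.a) := by gcongr
      _ ≤ 1 / 256 * (1048576 * 8) * (2 ^ q.a * 2 ^ q.a) * m * (ε * 2 ^ q.a) := by
          gcongr; nlinarith
      _ = ε / 256 * (1048576 * 8 * (2 ^ q.a * 2 ^ q.a * m * (2 ^ q.a : ℝ))) := by ring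
      _ ≤ _ := by gcongr
  have e0 : ∑ k ∈ Ico q.s₂ q.t, q.classEst V (c k) = ((∑ k ∈ Ico q.s₂ q.t, (c k : ℝ)) * (lam + 1) +
      (128 * 2 ^ q.a + 128 * 2 ^ q.a) * (q.l * (16 * 2 ^ q.a)) * q.R) * V / q.K := by
    simp only [Params.classEst]
    rw [← sum_div, ← sum_mul, sum_add_distrib, ← sum_mul, sum_const, Nat.card_Ico, q.t_sub,
      nsmul_eq_mul, Nat.cast_mul, ← q.D_pos]
    ring
  rw [e0, div_le_iff₀ hK]
  -- in terms of the total processing time, all but `P` of the samples are small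
  have e1 : P * q.K ≤ V * (x * (lam + 1) + (128 * 2 ^ q.a + 1) * q.R) :=
    hA.trans (mul_le_mul_of_nonneg_right hW (by positivity))
  have e2 : (128 * 2 ^ q.a + 128 * 2 ^ q.a) * (q.l * (16 * 2 ^ q.a)) * q.R ≤
      ε / 256 * (q.K : ℝ) := by
    rw [hK']
    calc _ ≤ ε / 256 * q.B * q.R := by gcongr
      _ = _ := by ring
  have e3 : (128 * 2 ^ q.a + 1) * q.R ≤ ε / 256 * (q.K : ℝ) := by
    rw [hK']
    calc (128 * 2 ^ q.a + 1) * (q.R : ℝ) ≤ ε / 256 * q.B * q.R := by gcongr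
      _ = _ := by ring
  have e4 : (∑ k ∈ Ico q.s₂ q.t, (c k : ℝ)) * (lam + 1) ≤ y * (lam + 1) := by gcongr
  have e5 : (y : ℝ) = q.K - x := by linarith
  rw [e5] at e4
  have e6 : lam * q.K ≤ ε / 128 * q.K := by gcongr
  calc ((∑ k ∈ Ico q.s₂ q.t, (c k : ℝ)) * (lam + 1) +
        (128 * 2 ^ q.a + 128 * 2 ^ q.a) * (q.l * (16 * 2 ^ q.a)) * q.R) * V
      ≤ ((q.K - x) * (lam + 1) + ε / 256 * q.K) * V := by gcongr
    _ = V * q.K - V * (x * (lam + 1) + (128 * 2 ^ q.a + 1) * q.R) +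
        V * (lam * q.K + ε / 256 * q.K + (128 * 2 ^ q.a + 1) * q.R) := by ring
    _ ≤ V * q.K - P * q.K + V * (ε / 128 * q.K + ε / 256 * q.K + ε / 256 * q.K) := by gcongr
    _ ≤ (V + ε * V / 8 - P) * q.K := by
        have : 0 ≤ V * (ε * q.K) := by positivity
        linarith
    _ ≤ _ := by gcongr

end

end Makespan

namespace Makespan

open Finset

variable {q : Params} {n m : ℕ} {ε γ : ℝ} {p : Fin n → ℝ} {w : ℕ → Fin n}
  {v V : ℝ} {f₀ f : ℕ → Fin n} {μ₀ μ : ℕ → ℕ} {N₀ N : ℕ} {s : State}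

theorem Params.geom_sum_le (q : Params) (N : ℕ) : ∑ k ∈ range N, (1 - q.δ) ^ k ≤ 1 / q.δ := by
  rw [le_div_iff₀ q.δ_pos]
  have := geom_sum_mul_neg (1 - q.δ) N
  rw [sub_sub_cancel] at this
  linarith [q.pow_pos N]

theorem sum_range_const_sub (m : ℕ) (Y : ℝ) (F : ℕ → ℝ) :
    ∑ i ∈ range m, (Y - F i) = m * Y - ∑ i ∈ range m, F i := by
  rw [sum_sub_distrib, sum_const, card_range, nsmul_eq_mul]

section

variable (h : Setting q n m ε γ) (G : Good q m p w) (hp : ∀ j, 0 < p j)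
  (r : Result q m ε p w v V f₀ f μ₀ μ N₀ N s)
include h G hp r

theorem Result.free_pos {i : ℕ} (hi : i < m) :
    0 < s.value + Params.bigBound m ε V / 8 - partLoad p f μ N i := by
  have := r.load_le_value h G hp i hi
  have := r.bigBound_pos h G hp
  linarith

theorem Result.cap_pos :
    0 < m * (s.value + Params.bigBound m ε V / 8) - ∑ i ∈ range m, partLoad p f μ N i := by
  rw [← sum_range_const_sub]
  exact sum_pos (fun i hi => r.free_pos h G hp (mem_range.1 hi)) ⟨0, mem_range.2 h.hm⟩

/-- The fraction of the jobs of each class of small jobs that is put on machine `i` is proportional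
to the free capacity on this machine. -/
theorem Result.slots_le {i k : ℕ} (hi : i < m) (hk : k < q.t) (hk' : q.s₂ ≤ k) {x : ℝ}
    (hx : x = (s.value + Params.bigBound m ε V / 8 - partLoad p f μ N i) /
      (m * (s.value + Params.bigBound m ε V / 8) - ∑ i ∈ range m, partLoad p f μ N i) *
      q.classEst V #{i ∈ range q.K | q.classOf (q.top m ε V) (p (w i)) = k} /
      (q.top m ε V * (1 - q.δ) ^ (k + 1))) :
    x ≤ s.natArr 0 (i * q.t + k) ∧ s.natArr 0 (i * q.t + k) ≤ x + 1 := by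
  have hcell := r.cell_small i hi k hk hk'
  have hθ := r.bigBound_pos h G hp
  have hV := r.V_pos h G hp
  have hcap := r.cap_pos h G hp
  have hfree := r.free_pos h G hp hi
  have hsum := r.sum_classEst_le h G hp
  have hval := r.value_le h G hp
  have hopt := opt_le_sum h.hm hp
  have hW := (r.bounds h G hp).1
  have ho := h.opt_pos hp
  have hm := h.m_ge
  have hε := h.ε_pos
  have hε1 := h.ε_lt
  rw [Params.slots_eq] at hcell
  change IsCeil q.f ((s.value + Params.bigBound m ε V / 8 - partLoad p f μ N i) /
      (m * (s.value + Params.bigBound m ε V / 8) - ∑ i ∈ range m, partLoad p f μ N i) *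
      q.classEst V #{i ∈ range q.K | q.classOf (q.top m ε V) (p (w i)) = k} /
      (q.top m ε V * (1 - q.δ) ^ (k + 1))) (s.natArr 0 (i * q.t + k)) at hcell
  rw [← hx] at hcell
  have hest := h.classEst_pos hV
    #{i ∈ range q.K | q.classOf (q.top m ε V) (p (w i)) = k}
  have hle : q.classEst V #{i ∈ range q.K | q.classOf (q.top m ε V) (p (w i)) = k} ≤
      m * (s.value + Params.bigBound m ε V / 8) - ∑ i ∈ range m, partLoad p f μ N i :=
    (single_le_sum (f := fun k => q.classEst V #{i ∈ range q.K | q.classOf (q.top m ε V)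
      (p (w i)) = k}) (fun l _ => (h.classEst_pos hV _).le) (mem_Ico.2 ⟨hk', hk⟩)).trans hsum
  set cap := m * (s.value + Params.bigBound m ε V / 8) - ∑ i ∈ range m, partLoad p f μ N i
  set e := q.classEst V #{i ∈ range q.K | q.classOf (q.top m ε V) (p (w i)) = k}
  set fr := s.value + Params.bigBound m ε V / 8 - partLoad p f μ N i with hfr
  have htop := r.top_pos h G hp
  have hpow := q.pow_pos (k + 1)
  refine hcell (by rw [hx]; positivity) ?_
  -- the binary digits suffice
  have h1 : fr / cap * e ≤ fr := by
    rw [div_mul_eq_mul_div, div_le_iff₀ hcap]; gcongr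
  have h2 : fr ≤ 3 * V := by
    have e1 : 0 ≤ partLoad p f μ N i := sum_nonneg fun x _ => (hp _).le
    have e2 : Params.bigBound m ε V ≤ V := by
      unfold Params.bigBound
      rw [div_le_iff₀ (by linarith)]; nlinarith
    have e3 : (1 + ε) * opt m p ≤ 2 * V := by
      have : opt m p ≤ V := hopt.trans hW
      nlinarith
    linarith
  have h3 : ε * V / (m * (65536 * (2 ^ q.l * 2 ^ q.l * (2 ^ q.a * 2 ^ q.a)))) ≤
      q.top m ε V * (1 - q.δ) ^ (k + 1) := by
    have e1 := q.mul_pow_le htop.le (show k + 1 ≤ q.t from hk)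
    refine le_trans ?_ e1
    rw [Params.smallBound_eq]
    have e2 := q.le_pow_mul_D (q.l + q.a + 8)
    have e3 : (4 : ℝ) ^ (q.l + q.a + 8) = 65536 * (2 ^ q.l * 2 ^ q.l * (2 ^ q.a * 2 ^ q.a)) := by
      rw [pow_add, pow_add, ← mul_pow, ← mul_pow]; norm_num; ring
    rw [e3] at e2
    calc _ = Params.bigBound m ε V * (1 / (65536 * (2 ^ q.l * 2 ^ q.l * (2 ^ q.a * 2 ^ q.a)))) := by
          unfold Params.bigBound; field_simp
      _ ≤ _ := by gcongr
  rw [hx, div_le_iff₀ (by positivity)]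
  refine (h1.trans h2).trans ?_
  have h4 : 64 * (m : ℝ) * 2 ^ q.a ≤ 2 ^ q.l := by
    refine le_trans ?_ h.l_ge
    have := h.n_ge
    calc 64 * (m : ℝ) * 2 ^ q.a = 64 * 1 * m * 2 ^ q.a := by ring
      _ ≤ _ := by gcongr
  have h5 := h.one_le_mul_a
  calc 3 * V ≤ 262144 / 65536 * V * 64 * 1 := by linarith
    _ ≤ 262144 / 65536 * V * 64 * (ε * 2 ^ q.a) := by gcongr
    _ = 262144 * 2 ^ q.l * 2 ^ q.l * (64 * m * 2 ^ q.a) * 2 ^ q.a * 2 ^ q.a *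
        (ε * V / (m * (65536 * (2 ^ q.l * 2 ^ q.l * (2 ^ q.a * 2 ^ q.a))))) := by
        field_simp
    _ ≤ 262144 * 2 ^ q.l * 2 ^ q.l * 2 ^ q.l * 2 ^ q.a * 2 ^ q.a *
        (q.top m ε V * (1 - q.δ) ^ (k + 1)) := by gcongr
    _ ≤ 2 ^ (q.f + 1) * (q.top m ε V * (1 - q.δ) ^ (k + 1)) := by
        have := h.f_ge
        gcongr
        rw [pow_succ]
        have : (0 : ℝ) < 2 ^ q.f := by positivity
        linarith

/-- There are enough slots for every class. -/
theorem Result.card_class_le {k : ℕ} (hk : k < q.t) :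
    #{j | q.classOf (q.top m ε V) (p j) = k} ≤ ∑ i ∈ range m, s.natArr 0 (i * q.t + k) := by
  have htop := r.top_pos h G hp
  rcases lt_or_ge k q.s₂ with hk' | hk'
  · rw [sum_congr rfl fun i hi => r.cell_big i (mem_range.1 hi) k hk hk']
    have e : ∀ i ∈ range m, #{x ∈ range N | μ x = i ∧ q.classOf (q.top m ε V) (p (f x)) = k} =
        #{x ∈ {x ∈ range N | q.classOf (q.top m ε V) (p (f x)) = k} | μ x = i} := fun i _ => by
      rw [filter_filter]; simp only [and_comm]
    rw [sum_congr rfl e, ← card_eq_sum_card_fiberwise (fun x hx => ?_)]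
    · refine le_trans (card_le_card (t := ({x ∈ range N | q.classOf (q.top m ε V) (p (f x)) =
        k}).image f) fun j hj => ?_) card_image_le
      have hj := (mem_filter.1 hj).2
      have h1 : q.mediumBound m ε V < p j :=
        (q.mul_pow_le htop.le (show k + 1 ≤ q.s₂ from hk')).trans_lt
          ((r.classOf_eq_iff h G hp j hk).1 hj).1
      obtain ⟨x, hx, rfl⟩ := (r.mem h G hp).2 h1
      exact mem_image.2 ⟨x, mem_filter.2 ⟨mem_range.2 hx, hj⟩, rfl⟩
    · exact mem_coe.2 (mem_range.2 (r.lt x (mem_range.1 (mem_filter.1 hx).1)))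
  · have hpow : 0 < q.top m ε V * (1 - q.δ) ^ (k + 1) := mul_pos htop (q.pow_pos _)
    have h1 : (#{j | q.classOf (q.top m ε V) (p j) = k} : ℝ) *
        (q.top m ε V * (1 - q.δ) ^ (k + 1)) ≤
        q.classEst V #{i ∈ range q.K | q.classOf (q.top m ε V) (p (w i)) = k} := by
      refine le_trans ?_ (r.sum_class_le h G hp hk)
      rw [← nsmul_eq_mul, ← sum_const]
      exact sum_le_sum fun j hj => ((r.classOf_eq_iff h G hp j hk).1 (mem_filter.1 hj).2).1.le
    rw [← le_div_iff₀ hpow] at h1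
    have h2 := sum_le_sum fun i hi => (r.slots_le h G hp (mem_range.1 hi) hk hk' rfl).1
    rw [← sum_div, ← sum_mul, ← sum_div, sum_range_const_sub,
      div_self (r.cap_pos h G hp).ne', one_mul] at h2
    exact_mod_cast h1.trans h2

/-- The slots of the big and medium jobs contribute at most their rounded load. -/
theorem Result.sum_big_le {i : ℕ} (hi : i < m) :
    ∑ k ∈ range q.s₂, s.natArr 0 (i * q.t + k) * (q.top m ε V * (1 - q.δ) ^ k) ≤
      partLoad p f μ N i / (1 - q.δ) := by
  have hδ : 0 < 1 - q.δ := by linarith [q.δ_le]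
  have htop := r.top_pos h G hp
  have e1 : ∀ k ∈ range q.s₂, s.natArr 0 (i * q.t + k) * (q.top m ε V * (1 - q.δ) ^ k) =
      ∑ x ∈ range N with μ x = i, if q.classOf (q.top m ε V) (p (f x)) = k then
        q.top m ε V * (1 - q.δ) ^ k else 0 := fun k hk => by
    have hk := mem_range.1 hk
    rw [r.cell_big i hi k (hk.trans_le q.s₂_le) hk, ← sum_filter, filter_filter, sum_const,
      nsmul_eq_mul]
  rw [sum_congr rfl e1, sum_comm, partLoad, sum_div]
  refine sum_le_sum fun x _ => ?_
  rw [sum_ite_eq]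
  split_ifs with hx
  · rw [mem_range] at hx
    rw [le_div_iff₀ hδ, mul_assoc, ← pow_succ]
    exact ((r.classOf_eq_iff h G hp (f x) (hx.trans_le q.s₂_le)).1 rfl).1.le
  · exact (div_pos (hp _) hδ).le

/-- The slots of the small jobs contribute at most the free capacity, up to rounding. -/
theorem Result.sum_small_le {i : ℕ} (hi : i < m) :
    ∑ k ∈ Ico q.s₂ q.t, s.natArr 0 (i * q.t + k) * (q.top m ε V * (1 - q.δ) ^ k) ≤
      (s.value + Params.bigBound m ε V / 8 - partLoad p f μ N i) / (1 - q.δ) +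
        q.mediumBound m ε V / q.δ := by
  have hδ : 0 < 1 - q.δ := by linarith [q.δ_le]
  have htop := r.top_pos h G hp
  have hcap := r.cap_pos h G hp
  have hfree := r.free_pos h G hp hi
  have hsum := r.sum_classEst_le h G hp
  have e1 : ∀ k ∈ Ico q.s₂ q.t, s.natArr 0 (i * q.t + k) * (q.top m ε V * (1 - q.δ) ^ k) ≤
      (s.value + Params.bigBound m ε V / 8 - partLoad p f μ N i) /
        (m * (s.value + Params.bigBound m ε V / 8) - ∑ i ∈ range m, partLoad p f μ N i) /
        (1 - q.δ) * q.classEst V #{i ∈ range q.K | q.classOf (q.top m ε V) (p (w i)) = k} +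
        q.top m ε V * (1 - q.δ) ^ k := fun k hk => by
    obtain ⟨hk', hk⟩ := mem_Ico.1 hk
    have hpow := q.pow_pos k
    refine (mul_le_mul_of_nonneg_right (r.slots_le h G hp hi hk hk' rfl).2
      (by positivity)).trans (le_of_eq ?_)
    rw [add_mul, one_mul, pow_succ]
    field_simp
  refine (sum_le_sum e1).trans ?_
  rw [sum_add_distrib, ← mul_sum]
  refine add_le_add ?_ ?_
  · calc _ ≤ (s.value + Params.bigBound m ε V / 8 - partLoad p f μ N i) /
        (m * (s.value + Params.bigBound m ε V / 8) - ∑ i ∈ range m, partLoad p f μ N i) /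
        (1 - q.δ) *
        (m * (s.value + Params.bigBound m ε V / 8) - ∑ i ∈ range m, partLoad p f μ N i) := by
          gcongr
      _ = _ := by rw [div_mul_eq_mul_div, div_mul_cancel₀ _ hcap.ne']
  · rw [sum_Ico_eq_sum_range]
    have e2 : ∀ k ∈ range (q.t - q.s₂), q.top m ε V * (1 - q.δ) ^ (q.s₂ + k) =
        q.mediumBound m ε V * (1 - q.δ) ^ k := fun k _ => by
      rw [Params.mediumBound, pow_add, mul_assoc]
    rw [sum_congr rfl e2, ← mul_sum, div_eq_mul_one_div]
    refine mul_le_mul_of_nonneg_left (q.geom_sum_le _) ?_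
    exact mul_nonneg htop.le (q.pow_pos _).le

theorem Result.card_jobClass_le (k : Fin (s.sketch m).t) :
    #((s.sketch m).jobClass p k) ≤ (s.sketch m).total k := by
  have hk : (k : ℕ) < q.t := by
    have := k.2
    change (k : ℕ) < s.nat 0 at this
    rwa [r.nat0] at this
  have e1 : (s.sketch m).total k = ∑ i ∈ range m, s.natArr 0 (i * q.t + k) := by
    rw [← Fin.sum_univ_eq_sum_range (fun i => s.natArr 0 (i * q.t + k)), ← r.nat0]; rfl
  rw [e1]
  refine le_trans (card_le_card fun j hj => ?_) (r.card_class_le h G hp hk)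
  exact mem_filter.2 ⟨mem_univ _, (r.mem_jobClass h G hp hk).1 hj⟩

theorem Result.exists_generates : ∃ σ, (s.sketch m).Generates p σ := by
  refine SketchSchedule.exists_generates h.hm (r.covers h G hp) ?_ (r.card_jobClass_le h G hp)
  change 0 ≤ s.real 2
  rw [r.real2]; exact (r.top_pos h G hp).le

/-- Every schedule generated from the sketch schedule is almost optimal. -/
theorem Result.makespan_le {σ : Fin n → Fin m} (hσ : (s.sketch m).Generates p σ) :
    makespan p σ ≤ (1 + 3 * ε) * opt m p := by
  have htop := r.top_pos h G hp
  have hθ := r.bigBound_pos h G hp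
  have hδ : 0 < 1 - q.δ := by linarith [q.δ_le]
  have hm := h.m_ge
  have hn := h.n_ge
  have hε := h.ε_pos
  have hε1 := h.ε_lt
  have hεa := h.one_le_mul_a
  have ho := h.opt_pos hp
  refine Makespan.makespan_le h.hm fun i => ?_
  have h1 := SketchSchedule.load_le_of_generates (r.covers h G hp)
    (show 0 ≤ s.real 2 by rw [r.real2]; exact htop.le) (r.card_jobClass_le h G hp) hσ i
  have e1 : ∀ k, (s.sketch m).procTime k = q.top m ε V * (1 - q.δ) ^ k := fun k => by
    change s.real 2 * (1 - s.real 1) ^ k = _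
    rw [r.real1, r.real2]
  have e2 : ∑ k : Fin (s.sketch m).t, (s.sketch m).count i k * (s.sketch m).procTime k =
      ∑ k ∈ range q.t, s.natArr 0 (i * q.t + k) * (q.top m ε V * (1 - q.δ) ^ k) := by
    simp only [e1]
    rw [← r.nat0, ← Fin.sum_univ_eq_sum_range
      (fun k => (s.natArr 0 (i * s.nat 0 + k) : ℝ) * (q.top m ε V * (1 - q.δ) ^ k))]
    rfl
  have e3 : (s.sketch m).t = q.t := r.nat0
  rw [e2, e1, e3, ← sum_range_add_sum_Ico _ q.s₂_le] at h1
  have h2 := r.sum_big_le h G hp i.2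
  have h3 := r.sum_small_le h G hp i.2
  have e4 : partLoad p f μ N i / (1 - q.δ) +
      (s.value + Params.bigBound m ε V / 8 - partLoad p f μ N i) / (1 - q.δ) =
      (s.value + Params.bigBound m ε V / 8) / (1 - q.δ) := by
    rw [← add_div]; congr 1; ring
  -- the threshold for big jobs is about `ε` times the optimum
  have hbig : Params.bigBound m ε V ≤ 17 / 16 * ε * opt m p := by
    have e5 := r.V_le h G hp
    have e6 : ε / (16 * m) ≤ 1 / 16 := by
      rw [div_le_div_iff₀ (by positivity) (by norm_num)]; linarith
    rw [Params.bigBound, div_le_iff₀ (by linarith)]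
    calc ε * V ≤ ε * ((1 + ε / (16 * m)) * (m * opt m p)) := by gcongr
      _ ≤ ε * ((1 + 1 / 16) * (m * opt m p)) := by gcongr
      _ = _ := by ring
  have hδε : q.δ ≤ ε / 16 := by
    rw [Params.δ, ← q.D_pos, div_le_div_iff₀ (by positivity) (by norm_num)]
    linarith
  have hmed : q.mediumBound m ε V / q.δ ≤ Params.bigBound m ε V / 16 := by
    rw [Params.mediumBound_eq, div_le_iff₀ q.δ_pos]
    have e5 := q.pow_mul_D_le (q.a + 8)
    calc _ ≤ Params.bigBound m ε V * (1 / 2 ^ (q.a + 8)) := by gcongr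
      _ = _ := by
        rw [Params.δ, ← q.D_pos, pow_add]; field_simp; norm_num
  have hsmall : n * (q.top m ε V * (1 - q.δ) ^ q.t) ≤ Params.bigBound m ε V / 16 := by
    rw [Params.smallBound_eq]
    have e5 := q.pow_mul_D_le (q.l + q.a + 8)
    have e6 : (n : ℝ) * (1 / 2 ^ (q.l + q.a + 8)) ≤ 1 / 16 := by
      rw [mul_one_div, div_le_div_iff₀ (by positivity) (by norm_num), pow_add, pow_add]
      have e7 := h.l_ge
      have e8 := q.one_le_a
      have e9 : (n : ℝ) ≤ 2 ^ q.l := by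
        refine le_trans ?_ e7
        calc (n : ℝ) = 1 * n * 1 * 1 := by ring
          _ ≤ 64 * n * m * 2 ^ q.a := by gcongr; norm_num
      calc (n : ℝ) * 16 ≤ 2 ^ q.l * 16 := by gcongr
        _ = 2 ^ q.l * 1 * 16 := by ring
        _ ≤ 2 ^ q.l * 2 ^ q.a * 2 ^ 8 := by gcongr; norm_num
        _ = _ := by ring
    calc _ ≤ n * (Params.bigBound m ε V * (1 / 2 ^ (q.l + q.a + 8))) := by gcongr
      _ = Params.bigBound m ε V * (n * (1 / 2 ^ (q.l + q.a + 8))) := by ring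
      _ ≤ Params.bigBound m ε V * (1 / 16) := by gcongr
      _ = _ := by ring
  have hval := r.value_le h G hp
  have hY : (s.value + Params.bigBound m ε V / 8) / (1 - q.δ) ≤ (1 + 2 * ε) * opt m p := by
    rw [div_le_iff₀ hδ]
    calc s.value + Params.bigBound m ε V / 8
        ≤ (1 + ε) * opt m p + 17 / 16 * ε * opt m p / 8 := by gcongr
      _ = (1 + ε + 17 / 128 * ε) * opt m p := by ring
      _ ≤ ((1 + 2 * ε) * (1 - ε / 16)) * opt m p := by
          refine mul_le_mul_of_nonneg_right ?_ ho.le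
          nlinarith
      _ = (1 + 2 * ε) * opt m p * (1 - ε / 16) := by ring
      _ ≤ (1 + 2 * ε) * opt m p * (1 - q.δ) := by gcongr
  have : 0 ≤ ε * opt m p := by positivity
  linarith

end

end Makespan

namespace Makespan

open Finset

/-! ### Bounds for the size of the output and for the time -/

theorem log_two_gt_half : 1 / 2 < Real.log 2 := by linarith [Real.log_two_gt_d9]

/-- An exponent is logarithmic if the power is polynomially bounded. -/
theorem exponent_le {k c d : ℕ} {x : ℝ} (hx : 1 ≤ x) (h : (2 : ℝ) ^ k ≤ 2 ^ c * x ^ d) :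
    (k : ℝ) ≤ c + 2 * d * Real.log x := by
  have h1 := Real.log_le_log (by positivity) h
  rw [Real.log_mul (by positivity) (by positivity), Real.log_pow, Real.log_pow, Real.log_pow] at h1
  have h2 := log_two_gt_half
  have h3 : 0 ≤ d * Real.log x := mul_nonneg (Nat.cast_nonneg _) (Real.log_nonneg hx)
  have h4 : (k - c) * Real.log 2 ≤ d * Real.log x := by linarith
  rcases le_or_gt (k : ℝ) c with h5 | h5
  · linarith
  · nlinarith

variable {q : Params} {n m : ℕ} {ε γ : ℝ}

theorem Setting.size_le (h : Setting q n m ε γ) (hmn : 2 ≤ m * n) :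
    ((m * q.t + q.t + 2 : ℕ) : ℝ) ≤
      6600 * ((m : ℝ) ^ 2 / ε ^ 2 * Real.log (m * (n : ℝ) ^ 2)) := by
  have hε := h.ε_pos
  have hε1 := h.ε_lt
  have hm := h.m_ge
  have hn := h.n_ge
  have ha := h.a_le
  have e0 : (2 : ℝ) ≤ m * n := by exact_mod_cast hmn
  have e1 : (2 : ℝ) ≤ m * n ^ 2 := by nlinarith
  have e2 : Real.log 2 ≤ Real.log (m * n ^ 2) := Real.log_le_log (by norm_num) e1
  have e3 := log_two_gt_half
  set y : ℝ := m * n ^ 2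
  have e4 : y ≤ y / ε := by rw [le_div_iff₀ hε]; nlinarith
  have e5 : Real.log (y / ε) ≤ Real.log y + 1 / ε := by
    rw [div_eq_mul_one_div, Real.log_mul (by linarith) (by positivity)]
    linarith [Real.log_le_sub_one_of_pos (show 0 < 1 / ε by positivity)]
  have e6 : (q.l : ℝ) ≤ (8 : ℕ) + 2 * (1 : ℕ) * Real.log (y / ε) := by
    refine exponent_le (by linarith) (h.l_le.trans ?_)
    calc 128 * (n * m * 2 ^ q.a : ℝ) ≤ 128 * (n * m * (2 / ε)) := by gcongr
      _ = 2 ^ 8 * (m * n ^ 1 / ε) ^ 1 := by ring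
      _ ≤ 2 ^ 8 * (m * n ^ 2 / ε) ^ 1 := by gcongr; norm_num
  have e7 : (q.a : ℝ) ≤ (1 : ℕ) + 2 * (1 : ℕ) * Real.log (y / ε) := by
    refine exponent_le (by linarith) (ha.trans ?_)
    calc 2 / ε = 2 ^ 1 * (1 / ε) ^ 1 := by ring
      _ ≤ 2 ^ 1 * (y / ε) ^ 1 := by gcongr; linarith
  have e8 : (q.T : ℝ) = 2 * q.l + q.a + 8 := by simp [Params.T]
  set Λ := Real.log y
  have e9 : Λ ≤ Λ / ε := by rw [le_div_iff₀ hε]; nlinarith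
  have e10 : 1 / ε ≤ 2 * (Λ / ε) := by
    rw [mul_div_assoc']; gcongr; linarith
  have e11 : q.T ≤ 68 * (Λ / ε) := by
    push_cast at e6 e7
    rw [e8]
    linarith
  have e12 : (q.t : ℝ) = 16 * q.T * 2 ^ q.a := by simp [Params.t, Params.D]; ring
  have hΛ : 0 < Λ := by linarith
  have e13 : (q.t : ℝ) ≤ 2176 * (Λ / ε ^ 2) := by
    rw [e12]
    calc 16 * q.T * (2 : ℝ) ^ q.a ≤ 16 * (68 * (Λ / ε)) * (2 / ε) := by gcongr
      _ = _ := by ring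
  have e14 : (2 : ℝ) ≤ m * q.t := by
    rw [e12]
    have := q.T_ge
    have := q.one_le_a
    calc (2 : ℝ) ≤ 1 * (16 * 8 * 1) := by norm_num
      _ ≤ _ := by gcongr
  push_cast
  have e15 : (0 : ℝ) ≤ q.t := Nat.cast_nonneg _
  calc (m : ℝ) * q.t + q.t + 2 ≤ m * q.t + m * q.t + m * q.t := by
        gcongr; exact le_mul_of_one_le_left e15 hm
    _ = 3 * (m * q.t) := by ring
    _ ≤ 3 * (m * (2176 * (Λ / ε ^ 2))) := by gcongr
    _ ≤ 6600 * (m ^ 1 / ε ^ 2 * Λ) := by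
        have : 0 ≤ (m : ℝ) * Λ / ε ^ 2 := by positivity
        have e : 6600 * ((m : ℝ) ^ 1 / ε ^ 2 * Λ) - 3 * (m * (2176 * (Λ / ε ^ 2))) =
          72 * (m * Λ / ε ^ 2) := by ring
        linarith
    _ ≤ _ := by gcongr; norm_num

/-- A bound for the number of steps of the planning program. -/
def Params.planTime (q : Params) : ℕ :=
  5 * (q.a + q.l + q.R + q.b + q.f) + 3 * ((q.l + q.a + 8) + q.T + q.l + q.R + q.s₁ + q.s₂) + 200

/-- All parts of the running time are dominated by one product of parameters. -/
theorem Setting.steps_le_nat (h : Setting q n m ε γ) :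
    q.planTime + q.K + q.mainTime m ≤ 1000 * (q.R * q.K * (m * q.t) * (q.f + 1)) := by
  have hR := h.R_pos
  have hm := h.hm
  have hB : 1 ≤ q.B := Nat.one_le_two_pow
  have hK : q.K = q.R * q.B := rfl
  have hRK : q.R ≤ q.K := Nat.le_mul_of_pos_right _ hB
  have hBK : q.B ≤ q.K := Nat.le_mul_of_pos_left _ hR
  have hK1 : 1 ≤ q.K := hR.trans hRK
  have hb : q.b ≤ q.B := Nat.lt_two_pow_self.le
  have hD : 1 ≤ q.D := Nat.mul_pos (by norm_num) Nat.one_le_two_pow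
  have hT : q.T ≤ q.t := Nat.le_mul_of_pos_right _ hD
  have hT' : q.T = 2 * q.l + q.a + 8 := rfl
  have hs₂ := q.s₂_le
  have hs₁ : q.s₁ ≤ q.s₂ := Nat.mul_le_mul_right _ (by omega)
  have ht1 : 1 ≤ q.t := by omega
  obtain ⟨u, hu⟩ : ∃ u, u = q.R * q.K * (m * q.t) * (q.f + 1) := ⟨_, rfl⟩
  have hf1 : 1 ≤ q.f + 1 := by omega
  have u1 : q.R * q.R ≤ u := by
    calc q.R * q.R = q.R * q.R * (1 * 1) * 1 := by ring
      _ ≤ u := by rw [hu]; gcongr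
  have u2 : q.K * (m * q.t) ≤ u := by
    calc q.K * (m * q.t) = 1 * q.K * (m * q.t) * 1 := by ring
      _ ≤ u := by rw [hu]; gcongr
  have u3 : (m * q.t) * (q.f + 1) ≤ u := by
    calc (m * q.t) * (q.f + 1) = 1 * 1 * (m * q.t) * (q.f + 1) := by ring
      _ ≤ u := by rw [hu]; gcongr
  have v1 : q.K * m ≤ q.K * (m * q.t) := by rw [← mul_assoc]; exact Nat.le_mul_of_pos_right _ ht1
  have v2 : q.K * q.t ≤ q.K * (m * q.t) := by gcongr; exact Nat.le_mul_of_pos_left _ hm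
  have v3 : q.K ≤ q.K * m := Nat.le_mul_of_pos_right _ hm
  have v4 : m ≤ q.K * m := Nat.le_mul_of_pos_left _ hK1
  have v5 : q.t ≤ q.K * q.t := Nat.le_mul_of_pos_left _ hK1
  have v6 : q.f + 1 ≤ (m * q.t) * (q.f + 1) := Nat.le_mul_of_pos_left _ (Nat.mul_pos hm ht1)
  rw [← hu]
  have w1 : q.R * (q.B * 12 + 7) = 12 * q.K + 7 * q.R := by rw [hK]; ring
  have w2 : q.R * (q.R * 5 + 10) = 5 * (q.R * q.R) + 10 * q.R := by ring
  have w3 : q.K * (m * 6 + 17) = 6 * (q.K * m) + 17 * q.K := by ring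
  have w4 : q.K * (q.t * 5 + 10) = 5 * (q.K * q.t) + 10 * q.K := by ring
  have w5 : m * (q.t * (q.f * 6 + 36) + (q.K + q.K) * (q.t * 5 + 13) + 13) =
      6 * (m * q.t * (q.f + 1)) + 30 * (m * q.t) + 10 * (q.K * (m * q.t)) + 26 * (q.K * m) +
        13 * m := by ring
  have v7 : m * q.t ≤ q.K * (m * q.t) := Nat.le_mul_of_pos_left _ hK1
  unfold Params.planTime Params.mainTime
  rw [w1, w2, w3, w4, w5]
  omega

theorem Setting.steps_le (h : Setting q n m ε γ) :
    ((q.planTime + q.K + q.mainTime m : ℕ) : ℝ) ≤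
      1000 * 144 * 2 ^ 29 * 961 * 56 * Real.log (n * m / (ε * γ) + 2) ^ 5 *
        ((m : ℝ) ^ 5 / ε ^ 4 * √(n : ℝ)) := by
  have hε := h.ε_pos
  have hε1 := h.ε_lt
  have hγ := h.γ_pos
  have hγ1 := h.γ_lt
  have hm := h.m_ge
  have hn := h.n_ge
  have ha := h.a_le
  obtain ⟨x, hx⟩ : ∃ x, x = n * m / (ε * γ) + 2 := ⟨_, rfl⟩
  rw [← hx]
  have hεγ : 0 < ε * γ := by positivity
  have hεγ1 : ε * γ ≤ 1 := by nlinarith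
  have hx1 : n * m / (ε * γ) ≤ x := by linarith
  have hx2 : 1 ≤ n * m / (ε * γ) := by
    rw [le_div_iff₀ hεγ]; nlinarith
  have hnx : (n : ℝ) ≤ x := by
    refine le_trans ?_ hx1
    rw [le_div_iff₀ hεγ]
    calc n * (ε * γ) ≤ (n : ℝ) * 1 := by gcongr
      _ ≤ n * m := by gcongr
  have hεx : 1 / ε ≤ x := by
    refine le_trans ?_ hx1
    rw [div_le_div_iff₀ hε hεγ]
    calc 1 * (ε * γ) ≤ 1 * (ε * 1) := by gcongr
      _ = 1 * 1 * ε := by ring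
      _ ≤ n * m * ε := by gcongr
  have hnmx : n * m * (1 / ε) ≤ x := by
    refine le_trans ?_ hx1
    rw [mul_one_div]
    gcongr
    nlinarith
  have hx3 : 3 ≤ x := by linarith
  have hM : 1 ≤ Real.log x := by
    rw [Real.le_log_iff_exp_le (by linarith)]
    linarith [Real.exp_one_lt_d9]
  set M := Real.log x with hMdef
  have hxone : 1 ≤ x := by linarith
  have b1 : (q.l : ℝ) ≤ (8 : ℕ) + 2 * (1 : ℕ) * M := by
    refine exponent_le hxone (h.l_le.trans ?_)
    calc 128 * (n * m * 2 ^ q.a : ℝ) ≤ 128 * (n * m * (2 / ε)) := by gcongr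
      _ = 2 ^ 8 * (n * m * (1 / ε)) ^ 1 := by ring
      _ ≤ 2 ^ 8 * x ^ 1 := by gcongr
  have b2 : (q.a : ℝ) ≤ (1 : ℕ) + 2 * (1 : ℕ) * M := by
    refine exponent_le hxone (ha.trans ?_)
    calc 2 / ε = 2 ^ 1 * (1 / ε) ^ 1 := by ring
      _ ≤ 2 ^ 1 * x ^ 1 := by gcongr
  have b3 : (q.R : ℝ) ≤ (8 : ℕ) + 2 * (2 : ℕ) * M := by
    refine exponent_le hxone (h.R_le.trans ?_)
    calc 128 * (n * (n * m * 2 ^ q.a)) / γ ≤ 128 * (n * (n * m * (2 / ε))) / γ := by gcongr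
      _ = 2 ^ 8 * (n * (n * m / (ε * γ))) := by field_simp; norm_num
      _ ≤ 2 ^ 8 * (x * x) := by gcongr
      _ = _ := by ring
  have b4 : q.f ≤ 19 + 3 * q.l + 2 * q.a := (pow_le_pow_iff_right₀ (by norm_num)).1 h.f_le
  have b4' : (q.f : ℝ) ≤ 19 + 3 * q.l + 2 * q.a := by exact_mod_cast b4
  push_cast at b1 b2 b3
  have b5 : (q.T : ℝ) = 2 * q.l + q.a + 8 := by simp [Params.T]
  have c1 : (q.T : ℝ) ≤ 31 * M := by linarith
  have c2 : (q.R : ℝ) ≤ 12 * M := by linarith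
  have c3 : (q.f : ℝ) + 1 ≤ 56 * M := by linarith
  have c4 : (q.t : ℝ) = 16 * q.T * 2 ^ q.a := by simp [Params.t, Params.D]; ring
  have c5 := h.B_le
  have c6 : (q.K : ℝ) = q.R * q.B := by simp [Params.K]
  have h1 : ((q.planTime + q.K + q.mainTime m : ℕ) : ℝ) ≤
      ((1000 * (q.R * q.K * (m * q.t) * (q.f + 1)) : ℕ) : ℝ) := by
    exact_mod_cast h.steps_le_nat
  refine h1.trans ?_
  push_cast
  rw [c6, c4]
  have ht : (0 : ℝ) ≤ q.T := Nat.cast_nonneg _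
  have hs : (0 : ℝ) ≤ √n := Real.sqrt_nonneg _
  calc 1000 * ((q.R : ℝ) * (q.R * q.B) * (m * (16 * q.T * 2 ^ q.a)) * (q.f + 1))
      ≤ 1000 * ((q.R : ℝ) * (q.R * (2097152 * 2 ^ q.a * 2 ^ q.a * 2 ^ q.a * m * q.T * √n)) *
        (m * (16 * q.T * 2 ^ q.a)) * (q.f + 1)) := by gcongr
    _ = 1000 * 2 ^ 25 * (q.R ^ 2 * q.T ^ 2 * (q.f + 1)) * ((2 ^ q.a) ^ 4 * m ^ 2 * √n) := by ring
    _ ≤ 1000 * 2 ^ 25 * ((12 * M) ^ 2 * (31 * M) ^ 2 * (56 * M)) *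
        ((2 / ε) ^ 4 * m ^ 5 * √n) := by gcongr; norm_num
    _ = _ := by ring

/-- The time bound, including the time of the black box. -/
theorem Setting.time_le (h : Setting q n m ε γ) {a b A : ℕ} (ha : a ≤ q.planTime)
    (hb : b ≤ q.mainTime m + A) :
    ((a + q.K + b : ℕ) : ℝ) ≤ 1000 * 144 * 2 ^ 29 * 961 * 56 *
      Real.log (n * m / (ε * γ) + 2) ^ 5 * ((m : ℝ) ^ 5 / ε ^ 4 * √(n : ℝ) + A) := by
  have h1 := h.steps_le
  have h2 : ((a + q.K + b : ℕ) : ℝ) ≤ ((q.planTime + q.K + q.mainTime m : ℕ) : ℝ) + A := by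
    exact_mod_cast (by omega : a + q.K + b ≤ q.planTime + q.K + q.mainTime m + A)
  have hM : 1 / 2 ≤ Real.log (n * m / (ε * γ) + 2) := by
    have := h.ε_pos
    have := h.γ_pos
    refine log_two_gt_half.le.trans (Real.log_le_log (by norm_num) ?_)
    have : 0 ≤ n * m / (ε * γ) := by positivity
    linarith
  have h3 : (1 : ℝ) ≤ 1000 * 144 * 2 ^ 29 * 961 * 56 * Real.log (n * m / (ε * γ) + 2) ^ 5 := by
    calc (1 : ℝ) ≤ 1000 * 144 * 2 ^ 29 * 961 * 56 * (1 / 2) ^ 5 := by norm_num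
      _ ≤ _ := by gcongr
  have h4 := mul_le_mul_of_nonneg_right h3 (Nat.cast_nonneg (α := ℝ) A)
  rw [mul_add]
  linarith

theorem sampleProb_mono {p : Fin n → ℝ} (hp : ∀ j, 0 < p j) {K : ℕ} {E E' : Set (Fin K → Fin n)}
    (h : E ⊆ E') : sampleProb p K E ≤ sampleProb p K E' :=
  sum_le_sum fun _ _ => Set.indicator_le_indicator_of_subset h (fun _ => prod_nonneg fun _ _ =>
    div_nonneg (hp _).le (sum_nonneg fun j _ => (hp j).le)) _

end Makespan

theorem theorem1 :
    ∃ (alg : SamplingAlgorithm) (C : ℝ) (c : ℕ),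
      ∀ (B : BlackBox) (A : ℕ → ℕ → ℝ → ℕ), B.IsApproximationScheme → B.RunsInTime A →
      ∀ (n m : ℕ) (ε γ : ℝ), 1 ≤ n → 1 ≤ m → 0 < ε → ε < 1 → 0 < γ → γ < 1 →
      ∃ K : ℕ, ∀ p : Fin n → ℝ, (∀ j, 0 < p j) →
      ∃ (out : (Fin K → Fin n) → State) (time : (Fin K → Fin n) → ℕ),
        (∀ ω, alg.Runs B m ε γ p ω (out ω) (time ω)) ∧
        (∀ ω, (time ω : ℝ) ≤ C * Real.log (n * m / (ε * γ) + 2) ^ c *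
          ((m : ℝ) ^ 5 / ε ^ 4 * √(n : ℝ) + A m ⌈(m : ℝ) / ε⌉₊ ε)) ∧
        (2 ≤ m * n → ∀ ω, (((out ω).sketch m).size : ℝ) ≤
          C * ((m : ℝ) ^ 2 / ε ^ 2 * Real.log (m * (n : ℝ) ^ 2))) ∧
        1 - γ ≤ sampleProb p K {ω |
          opt m p ≤ (out ω).value ∧ (out ω).value ≤ (1 + ε) * opt m p ∧
          ((out ω).sketch m).Covers p ∧
          (∃ σ, ((out ω).sketch m).Generates p σ) ∧
          ∀ σ, ((out ω).sketch m).Generates p σ → makespan p σ ≤ (1 + 3 * ε) * opt m p} := by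
  refine ⟨⟨planProg, mainProg⟩, 1000 * 144 * 2 ^ 29 * 961 * 56, 5, ?_⟩
  intro B A hB hA n m ε γ hn hm hε hε1 hγ hγ1
  obtain ⟨q, hq⟩ := Params.exists_valid n m ε γ
  have h : Setting q n m ε γ := ⟨hq, hn, hm, hε, hε1, hγ, hγ1⟩
  obtain ⟨s, a, hs, ha, hst, hnat, hreal⟩ := planProg_spec (B := B) hq
  refine ⟨q.K, fun p hp => ?_⟩
  have hrun : ∀ ω : Fin q.K → Fin n, ∃ s' b, Exec B mainProg (s.loadSamples p ω) s' b ∧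
      b ≤ q.mainTime m + A m ⌈(m : ℝ) / ε⌉₊ ε ∧
      ∃ v V f₀ f μ₀ μ N₀ N, Result q m ε p (extend hn ω) v V f₀ f μ₀ μ N₀ N s' := fun ω => by
    refine mainProg_spec hB hA hm hε hε1 hp (w := extend hn ω) ⟨?_, ?_, ?_⟩ ?_ ?_
    · obtain ⟨⟩ := hst
      constructor <;> assumption
    · intro i hi
      simp [State.loadSamples, State.writeNats, State.writeReals, State.setNatArr,
        State.setRealArr, extend, hi]
    · intro i hi
      simp [State.loadSamples, State.writeNats, State.writeReals, State.setNatArr,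
        State.setRealArr, extend, hi]
    · intro x hx y
      simp [State.loadSamples, State.writeNats, State.writeReals, State.setNatArr,
        State.setRealArr, hx, hnat]
    · intro x hx y
      simp [State.loadSamples, State.writeNats, State.writeReals, State.setNatArr,
        State.setRealArr, hx, hreal]
  choose out b hexec hb v V f₀ f μ₀ μ N₀ N hres using hrun
  refine ⟨out, fun ω => a + q.K + b ω, fun ω => ⟨s, a, b ω, hs, hst.nat2, hexec ω, rfl⟩,
    fun ω => h.time_le ha (hb ω), fun hmn ω => ?_, ?_⟩
  · have e : ((out ω).sketch m).size = m * q.t + q.t + 2 := by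
      change m * (out ω).nat 0 + (out ω).nat 0 + 2 = _
      rw [(hres ω).nat0]
    rw [e]
    refine (h.size_le hmn).trans ?_
    have e1 : (0 : ℝ) ≤ (m : ℝ) ^ 2 / ε ^ 2 * Real.log (m * (n : ℝ) ^ 2) := by
      have := h.m_ge
      have := h.n_ge
      refine mul_nonneg (by positivity) (Real.log_nonneg ?_)
      exact one_le_mul_of_one_le_of_one_le h.m_ge (one_le_pow₀ h.n_ge)
    gcongr
    norm_num
  · refine (sampleProb_good h hp).trans (sampleProb_mono hp fun ω hω => ?_)
    have G : Good q m p (extend hn ω) := hω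
    have r := hres ω
    exact ⟨r.opt_le_value h G hp, r.value_le h G hp, r.covers h G hp,
      r.exists_generates h G hp, fun σ hσ => r.makespan_le h G hp hσ⟩
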